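/- **Theorem 1.3.** Work over $\mathbb C$. For a subset $Y\subset\mathbb P^N$ let $\langle Y\rangle$ be its linear span, let $\sigma_r(Y)$ be the Zariski closure of the union of the spans $\langle y_1,\dots,y_r\rangle$ with $y_1,\dots,y_r\in Y$, and let $I(Y)$ be its homogeneous ideal. Let $v_d:\mathbb P V\to\mathbb P(S^dV)$ be the $d$-th Veronese embedding, where $\mathbb P V=\mathbb P^n$. For a variety $X\subset\mathbb P^n$, consider, for given $q$ and $r$, the following properties: * (a) $\sigma_r(v_d(X))\neq\sigma_r(v_d(\mathbb P^n))\cap\langle v_d(X)\rangle$ as sets; * (b) $\sigma_r(v_d(X))$ is not the zero set of any collection of homogeneous polynomials of degree at most $q$ on $\mathbb P(S^dV)$. Then: 1. For all integers $q\ge 0$ and $r\ge 2$ there are $n$ and an irreducible, singular variety $X\subset\mathbb P^n$ such that (a) and (b) hold for all $d\ge 2r-1$. 2. Explicit curves: let $k\ge 4$, let $C\subset\mathbb P^{k+2}$ be the rational normal curve, let $p_1,\dots,p_k\in C$ be distinct points, and let $H\cong\mathbb P^{k-2}$ be a hyperplane of $\langle p_1,\dots,p_k\rangle\cong\mathbb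 P^{k-1}$ containing none of the $p_i$. Let $X\subset\mathbb P^3$ be the image of $C$ under the projection $\mathbb P^{k+2}\setminus H\to\mathbb P^3$ from $H$. Then $X$ is an irreducible singular curve such that for all $r\ge2$ and $d\ge 2r-1$, (a) holds, and (b) holds for every $q<\binom k2$. 3. Complete intersections: for every integer $q\ge0$ there are integers $s,s'\ge1$, $t,t'\ge2$ and homogeneous polynomials $g,g',h,h'\in\mathbb C[x_1,x_2,x_3]$ of respective degrees $t,\,t',\,s+t,\,s'+t'$ such that, with $f=x_0^sg+h$ and $f'=x_0^{s'}g'+h'$, the set $X=\{f=f'=0\}\subset\mathbb P^3$ is an irreducible singular curve with $I(X)=(f,f')$ (so $X$ is a reduced complete intersection), and (a) and (b) hold for all $r\ge2$ and $d\ge2r-1$. 4. All curves $X$ in 2, and curves $X$ as in 3 for every $q$, are counter-examples to the Eisenbud–Koh–Stillman (EKS) conjecture with $L_1=L_2=\mathcal O_X(1)$, that is: let $I(\mathrm{Rank}_r(L_1^a,L_2^b))$ be the ideal in the coordinate ring of $\mathbb P(S^{a+b}V)$ generated by the linear forms vanishing on $v_{a+b}(X)$ and by the $(r+1)\times(r+1)$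 minors of the catalecticant matrix, i.e. the matrix of the multiplication $S^aV^*\otimes S^bV^*\to S^{a+b}V^*$ in monomial bases with entries read as linear forms on $S^{a+b}V$. Then there is no function $r_0(a,b)$ with $r_0(a,b)\to\infty$ as $a,b\to\infty$ such that $I(\sigma_r(v_{a+b}(X)))=I(\mathrm{Rank}_r(L_1^a,L_2^b))$ for all $a,b$ and all $r$ with $1\le r\le r_0(a,b)$. -/

import Mathlib

open scoped LinearAlgebra.Projectivization

/-- Complex projective space with homogeneous coordinates indexed by `σ`;
`PSpace (Fin (n + 1))` is `n`-dimensional projective space. -/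
abbrev PSpace (σ : Type) : Type := ℙ ℂ (σ → ℂ)

/-- Vanishing of a polynomial at a point of projective space. It is only used for homogeneous `F`,
for which it does not depend on the chosen representative of the point. -/
def VanishesAt {σ : Type} (F : MvPolynomial σ ℂ) (x : PSpace σ) : Prop :=
  MvPolynomial.eval x.rep F = 0

/-- The common zeros in projective space of a set of (homogeneous) polynomials. -/
def zeroLocus {σ : Type} (E : Set (MvPolynomial σ ℂ)) : Set (PSpace σ) :=
  {x | ∀ F ∈ E, VanishesAt F x}

/-- A closed algebraic subset: the zero locus of a set of homogeneous polynomials. -/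
def IsAlgebraicSet {σ : Type} (Z : Set (PSpace σ)) : Prop :=
  ∃ E : Set (MvPolynomial σ ℂ), (∀ F ∈ E, ∃ m, F.IsHomogeneous m) ∧ Z = zeroLocus E

theorem isAlgebraicSet_empty {σ : Type} : IsAlgebraicSet (∅ : Set (PSpace σ)) := by
  refine ⟨{1}, ?_, ?_⟩
  · rintro F rfl
    exact ⟨0, MvPolynomial.isHomogeneous_one σ ℂ⟩
  · ext x
    simp [zeroLocus, VanishesAt]

theorem isAlgebraicSet_sInter {σ : Type} (A : Set (Set (PSpace σ)))
    (hA : A ⊆ {Z | IsAlgebraicSet Z}) : IsAlgebraicSet (⋂₀ A) := by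
  refine ⟨{F | (∃ m, F.IsHomogeneous m) ∧ ∃ Z ∈ A, ∀ x ∈ Z, VanishesAt F x},
    fun F hF => hF.1, ?_⟩
  ext x
  constructor
  · rintro hx F ⟨-, Z, hZ, hF⟩
    exact hF x (hx Z hZ)
  · intro hx Z hZ
    obtain ⟨E, hE, rfl⟩ := hA hZ
    intro F hF
    exact hx F ⟨hE F hF, _, hZ, fun y hy => hy F hF⟩

theorem isAlgebraicSet_union {σ : Type} {Y Z : Set (PSpace σ)} (hY : IsAlgebraicSet Y)
    (hZ : IsAlgebraicSet Z) : IsAlgebraicSet (Y ∪ Z) := by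
  obtain ⟨E, hE, rfl⟩ := hY
  obtain ⟨E', hE', rfl⟩ := hZ
  refine ⟨{H | ∃ F ∈ E, ∃ G ∈ E', H = F * G}, ?_, ?_⟩
  · rintro H ⟨F, hF, G, hG, rfl⟩
    obtain ⟨m, hm⟩ := hE F hF
    obtain ⟨m', hm'⟩ := hE' G hG
    exact ⟨m + m', hm.mul hm'⟩
  · ext x
    constructor
    · rintro (hx | hx) H ⟨F, hF, G, hG, rfl⟩
      · have h := hx F hF
        simp only [VanishesAt] at h ⊢
        simp [h]
      · have h := hx G hG
        simp only [VanishesAt] at h ⊢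
        simp [h]
    · intro hx
      by_contra hcon
      simp only [Set.mem_union, zeroLocus, Set.mem_ofPred_eq, not_or, not_forall] at hcon
      obtain ⟨⟨F, hF, hFx⟩, G, hG, hGx⟩ := hcon
      have h := hx (F * G) ⟨F, hF, G, hG, rfl⟩
      simp only [VanishesAt, map_mul, mul_eq_zero] at h hFx hGx
      tauto

/-- The Zariski topology on projective space: the closed sets are the zero loci of sets of
homogeneous polynomials. -/
instance zariskiTopology (σ : Type) : TopologicalSpace (PSpace σ) :=
  TopologicalSpace.ofClosed {Z | IsAlgebraicSet Z} isAlgebraicSet_empty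
    isAlgebraicSet_sInter (fun _ hY _ hZ => isAlgebraicSet_union hY hZ)

/-- A (projective) variety: an irreducible Zariski closed subset of projective space. -/
def IsVariety {σ : Type} (X : Set (PSpace σ)) : Prop :=
  IsClosed X ∧ IsIrreducible X

/-- The homogeneous ideal `I(Y)` of a subset `Y` of projective space, generated by the homogeneous
polynomials that vanish on `Y`. -/
noncomputable def homogeneousIdeal {σ : Type} (Y : Set (PSpace σ)) : Ideal (MvPolynomial σ ℂ) :=
  Ideal.span {F | ∃ m, F.IsHomogeneous m ∧ ∀ x ∈ Y, VanishesAt F x}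

/-- The embedded Zariski tangent space of `X` at `x`, as the linear subspace of the ambient vector
space given by `dF_x(v) = 0` for all homogeneous `F` vanishing on `X`. -/
def affineTangentSpace {σ : Type} [Fintype σ] (X : Set (PSpace σ)) (x : PSpace σ) :
    Submodule ℂ (σ → ℂ) where
  carrier := {v | ∀ (F : MvPolynomial σ ℂ) (m : ℕ), F.IsHomogeneous m →
    (∀ y ∈ X, VanishesAt F y) →
      ∑ i, MvPolynomial.eval x.rep (MvPolynomial.pderiv i F) * v i = 0}
  add_mem' := by
    intro v w hv hw F m hF hX
    simp only [Pi.add_apply, mul_add, Finset.sum_add_distrib, hv F m hF hX, hw F m hF hX, add_zero]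
  zero_mem' := by
    intro F m _ _
    simp
  smul_mem' := by
    intro c v hv F m hF hX
    have h : ∑ i, MvPolynomial.eval x.rep (MvPolynomial.pderiv i F) * (c • v) i
        = c * ∑ i, MvPolynomial.eval x.rep (MvPolynomial.pderiv i F) * v i := by
      rw [Finset.mul_sum]
      refine Finset.sum_congr rfl fun i _ => ?_
      simp only [Pi.smul_apply, smul_eq_mul]
      ring
    rw [h, hv F m hF hX, mul_zero]

/-- A variety is singular if at some point the dimension of its embedded projective tangent space
(one less than that of `affineTangentSpace`) exceeds the dimension of the variety. -/
def IsSingularVariety {σ : Type} [Fintype σ] (X : Set (PSpace σ)) : Prop :=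
  IsVariety X ∧ ∃ x ∈ X,
    topologicalKrullDim X + 1 < (Module.finrank ℂ (affineTangentSpace X x) : WithBot ℕ∞)

/-- The vector of all monomials of degree `d` in the coordinates of `v`. -/
def veroneseVec {σ : Type} (d : ℕ) (v : σ → ℂ) : Sym σ d → ℂ :=
  fun s => ((s : Multiset σ).map v).prod

theorem veroneseVec_ne_zero {σ : Type} (d : ℕ) {v : σ → ℂ} (hv : v ≠ 0) :
    veroneseVec d v ≠ 0 := by
  obtain ⟨i, hi⟩ := Function.ne_iff.mp hv
  intro h
  have h1 := congrFun h (Sym.replicate d i)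
  simp only [veroneseVec, Sym.coe_replicate, Multiset.map_replicate, Multiset.prod_replicate,
    Pi.zero_apply] at h1
  exact pow_ne_zero d hi h1

theorem veroneseVec_smul {σ : Type} (d : ℕ) (t : ℂ) (v : σ → ℂ) :
    veroneseVec d (t • v) = t ^ d • veroneseVec d v := by
  ext s
  simp [veroneseVec, Multiset.prod_map_mul]

/-- The `d`-th Veronese embedding `v_d`, in the coordinates given by all monomials of degree `d`;
the target is the projective space of `S^d V`. -/
noncomputable def veronese {σ : Type} (d : ℕ) : PSpace σ → PSpace (Sym σ d) :=
  Projectivization.lift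
    (fun v : {v : σ → ℂ // v ≠ 0} =>
      Projectivization.mk ℂ (veroneseVec d v.1) (veroneseVec_ne_zero d v.2))
    (by
      rintro ⟨a, ha⟩ ⟨b, hb⟩ t h
      change a = t • b at h
      refine (Projectivization.mk_eq_mk_iff' ℂ _ _ _ _).mpr ⟨t ^ d, ?_⟩
      change t ^ d • veroneseVec d b = veroneseVec d a
      rw [h, veroneseVec_smul])

/-- The `r`-th secant variety `σ_r(Y)`: the Zariski closure of the union of the linear spans of
`r`-tuples of points of `Y`. -/
def secantVariety {σ : Type} (r : ℕ) (Y : Set (PSpace σ)) : Set (PSpace σ) :=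
  closure {p | ∃ y : Fin r → PSpace σ, (∀ i, y i ∈ Y) ∧
    p ∈ Projectivization.Subspace.span (Set.range y)}

/-- The linear span of a subset of projective space. -/
def linearSpan {σ : Type} (Y : Set (PSpace σ)) : Set (PSpace σ) :=
  (Projectivization.Subspace.span Y : Set (PSpace σ))

/-- `Y` is cut out set-theoretically by (homogeneous) equations of degree at most `q`. -/
def IsCutOutInDegreeLE {σ : Type} (q : ℕ) (Y : Set (PSpace σ)) : Prop :=
  ∃ E : Set (MvPolynomial σ ℂ), (∀ F ∈ E, ∃ m ≤ q, F.IsHomogeneous m) ∧ Y = zeroLocus E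

/-- The generic catalecticant matrix: the matrix of the multiplication
`S^a V^* ⊗ S^b V^* → S^(a+b) V^*` in the monomial bases, with entries in `Sym (S^(a+b) V^*)`. -/
noncomputable def catalecticant (σ : Type) (a b : ℕ) :
    Matrix (Sym σ a) (Sym σ b) (MvPolynomial (Sym σ (a + b)) ℂ) :=
  Matrix.of fun s t => MvPolynomial.X (s.append t)

/-- The ideal `I(Rank_r(L^a, L^b))` for `L = O_X(1)`: it is generated by the `r + 1` by `r + 1`
minors of the multiplication matrix, restricted to the linear span of `v_(a+b)(X)`. It is written
as an ideal of the coordinate ring of the whole `P(S^(a+b) V)`, so that the linear forms vanishing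
on `v_(a+b)(X)` are among its generators. -/
noncomputable def rankIdeal {σ : Type} (r a b : ℕ) (X : Set (PSpace σ)) :
    Ideal (MvPolynomial (Sym σ (a + b)) ℂ) :=
  Ideal.span
    ({M | ∃ (f : Fin (r + 1) → Sym σ a) (g : Fin (r + 1) → Sym σ b),
        M = ((catalecticant σ a b).submatrix f g).det} ∪
      {F | F.IsHomogeneous 1 ∧ ∀ y ∈ veronese (a + b) '' X, VanishesAt F y})

/-- The assertion of the Eisenbud--Koh--Stillman conjecture for an embedded curve `X` and the line
bundles `L₁ = L₂ = O_X(1)`: there is a bound `r₀ (a, b)`, tending to infinity with `a` and `b`,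
such that `I(σ_r(v_(a+b)(X))) = I(Rank_r(L₁^a, L₂^b))` for all `1 ≤ r ≤ r₀ (a, b)`. For large `a`
and `b` the embedding of `X` by the complete linear system of `L₁^a ⊗ L₂^b` is the one
by `v_(a+b)` into the linear span of its image, and small `a`, `b` play no role here. -/
def EKSHolds {σ : Type} (X : Set (PSpace σ)) : Prop :=
  ∃ r₀ : ℕ × ℕ → ℕ, Filter.Tendsto r₀ (Filter.atTop ×ˢ Filter.atTop) Filter.atTop ∧
    ∀ a b r : ℕ, 1 ≤ r → r ≤ r₀ (a, b) →
      homogeneousIdeal (secantVariety r (veronese (a + b) '' X)) = rankIdeal r a b X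

/-- The rational normal curve of degree `n` in `n`-dimensional projective space. -/
noncomputable def rationalNormalCurve (n : ℕ) : Set (PSpace (Sym (Fin 2) n)) :=
  Set.range (veronese (σ := Fin 2) n)

/-- The image of `C` under the linear projection induced by `L`, whose centre is the projective
space of the kernel of `L` (points of `C` in the centre have no image). -/
def projectedImage {σ τ : Type} (L : (σ → ℂ) →ₗ[ℂ] (τ → ℂ)) (C : Set (PSpace σ)) :
    Set (PSpace τ) :=
  {x | ∃ c ∈ C, ∃ h : L c.rep ≠ 0, x = Projectivization.mk ℂ (L c.rep) h}

/-! ### The Veronese map and its derivative over an arbitrary ring -/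

/-! Write `D_v` for the derivative at `x` of `u ↦ u ^ d` in the direction `v`. All examples are
curves `X` in `P^3` with a point `x` at which several smooth branches meet, such that `x` and the
finite set `T` of tangent vectors span `ℂ^4` (`IsMultibranchPoint`). Put `r = m + 2` and consider `P
= D_v + ∑ y_j ^ d` with distinct points `y_1, …, y_m` of `X` other than `x`.

The point `P` lies on `σ_r` of the Veronese variety, since `D_v` is a limit of combinations of two
powers. It also lies in the span of `v_d(X)`: the vectors `D_τ` with `τ ∈ T` are limits of
difference quotients along `X`, and with `x ^ d` they generate all `D_v`. If `v` belongs to some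
`⟨x, τ, τ'⟩`, then moving two points along arcs with suitable velocities shows that `P` is even in
`σ_r(v_d(X))` (`isSecantVec_of_isArcTangent`).

The converse is the heart of the proof. A point of the Zariski closure is a specialization along a
valuation ring (`exists_place`), so `P` is the reduction of a sum `∑ c_i A_i ^ d` of `r` powers of
points of `X`. A product of `d` linear forms that kills all `A_i` must kill `P`. For `d ≥ 2r - 1`
there is room to choose such products so that one `A_i` is forced to specialize to each `y_j`, the
other two to specialize to `x`, and the limit of their secant line to contain `v`
(`exists_secant_limit`). Smoothness of the branches puts this limit inside some `⟨x, τ, τ'⟩`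
(`SmoothBranches.exists_tangents`): two points on branches with different tangents give a
combination of `x, τ, τ'`, and two points with the same tangent give `⟨x, τ⟩`.

Property (a) follows by taking `v` outside the finitely many proper subspaces `⟨x, τ, τ'⟩`. For (b),
a line through such a `v` meets `N` different planes `⟨x, τ, τ'⟩` in `N` different points. An
equation of `σ_r(v_d(X))` of degree less than `N` vanishes at the corresponding points of a line in
`P(S^d V)`, hence on the whole line and at `P`. For EKS, take `r = 2`: the catalecticant of `D_v` is
a sum of two matrices of rank one, so the minors and the linear equations vanish at `D_v`, while
some equation of `σ_2(v_d(X))` does not.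

There are two sources of such curves. The equations `x_0 (x_i ^ n - x_3 ^ n) + x_i ^ (n + 1) = 0`,
with exponents `n` for `i = 1` and `2` for `i = 2`, have branches `x_1 ≈ ζ x_3`, `x_2 ≈ ± x_3` at
`[1:0:0:0]`; coprimality of `n + 1` and `3` makes their ideal prime (`branchIdeal_isPrime`). The
projections of rational normal curves identify `k` points, and each of the `k.choose 2` pairs of the
resulting branches spans its own plane (`exists_isMultipointParam`, `exists_planes`). -/

namespace SecantVeronese

open Polynomial in
/-- The first order term of `∏ (x i + ε v i)` over a multiset of indices. -/
noncomputable def multisetDeriv {σ R : Type*} [CommRing R] (x v : σ → R) (m : Multiset σ) : R :=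
  ((m.map fun i => C (x i) + X * C (v i)).prod).coeff 1

section multisetDeriv

variable {σ R S : Type*} [CommRing R] [CommRing S] (x v w : σ → R)

open Polynomial in
theorem coeff_zero_prod (m : Multiset σ) :
    ((m.map fun i => C (x i) + X * C (v i)).prod).coeff 0 = (m.map x).prod := by
  rw [coeff_zero_eq_eval_zero, eval_multiset_prod, Multiset.map_map]
  simp

theorem multisetDeriv_zero : multisetDeriv x v 0 = 0 := by
  simp [multisetDeriv, Polynomial.coeff_one]

theorem multisetDeriv_add (m n : Multiset σ) :
    multisetDeriv x v (m + n)
      = multisetDeriv x v m * (n.map x).prod + (m.map x).prod * multisetDeriv x v n := by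
  simp only [multisetDeriv, Multiset.map_add, Multiset.prod_add, Polynomial.mul_coeff_one,
    coeff_zero_prod]
  ring

theorem multisetDeriv_singleton (a : σ) : multisetDeriv x v {a} = v a := by
  simp [multisetDeriv]

theorem multisetDeriv_cons (a : σ) (m : Multiset σ) :
    multisetDeriv x v (a ::ₘ m) = v a * (m.map x).prod + x a * multisetDeriv x v m := by
  rw [← Multiset.singleton_add, multisetDeriv_add, multisetDeriv_singleton]
  simp

theorem multisetDeriv_add_right (m : Multiset σ) :
    multisetDeriv x (v + w) m = multisetDeriv x v m + multisetDeriv x w m := by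
  induction m using Multiset.induction with
  | empty => simp [multisetDeriv_zero]
  | cons a m ih =>
    simp only [multisetDeriv_cons, ih, Pi.add_apply]
    ring

theorem multisetDeriv_smul_right (c : R) (m : Multiset σ) :
    multisetDeriv x (c • v) m = c * multisetDeriv x v m := by
  induction m using Multiset.induction with
  | empty => simp [multisetDeriv_zero]
  | cons a m ih =>
    simp only [multisetDeriv_cons, ih, Pi.smul_apply, smul_eq_mul]
    ring

theorem multisetDeriv_self (m : Multiset σ) :
    multisetDeriv x x m = m.card * (m.map x).prod := by
  induction m using Multiset.induction with
  | empty => simp [multisetDeriv_zero]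
  | cons a m ih =>
    simp only [multisetDeriv_cons, ih, Multiset.map_cons, Multiset.prod_cons, Multiset.card_cons,
      Nat.cast_add, Nat.cast_one]
    ring

theorem map_multisetDeriv (f : R →+* S) (m : Multiset σ) :
    f (multisetDeriv x v m) = multisetDeriv (f ∘ x) (f ∘ v) m := by
  induction m using Multiset.induction with
  | empty => simp [multisetDeriv_zero]
  | cons a m ih =>
    simp [multisetDeriv_cons, ih, map_multiset_prod]

end multisetDeriv

/-- The vector of monomials of degree `d`, over an arbitrary ring. -/
def ver {σ R : Type*} [CommRing R] (d : ℕ) (x : σ → R) : Sym σ d → R :=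
  fun s => ((s : Multiset σ).map x).prod

/-- The derivative at `x` in direction `v` of the vector of monomials of degree `d`. -/
noncomputable def verDeriv {σ R : Type*} [CommRing R] (d : ℕ) (x v : σ → R) : Sym σ d → R :=
  fun s => multisetDeriv x v s

theorem veroneseVec_eq_ver {σ : Type} (d : ℕ) (x : σ → ℂ) : veroneseVec d x = ver d x := rfl

/-! ### Powers of vectors paired with products of linear forms -/

section pairing

variable {σ R S : Type*} [CommRing R] [CommRing S] {d : ℕ}

theorem map_ver (f : R →+* S) (x : σ → R) (s : Sym σ d) : f (ver d x s) = ver d (f ∘ x) s := by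
  simp [ver, map_multiset_prod]

theorem ver_smul (c : R) (x : σ → R) : ver d (c • x) = c ^ d • ver d x := by
  ext s
  simp [ver, Multiset.prod_map_mul]

theorem verDeriv_add (x v w : σ → R) : verDeriv d x (v + w) = verDeriv d x v + verDeriv d x w :=
  funext fun _ => multisetDeriv_add_right _ _ _ _

theorem verDeriv_smul (c : R) (x v : σ → R) : verDeriv d x (c • v) = c • verDeriv d x v :=
  funext fun _ => multisetDeriv_smul_right _ _ _ _

theorem verDeriv_sub (x v w : σ → R) : verDeriv d x (v - w) = verDeriv d x v - verDeriv d x w := by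
  rw [sub_eq_add_neg, ← neg_one_smul R w, verDeriv_add, verDeriv_smul, neg_one_smul,
    ← sub_eq_add_neg]

theorem verDeriv_self (x : σ → R) : verDeriv d x x = (d : R) • ver d x := by
  ext s
  simp [verDeriv, multisetDeriv_self, ver]

theorem map_verDeriv (f : R →+* S) (x v : σ → R) (s : Sym σ d) :
    f (verDeriv d x v s) = verDeriv d (f ∘ x) (f ∘ v) s :=
  map_multisetDeriv _ _ _ _

/-- The element of `Sym σ d` given by a function on `Fin d`. -/
def symOf (f : Fin d → σ) : Sym σ d := ⟨Finset.univ.val.map f, by simp⟩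

variable [Fintype σ]

/-- The value of the degree `d` form `∏ k, w k` (a product of linear forms) on a vector of the
`d`-th symmetric power. -/
noncomputable def pair (w : Fin d → σ → R) (z : Sym σ d → R) : R :=
  ∑ f : Fin d → σ, (∏ k, w k (f k)) * z (symOf f)

/-- Expanding the product of the linear forms indexes the terms by functions `Fin d → σ`; summing
over functions instead of multisets in `pair` absorbs the multinomial coefficients. -/
theorem pair_ver (w : Fin d → σ → R) (x : σ → R) : pair w (ver d x) = ∏ k, (w k ⬝ᵥ x) := by
  classical
  simp only [dotProduct, Finset.prod_univ_sum, Fintype.piFinset_univ, pair]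
  refine Finset.sum_congr rfl fun f _ => ?_
  rw [Finset.prod_mul_distrib]
  congr 1
  simp [ver, symOf, List.prod_ofFn]

theorem pair_add (w : Fin d → σ → R) (z z' : Sym σ d → R) :
    pair w (z + z') = pair w z + pair w z' := by
  simp [pair, mul_add, Finset.sum_add_distrib]

theorem pair_sum {ι : Type*} (s : Finset ι) (w : Fin d → σ → R) (z : ι → Sym σ d → R) :
    pair w (∑ i ∈ s, z i) = ∑ i ∈ s, pair w (z i) := by
  simp only [pair, Finset.sum_apply, Finset.mul_sum]
  exact Finset.sum_comm

theorem pair_smul (w : Fin d → σ → R) (c : R) (z : Sym σ d → R) :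
    pair w (c • z) = c * pair w z := by
  simp only [pair, Pi.smul_apply, smul_eq_mul, Finset.mul_sum]
  exact Finset.sum_congr rfl fun _ _ => by ring

theorem map_pair (f : R →+* S) (w : Fin d → σ → R) (z : Sym σ d → R) :
    f (pair w z) = pair (fun k => f ∘ w k) (f ∘ z) := by
  simp [pair, map_sum, map_prod]

-- Apply `pair_ver` over `R[X]` to the vector `x + X v` and compare the coefficients of `X`.
open Polynomial in
theorem pair_verDeriv (w : Fin d → σ → R) (x v : σ → R) :
    pair w (verDeriv d x v)
      = multisetDeriv (fun l : σ → R => l ⬝ᵥ x) (fun l => l ⬝ᵥ v) (Finset.univ.val.map w) := by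
  have h := pair_ver (fun k => C ∘ w k) (fun i => C (x i) + X * C (v i))
  have h2 := congrArg (fun p : R[X] => p.coeff 1) h
  simp only [pair, finsetSum_coeff] at h2
  rw [multisetDeriv, Multiset.map_map]
  convert h2 using 1
  · refine Finset.sum_congr rfl fun f _ => ?_
    have : ∏ k, (C ∘ w k) (f k) = C (∏ k, w k (f k)) := by simp [map_prod]
    rw [this, coeff_C_mul]
    rfl
  · congr 1
    refine Finset.prod_congr rfl fun k _ => ?_
    simp only [dotProduct, Function.comp, mul_add, Finset.sum_add_distrib, map_sum, map_mul,
      Finset.mul_sum]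
    congr 1
    exact Finset.sum_congr rfl fun i _ => by ring

end pairing

end SecantVeronese

/-! ### Specializations of sums of powers along a valuation ring -/

namespace SecantVeronese

/-- Two vectors with a nonzero two by two minor. -/
def Indep {σ F : Type*} [CommRing F] (a b : σ → F) : Prop := ∃ k l, a k * b l - a l * b k ≠ 0

section Field

variable {σ F : Type*} [Field F]

theorem Indep.symm {a b : σ → F} (h : Indep a b) : Indep b a := by
  obtain ⟨k, l, h⟩ := h
  exact ⟨l, k, by convert h using 1; ring⟩

theorem not_indep_iff {a b : σ → F} (hb : b ≠ 0) : ¬ Indep a b ↔ ∃ c : F, a = c • b := by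
  constructor
  · intro h
    simp only [Indep, not_exists, not_not] at h
    obtain ⟨l, hl⟩ := Function.ne_iff.mp hb
    simp only [Pi.zero_apply] at hl
    refine ⟨a l / b l, funext fun k => ?_⟩
    have := h k l
    simp only [Pi.smul_apply, smul_eq_mul]
    field_simp
    linear_combination this
  · rintro ⟨c, rfl⟩ ⟨k, l, h⟩
    exact h (by simp only [Pi.smul_apply, smul_eq_mul]; ring)

theorem Indep.ne_zero {a b : σ → F} (h : Indep a b) : b ≠ 0 := by
  rintro rfl
  obtain ⟨k, l, h⟩ := h
  simp at h

theorem Indep.map {F' : Type*} [Field F'] {a b : σ → F} (h : Indep a b) (f : F →+* F') :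
    Indep (f ∘ a) (f ∘ b) := by
  obtain ⟨k, l, h⟩ := h
  refine ⟨k, l, ?_⟩
  simpa using (map_ne_zero f).mpr h

theorem Indep.exists_form [Fintype σ] [DecidableEq σ] {a b : σ → F} (h : Indep a b) :
    ∃ w : σ → F, w ⬝ᵥ a = 0 ∧ w ⬝ᵥ b ≠ 0 := by
  obtain ⟨k, l, h⟩ := h
  refine ⟨a k • Pi.single l 1 - a l • Pi.single k 1, ?_, ?_⟩
  · simp [sub_dotProduct]; ring
  · simpa [sub_dotProduct] using h

end Field

/-! ### Limits of sums of powers over a valuation ring -/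

section Specialization

variable {σ K : Type*} [Fintype σ] [DecidableEq σ] [Field K] {O : ValuationSubring K} {d : ℕ}

local notation "κ" => IsLocalRing.ResidueField O
local notation "π" => IsLocalRing.residue O

omit [DecidableEq σ] in
theorem residue_dotProduct (w x : σ → O) : π (w ⬝ᵥ x) = (π ∘ w) ⬝ᵥ (π ∘ x) := by
  simp [dotProduct, map_sum]

omit [Fintype σ] [DecidableEq σ] in
theorem exists_lift_form (w : σ → κ) : ∃ w' : σ → O, π ∘ w' = w := by
  choose f hf using IsLocalRing.residue_surjective (R := O)
  exact ⟨f ∘ w, funext fun i => hf _⟩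

/-- The form given by a two by two minor with `a` vanishes at `a` exactly over `O`, not only modulo
the maximal ideal, and its reduction does not vanish at `b`. -/
theorem exists_form_of_indep {a : σ → O} {b : σ → κ} (h : Indep (π ∘ a) b) :
    ∃ w : σ → O, w ⬝ᵥ a = 0 ∧ (π ∘ w) ⬝ᵥ b ≠ 0 := by
  obtain ⟨k, l, h⟩ := h
  refine ⟨a k • Pi.single l 1 - a l • Pi.single k 1, ?_, ?_⟩
  · simp [sub_dotProduct]; ring
  · convert h using 1
    have : π ∘ (a k • Pi.single l 1 - a l • Pi.single k 1)
        = (π (a k)) • Pi.single l 1 - (π (a l)) • Pi.single k (1 : κ) := by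
      ext i
      simp [Pi.single_apply, apply_ite π]
    rw [this]
    simp [sub_dotProduct]

omit [DecidableEq σ] in
/-- Products of linear forms vanishing at all the points vanish on the limit. -/
theorem prod_forms_eq_zero {ι J : Type*} [Fintype ι] [Fintype J] (A : ι → σ → O) (c : ι → K)
    (Z : Sym σ d → O) (hZ : ∀ s, (Z s : K) = ∑ i, c i * (ver d (A i) s : O))
    (x v : σ → κ) (y : J → σ → κ) (hP : π ∘ Z = verDeriv d x v + ∑ j, ver d (y j))
    (M : Multiset (σ → O)) (hM : M.card = d) (hA : ∀ i, ∃ w ∈ M, w ⬝ᵥ A i = 0) :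
    multisetDeriv (fun w : σ → O => (π ∘ w) ⬝ᵥ x) (fun w => (π ∘ w) ⬝ᵥ v) M
      + ∑ j, (M.map fun w => (π ∘ w) ⬝ᵥ y j).prod = 0 := by
  obtain ⟨w, rfl⟩ : ∃ w : Fin d → σ → O, M = Finset.univ.val.map w := by
    obtain ⟨L, rfl⟩ : ∃ L : List (σ → O), M = L := ⟨M.toList, M.coe_toList.symm⟩
    rw [Multiset.coe_card] at hM
    subst hM
    refine ⟨L.get, ?_⟩
    rw [Fin.univ_val_map, List.ofFn_get]
  -- The coefficients `c i` need not be integral, so the vanishing is checked in `K`; only the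
  -- result is reduced.
  have h0 : pair w Z = 0 := by
    apply Subtype.val_injective
    have h1 : O.subtype (pair w Z) = pair (fun k => O.subtype ∘ w k) (O.subtype ∘ Z) :=
      map_pair _ _ _
    have h2 : O.subtype ∘ Z = ∑ i, c i • ver d (O.subtype ∘ A i) := by
      ext s
      have h3 : ∀ i, O.subtype (ver d (A i) s) = ver d (O.subtype ∘ A i) s :=
        fun i => map_ver _ _ _
      simp only [Finset.sum_apply, Pi.smul_apply, smul_eq_mul, ← h3]
      exact hZ s
    change O.subtype _ = 0
    rw [h1, h2, pair_sum]
    refine Finset.sum_eq_zero fun i _ => ?_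
    rw [pair_smul, pair_ver]
    obtain ⟨_, hw, h⟩ := hA i
    obtain ⟨k, -, rfl⟩ := Multiset.mem_map.mp hw
    rw [Finset.prod_eq_zero (Finset.mem_univ k), mul_zero]
    have := congrArg O.subtype h
    simpa [dotProduct, map_sum] using this
  have h1 := congrArg π h0
  rw [map_pair, hP, pair_add, pair_sum, pair_verDeriv, map_zero] at h1
  rw [← h1]
  congr 1
  · simp only [multisetDeriv, Multiset.map_map]
    rfl
  · refine Finset.sum_congr rfl fun j _ => ?_
    rw [pair_ver, Multiset.map_map]
    rfl

omit [Fintype σ] [DecidableEq σ] in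
theorem not_indep_trans {F : Type*} [Field F] {a b c : σ → F} (ha : a ≠ 0) (hb : b ≠ 0)
    (hc : c ≠ 0) (h : ¬ Indep a b) (h' : ¬ Indep a c) : ¬ Indep b c := by
  rw [not_indep_iff hb] at h
  rw [not_indep_iff hc] at h'
  obtain ⟨s, rfl⟩ := h
  obtain ⟨t, h⟩ := h'
  rw [not_indep_iff hc]
  have hs : s ≠ 0 := by rintro rfl; simp at ha
  refine ⟨s⁻¹ * t, ?_⟩
  rw [mul_smul, ← h, smul_smul, inv_mul_cancel₀ hs, one_smul]

/-- If a sum of powers specializes to `x ^ (d - 1) v + ∑ y_j ^ d`, then two of the points specialize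
to `x` and the limit of their secant line contains `v`. -/
theorem exists_secant_limit {m : ℕ} (hd : 2 * m + 3 ≤ d) (A : Fin (m + 2) → σ → O)
    (hA1 : ∀ i, ∃ n, A i n = 1) (c : Fin (m + 2) → K)
    (Z : Sym σ d → O) (hZ : ∀ s, (Z s : K) = ∑ i, c i * (ver d (A i) s : O))
    (x v : σ → κ) (y : Fin m → σ → κ) (hP : π ∘ Z = verDeriv d x v + ∑ j, ver d (y j))
    (hxv : Indep x v) (hxy : ∀ j, Indep x (y j)) (hy : ∀ j j', j ≠ j' → Indep (y j) (y j')) :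
    ∃ i₀ i₁, ¬ Indep (π ∘ A i₀) x ∧ ¬ Indep (π ∘ A i₁) x ∧
      ∀ w : σ → O, w ⬝ᵥ A i₀ = 0 → w ⬝ᵥ A i₁ = 0 → (π ∘ w) ⬝ᵥ v = 0 := by
  classical
  have hx0 : x ≠ 0 := hxv.symm.ne_zero
  have hA0 : ∀ i, π ∘ A i ≠ 0 := by
    intro i h
    obtain ⟨n, hn⟩ := hA1 i
    have := congrFun h n
    simp [hn] at this
  have test := prod_forms_eq_zero A c Z hZ x v y hP
  -- every `y j` is the limit of some point
  have step1 : ∀ j, ∃ i, ¬ Indep (π ∘ A i) (y j) := by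
    intro j
    by_contra! hcon
    choose l hl0 hl1 using fun i => exists_form_of_indep (hcon i)
    obtain ⟨a', ha0, ha1⟩ := (hxy j).exists_form
    obtain ⟨a, rfl⟩ := exists_lift_form a'
    have hb : ∀ j', ∃ b : σ → O, (j' ≠ j → (π ∘ b) ⬝ᵥ y j' = 0) ∧ (π ∘ b) ⬝ᵥ y j ≠ 0 := by
      intro j'
      by_cases h : j' = j
      · exact ⟨a, fun h' => absurd h h', ha1⟩
      · obtain ⟨b', hb0, hb1⟩ := (hy j' j h).exists_form
        obtain ⟨b, rfl⟩ := exists_lift_form b'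
        exact ⟨b, fun _ => hb0, hb1⟩
    choose b hb0 hb1 using hb
    have hm : 1 ≤ m := Nat.one_le_iff_ne_zero.mpr (by rintro rfl; exact j.elim0)
    -- The product consists of two forms through `x` (killing the derivative term), `m + 2` forms
    -- killing the `A i`, and `m - 1` forms killing the other `y j'`. None of them vanishes at `y
    -- j`. This is `2 * m + 3` forms, and the rest is padding.
    set M : Multiset (σ → O) := {a} + ({a} + (Finset.univ.val.map l +
      ((Finset.univ.erase j).val.map b + Multiset.replicate (d - (2 * m + 3)) a))) with hMdef
    have hM : M.card = d := by
      simp only [hMdef, Multiset.card_add, Multiset.card_singleton, Multiset.card_map,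
        Finset.card_val, Finset.card_univ, Fintype.card_fin, Multiset.card_replicate,
        Finset.card_erase_of_mem (Finset.mem_univ j)]
      omega
    have h := test M hM fun i => ⟨l i, by
      simp only [hMdef, Multiset.mem_add]
      exact Or.inr (Or.inr (Or.inl (Multiset.mem_map_of_mem _ (Finset.mem_univ_val i)))), hl0 i⟩
    have h1 : multisetDeriv (fun w : σ → O => (π ∘ w) ⬝ᵥ x) (fun w => (π ∘ w) ⬝ᵥ v) M = 0 := by
      rw [hMdef, multisetDeriv_add, multisetDeriv_add]
      simp [ha0]
    rw [h1, zero_add, Finset.sum_eq_single j] at h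
    · refine absurd h ?_
      rw [Multiset.prod_eq_zero_iff]
      simp only [hMdef, Multiset.mem_map, Multiset.mem_add, Multiset.mem_singleton,
        Multiset.mem_replicate, not_exists, not_and]
      rintro w (rfl | rfl | ⟨i, -, rfl⟩ | ⟨i, -, rfl⟩ | ⟨-, rfl⟩)
      · exact ha1
      · exact ha1
      · exact hl1 i
      · exact hb1 i
      · exact ha1
    · intro j' _ hj'
      rw [Multiset.prod_eq_zero_iff]
      refine Multiset.mem_map.mpr ⟨b j', ?_, hb0 j' hj'⟩
      simp only [hMdef, Multiset.mem_add, Multiset.mem_map]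
      exact Or.inr (Or.inr (Or.inr (Or.inl ⟨j', Finset.mem_val.mpr (Finset.mem_erase.mpr
        ⟨hj', Finset.mem_univ j'⟩), rfl⟩)))
    · simp
  choose f hf using step1
  have hy0 : ∀ j, y j ≠ 0 := fun j => (hxy j).ne_zero
  have hfinj : Function.Injective f := by
    intro j j' h
    by_contra hne
    exact not_indep_trans (hA0 (f j)) (hy0 j) (hy0 j') (hf j) (h ▸ hf j') (hy j j' hne)
  have hfx : ∀ j, Indep (π ∘ A (f j)) x := by
    intro j
    by_contra h
    exact not_indep_trans (hA0 (f j)) hx0 (hy0 j) h (hf j) (hxy j)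
  have hcard : (Finset.univ \ Finset.univ.image f).card = 2 := by
    rw [Finset.card_sdiff_of_subset (Finset.subset_univ _), Finset.card_image_of_injective _ hfinj]
    simp
  obtain ⟨i₀, i₁, -, hS⟩ := Finset.card_eq_two.mp hcard
  have hcover : ∀ i, i = i₀ ∨ i = i₁ ∨ ∃ j, f j = i := by
    intro i
    by_cases h : ∃ j, f j = i
    · exact Or.inr (Or.inr h)
    · have : i ∈ Finset.univ \ Finset.univ.image f := by simpa using h
      rw [hS] at this
      simp only [Finset.mem_insert, Finset.mem_singleton] at this
      tauto
  choose l hl0 hl1 using fun j => exists_form_of_indep (hfx j)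
  have hb : ∀ j, ∃ b : σ → O, (π ∘ b) ⬝ᵥ y j = 0 ∧ (π ∘ b) ⬝ᵥ x ≠ 0 := by
    intro j
    obtain ⟨b', hb0, hb1⟩ := (hxy j).symm.exists_form
    obtain ⟨b, rfl⟩ := exists_lift_form b'
    exact ⟨b, hb0, hb1⟩
  choose b hb0 hb1 using hb
  have he : ∃ e : σ → O, (π ∘ e) ⬝ᵥ x ≠ 0 := by
    obtain ⟨e', -, he⟩ := hxv.symm.exists_form
    obtain ⟨e, rfl⟩ := exists_lift_form e'
    exact ⟨e, he⟩
  obtain ⟨e, he⟩ := he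
  -- The forms `l j` kill the points `A (f j)`, the forms `b j` kill the `y j`, and none vanishes at
  -- `x`. This uses `2 * m` of the `d` factors, so up to three remain free to test the two points `A
  -- i₀`, `A i₁` against `v`.
  have test2 : ∀ Q : Multiset (σ → O), Q.card ≤ 3 → (∃ w ∈ Q, w ⬝ᵥ A i₀ = 0) →
      (∃ w ∈ Q, w ⬝ᵥ A i₁ = 0) → (Q.map fun w => (π ∘ w) ⬝ᵥ x).prod = 0 →
      multisetDeriv (fun w : σ → O => (π ∘ w) ⬝ᵥ x) (fun w => (π ∘ w) ⬝ᵥ v) Q = 0 := by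
    intro Q hQ h0 h1 hQx
    set R : Multiset (σ → O) := Finset.univ.val.map l + (Finset.univ.val.map b +
      Multiset.replicate (d - (2 * m + Q.card)) e) with hR
    have hM : (Q + R).card = d := by
      simp only [hR, Multiset.card_add, Multiset.card_map, Finset.card_val, Finset.card_univ,
        Fintype.card_fin, Multiset.card_replicate]
      omega
    have h := test (Q + R) hM ?_
    · rw [Finset.sum_eq_zero, add_zero, multisetDeriv_add, hQx, zero_mul, add_zero,
        mul_eq_zero] at h
      · refine h.resolve_right ?_
        rw [Multiset.prod_eq_zero_iff]
        simp only [hR, Multiset.mem_map, Multiset.mem_add, Multiset.mem_replicate, not_exists,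
          not_and]
        rintro w (⟨i, -, rfl⟩ | ⟨i, -, rfl⟩ | ⟨-, rfl⟩)
        · exact hl1 i
        · exact hb1 i
        · exact he
      · intro j _
        rw [Multiset.prod_eq_zero_iff]
        refine Multiset.mem_map.mpr ⟨b j, ?_, hb0 j⟩
        simp [hR]
    · intro i
      rcases hcover i with rfl | rfl | ⟨j, rfl⟩
      · obtain ⟨w, hw, h⟩ := h0
        exact ⟨w, Multiset.mem_add.mpr (Or.inl hw), h⟩
      · obtain ⟨w, hw, h⟩ := h1
        exact ⟨w, Multiset.mem_add.mpr (Or.inl hw), h⟩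
      · exact ⟨l j, by simp [hR], hl0 j⟩
  have hker : ∀ i, ¬ Indep (π ∘ A i) x → ∀ w : σ → O, w ⬝ᵥ A i = 0 → (π ∘ w) ⬝ᵥ x = 0 := by
    intro i hi w hw
    obtain ⟨s, hs⟩ := (not_indep_iff hx0).mp hi
    have h := congrArg π hw
    rw [residue_dotProduct, hs, dotProduct_smul, map_zero, smul_eq_mul, mul_eq_zero] at h
    refine h.resolve_left ?_
    rintro rfl
    exact hA0 i (by simpa using hs)
  have hform : ∀ i, ¬ Indep (π ∘ A i) x → ∃ w : σ → O, w ⬝ᵥ A i = 0 ∧ (π ∘ w) ⬝ᵥ v ≠ 0 := by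
    intro i hi
    refine exists_form_of_indep ?_
    by_contra h
    exact not_indep_trans (hA0 i) hx0 hxv.ne_zero hi h hxv
  -- A form killing a point that specializes to `x` vanishes at `x` after reduction, so it can be
  -- chosen nonzero at `v`. Its product with a form nonzero at `x` then has nonzero derivative in
  -- the direction `v`.
  have hmixed : ∀ i, ¬ Indep (π ∘ A i) x → ∀ w' : σ → O, (π ∘ w') ⬝ᵥ x ≠ 0 →
      ∃ w : σ → O, w ⬝ᵥ A i = 0 ∧ (({w, w'} : Multiset (σ → O)).map fun w => (π ∘ w) ⬝ᵥ x).prod = 0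
      ∧ multisetDeriv (fun w : σ → O => (π ∘ w) ⬝ᵥ x) (fun w => (π ∘ w) ⬝ᵥ v) {w, w'} ≠ 0 := by
    intro i hi w' hw'
    obtain ⟨w, hw, hwv⟩ := hform i hi
    have hwx := hker i hi w hw
    refine ⟨w, hw, by simp [hwx], ?_⟩
    rw [Multiset.insert_eq_cons, multisetDeriv_cons, hwx]
    simpa using ⟨hwv, hw'⟩
  by_cases h0 : Indep (π ∘ A i₀) x
  · exfalso
    obtain ⟨l₀, hl₀, hl₀'⟩ := exists_form_of_indep h0
    by_cases h1 : Indep (π ∘ A i₁) x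
    · obtain ⟨l₁, hl₁, hl₁'⟩ := exists_form_of_indep h1
      -- With neither point tending to `x`, the third free factor is a form `n` through `x` that
      -- detects `v`.
      obtain ⟨n', hn0, hn1⟩ := hxv.exists_form
      obtain ⟨n, rfl⟩ := exists_lift_form n'
      have h := test2 {n, l₀, l₁} (by simp) ⟨l₀, by simp, hl₀⟩ ⟨l₁, by simp, hl₁⟩ (by simp [hn0])
      rw [Multiset.insert_eq_cons, multisetDeriv_cons, hn0] at h
      simp at h
      tauto
    · obtain ⟨w, hw, hw0, hw1⟩ := hmixed i₁ h1 l₀ hl₀'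
      exact hw1 (test2 _ (by simp) ⟨l₀, by simp, hl₀⟩ ⟨w, by simp, hw⟩ hw0)
  by_cases h1 : Indep (π ∘ A i₁) x
  · exfalso
    obtain ⟨l₁, hl₁, hl₁'⟩ := exists_form_of_indep h1
    obtain ⟨w, hw, hw0, hw1⟩ := hmixed i₀ h0 l₁ hl₁'
    exact hw1 (test2 _ (by simp) ⟨w, by simp, hw⟩ ⟨l₁, by simp, hl₁⟩ hw0)
  refine ⟨i₀, i₁, h0, h1, fun w hw0 hw1 => ?_⟩
  have h := test2 {w} (by simp) ⟨w, by simp, hw0⟩ ⟨w, by simp, hw1⟩ (by simp [hker i₀ h0 w hw0])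
  simpa [multisetDeriv_singleton] using h

end Specialization

end SecantVeronese

/-! ### Closures in projective space and places -/

namespace SecantVeronese

open MvPolynomial

section Projective

variable {σ : Type}

theorem eval_smul_of_isHomogeneous {R : Type*} [CommRing R] {F : MvPolynomial σ R} {m : ℕ}
    (hF : F.IsHomogeneous m) (c : R) (v : σ → R) : eval (c • v) F = c ^ m * eval v F := by
  rw [eval_eq, eval_eq, Finset.mul_sum]
  refine Finset.sum_congr rfl fun s hs => ?_
  have h : ∑ i ∈ s.support, s i = m := by
    have := hF (mem_support_iff.mp hs)
    simpa [Finsupp.weight_apply, Finsupp.sum] using this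
  simp only [Pi.smul_apply, smul_eq_mul, mul_pow, Finset.prod_mul_distrib,
    Finset.prod_pow_eq_pow_sum, h]
  ring

theorem vanishesAt_mk {F : MvPolynomial σ ℂ} {m : ℕ} (hF : F.IsHomogeneous m) {v : σ → ℂ}
    (hv : v ≠ 0) : VanishesAt F (Projectivization.mk ℂ v hv) ↔ eval v F = 0 := by
  obtain ⟨a, ha⟩ := Projectivization.exists_smul_eq_mk_rep ℂ v hv
  rw [VanishesAt, ← ha, Units.smul_def, eval_smul_of_isHomogeneous hF]
  simp

theorem isClosed_iff_isAlgebraicSet {Z : Set (PSpace σ)} : IsClosed Z ↔ IsAlgebraicSet Z := by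
  rw [← isOpen_compl_iff]
  change IsAlgebraicSet Zᶜᶜ ↔ _
  rw [compl_compl]

theorem mem_closure_iff_vanishesAt {S : Set (PSpace σ)} {x : PSpace σ} :
    x ∈ closure S ↔ ∀ (F : MvPolynomial σ ℂ) (m : ℕ), F.IsHomogeneous m →
      (∀ y ∈ S, VanishesAt F y) → VanishesAt F x := by
  constructor
  · intro hx F m hF hS
    have hcl : IsClosed (zeroLocus {F}) :=
      isClosed_iff_isAlgebraicSet.mpr ⟨{F}, by rintro _ rfl; exact ⟨m, hF⟩, rfl⟩
    have := closure_minimal (fun y hy G hG => by rw [hG]; exact hS y hy : S ⊆ zeroLocus {F}) hcl hx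
    exact this F rfl
  · intro h Z ⟨hZ, hSZ⟩
    obtain ⟨E, hE, rfl⟩ := isClosed_iff_isAlgebraicSet.mp hZ
    intro F hF
    obtain ⟨m, hm⟩ := hE F hF
    exact h F m hm fun y hy => hSZ hy F hF

/-- The nonzero vectors of the affine cone over a subset of projective space. -/
def coneOf (X : Set (PSpace σ)) : Set (σ → ℂ) :=
  {v | ∃ h : v ≠ 0, Projectivization.mk ℂ v h ∈ X}

theorem smul_mem_coneOf {X : Set (PSpace σ)} {v : σ → ℂ} (hv : v ∈ coneOf X) {c : ℂ} (hc : c ≠ 0) :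
    c • v ∈ coneOf X := by
  obtain ⟨h, hX⟩ := hv
  refine ⟨smul_ne_zero hc h, ?_⟩
  rwa [(Projectivization.mk_eq_mk_iff' ℂ (c • v) v _ h).mpr ⟨c, rfl⟩]

theorem rep_mem_coneOf {X : Set (PSpace σ)} {x : PSpace σ} (hx : x ∈ X) : x.rep ∈ coneOf X :=
  ⟨x.rep_nonzero, by rwa [x.mk_rep]⟩

theorem veronese_mk (d : ℕ) (v : σ → ℂ) (hv : v ≠ 0) :
    veronese d (Projectivization.mk ℂ v hv)
      = Projectivization.mk ℂ (veroneseVec d v) (veroneseVec_ne_zero d hv) := rfl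

theorem coneOf_veronese_image (d : ℕ) (X : Set (PSpace σ)) (z : Sym σ d → ℂ) :
    z ∈ coneOf (veronese d '' X) ↔ ∃ c : ℂ, c ≠ 0 ∧ ∃ v ∈ coneOf X, z = c • ver d v := by
  constructor
  · rintro ⟨hz, x, hx, h⟩
    rw [← x.mk_rep, veronese_mk, Projectivization.mk_eq_mk_iff'] at h
    obtain ⟨c, hc⟩ := h
    have hc0 : c ≠ 0 := by
      rintro rfl
      exact veroneseVec_ne_zero d x.rep_nonzero (by simpa using hc.symm)
    refine ⟨c⁻¹, inv_ne_zero hc0, x.rep, rep_mem_coneOf hx, ?_⟩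
    rw [← veroneseVec_eq_ver, ← hc, smul_smul, inv_mul_cancel₀ hc0, one_smul]
  · rintro ⟨c, hc, v, ⟨hv, hX⟩, rfl⟩
    have h : ver d v ∈ coneOf (veronese d '' X) := ⟨veroneseVec_ne_zero d hv, ⟨_, hX, rfl⟩⟩
    exact smul_mem_coneOf h hc

theorem mk_mem_span_iff {S : Set (PSpace σ)} {v : σ → ℂ} (hv : v ≠ 0) :
    Projectivization.mk ℂ v hv ∈ Projectivization.Subspace.span S
      ↔ v ∈ Submodule.span ℂ (Projectivization.rep '' S) := by
  constructor
  · intro h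
    refine (Projectivization.Subspace.mem_span _).mp h
      (Submodule.span ℂ (Projectivization.rep '' S)).projectivization fun x hx => ?_
    rw [← x.mk_rep]
    exact (Submodule.mk_mem_projectivization_iff _ x.rep_nonzero).mpr
      (Submodule.subset_span ⟨x, hx, rfl⟩)
  · rw [← Projectivization.Subspace.mem_submodule_iff _ hv]
    refine fun h => Submodule.span_le.mpr ?_ h
    rintro _ ⟨x, hx, rfl⟩
    refine (Projectivization.Subspace.mem_submodule_iff _ x.rep_nonzero).mpr ?_
    rw [x.mk_rep]
    exact Projectivization.Subspace.subset_span _ hx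

end Projective

/-- A place of the ring of functions on `W`: a homomorphism to a field with a valuation ring
containing the constants. -/
structure Place (W : Type) where
  /-- the field -/
  K : Type
  [field : Field K]
  /-- the valuation ring -/
  O : ValuationSubring K
  /-- the evaluation of functions -/
  ψ : (W → ℂ) →+* K
  const_mem : ∀ c : ℂ, ψ (fun _ => c) ∈ O

attribute [instance] Place.field

namespace Place

variable {W : Type} (P : Place W)

/-- The residue field. -/
abbrev κ : Type := IsLocalRing.ResidueField P.O

/-- The residue map. -/
abbrev π : P.O →+* P.κ := IsLocalRing.residue P.O

/-- The inclusion of the constants. -/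
def j : ℂ →+* P.O :=
  (P.ψ.comp (Pi.constRingHom W ℂ)).codRestrict P.O.toSubring P.const_mem

theorem coe_j (c : ℂ) : (P.j c : P.K) = P.ψ (fun _ => c) := rfl

/-- The embedding of the complex numbers into the residue field. -/
noncomputable def ρ : ℂ →+* P.κ := P.π.comp P.j

theorem ρ_apply (c : ℂ) : P.ρ c = P.π (P.j c) := rfl

theorem ψ_eval {N : Type} (F : MvPolynomial N ℂ) (Z : W → N → ℂ) :
    P.ψ (fun w => eval (Z w) F) = eval₂ (P.O.subtype.comp P.j) (fun n => P.ψ fun w => Z w n) F := by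
  have h : P.ψ.comp (RingHom.pi fun w => eval (Z w))
      = eval₂Hom (P.O.subtype.comp P.j) (fun n => P.ψ fun w => Z w n) := by
    refine MvPolynomial.ringHom_ext (fun c => ?_) fun n => ?_
    · simp only [RingHom.comp_apply, eval₂Hom_C]
      change _ = ((P.j c : P.O) : P.K)
      rw [coe_j]
      congr 1
      funext w
      exact eval_C c
    · simp only [RingHom.comp_apply, eval₂Hom_X']
      congr 1
      funext w
      exact eval_X n
  exact congrArg (fun f => f F) h

end Place

/-- A vector at which all polynomials vanish that vanish on the image of `Z` is a specialization of
the generic value of `Z`. -/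
theorem exists_place {W N : Type} (Z : W → N → ℂ) (p : N → ℂ)
    (h : ∀ F : MvPolynomial N ℂ, (∀ w, eval (Z w) F = 0) → eval p F = 0) :
    ∃ P : Place W, ∃ z : N → P.O, (∀ n, (z n : P.K) = P.ψ fun w => Z w n) ∧
      ∀ n, P.π (z n) = P.ρ (p n) := by
  set Φ : MvPolynomial N ℂ →+* (W → ℂ) := RingHom.pi fun w => eval (Z w) with hΦ
  have hprime : (RingHom.ker (eval p : MvPolynomial N ℂ →+* ℂ)).IsPrime := RingHom.ker_isPrime _
  have hΦ' : ∀ F w, Φ F w = eval (Z w) F := fun _ _ => rfl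
  -- By hypothesis the kernel of `Φ` lies in the prime `ker (eval p)`, so `M` avoids zero. A prime
  -- `Q` disjoint from `M` gives a field `K` in which no further polynomial outside `ker (eval p)`
  -- becomes zero. All functions on `W` get a value in `K`, so no algebraic structure on `W` is
  -- needed.
  set M : Submonoid (W → ℂ) := ((RingHom.ker (eval p)).primeCompl).map Φ.toMonoidHom with hM
  obtain ⟨Q, hQ, -, hdisj⟩ := Ideal.exists_le_prime_disjoint (⊥ : Ideal (W → ℂ)) M (by
    rw [Set.disjoint_left]
    rintro _ h0 ⟨F, hF, rfl⟩
    exact hF (h F fun w => congrFun h0 w))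
  let K := FractionRing ((W → ℂ) ⧸ Q)
  let ψ : (W → ℂ) →+* K := (algebraMap ((W → ℂ) ⧸ Q) K).comp (Ideal.Quotient.mk Q)
  have hψ : ∀ F, ψ (Φ F) = 0 → eval p F = 0 := by
    intro F hF
    by_contra hne
    have h1 : Φ F ∈ Q := by
      rw [RingHom.comp_apply, map_eq_zero_iff _ (IsFractionRing.injective _ _)] at hF
      exact Ideal.Quotient.eq_zero_iff_mem.mp hF
    exact Set.disjoint_left.mp hdisj h1 ⟨F, hne, rfl⟩
  let A : Subring K := (ψ.comp Φ).range
  let I : Ideal A := (RingHom.ker (eval p)).map (ψ.comp Φ).rangeRestrict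
  have hI : I ≠ ⊤ := by
    intro htop
    have h1 : (1 : A) ∈ I := htop ▸ Submodule.mem_top
    rw [Ideal.mem_map_iff_of_surjective _ ((ψ.comp Φ).rangeRestrict_surjective)] at h1
    obtain ⟨F, hF, h1⟩ := h1
    have h2 : ψ (Φ (1 - F)) = 0 := by
      have := congrArg Subtype.val h1
      rw [map_sub, map_sub, map_one, map_one]
      exact sub_eq_zero.mpr this.symm
    have h3 := hψ _ h2
    rw [RingHom.mem_ker] at hF
    simp [hF] at h3
  -- Existence of a valuation ring that contains the image `A` of the polynomials and has the proper
  -- ideal `I` of those vanishing at `p` in its maximal ideal.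
  obtain ⟨O, hAO, hOI⟩ := Ideal.image_subset_nonunits_valuationSubring I hI
  let P : Place W := ⟨K, O, ψ, fun c => hAO ⟨C c, by
    change ψ (Φ (C c)) = _
    congr 1
    funext w
    simp [hΦ']⟩⟩
  have hmem : ∀ n, (P.ψ fun w => Z w n) ∈ O := fun n => hAO ⟨X n, by
    change ψ (Φ (X n)) = ψ _
    congr 1
    funext w
    simp [hΦ']⟩
  refine ⟨P, fun n => ⟨_, hmem n⟩, fun n => rfl, fun n => ?_⟩
  rw [Place.ρ_apply, ← sub_eq_zero, ← RingHom.map_sub]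
  have h1 : (ψ.comp Φ).rangeRestrict (X n - C (p n)) ∈ I :=
    Ideal.mem_map_of_mem _ (by simp [RingHom.mem_ker])
  have h2 := hOI ⟨_, h1, rfl⟩
  refine (IsLocalRing.residue_eq_zero_iff _).mpr ?_
  rw [← ValuationSubring.coe_mem_nonunits_iff]
  have h3 : ψ (fun w => Z w n) - ψ (fun _ => p n) = ψ (Φ (X n - C (p n))) := by
    rw [← map_sub]
    congr 1
    funext w
    simp [hΦ']
  change ψ (fun w => Z w n) - ψ (fun _ => p n) ∈ O.nonunits
  rw [h3]
  exact h2

end SecantVeronese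

/-! ### Secant varieties of Veronese images near a branched point -/

namespace SecantVeronese

open MvPolynomial

/-! ### Secant varieties in terms of vectors of the affine cone -/

section SecVec

variable {σ : Type}

/-- A vector belongs to the closure of the set of sums of `r` multiples of `d`-th powers of vectors
of the cone over `X`. -/
def IsSecantVec (r d : ℕ) (X : Set (PSpace σ)) (z : Sym σ d → ℂ) : Prop :=
  ∀ (F : MvPolynomial (Sym σ d) ℂ) (m : ℕ), F.IsHomogeneous m →
    (∀ A : Fin r → σ → ℂ, (∀ i, A i ∈ coneOf X) → ∀ c : Fin r → ℂ,
      eval (∑ i, c i • ver d (A i)) F = 0) → eval z F = 0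

theorem mk_mem_secant_iff {r d : ℕ} {X : Set (PSpace σ)} {z : Sym σ d → ℂ} (hz : z ≠ 0) :
    (∃ y : Fin r → PSpace (Sym σ d), (∀ i, y i ∈ veronese d '' X) ∧
      Projectivization.mk ℂ z hz ∈ Projectivization.Subspace.span (Set.range y)) ↔
    ∃ A : Fin r → σ → ℂ, (∀ i, A i ∈ coneOf X) ∧ ∃ c : Fin r → ℂ,
      z = ∑ i, c i • ver d (A i) := by
  constructor
  · rintro ⟨y, hy, h⟩
    rw [mk_mem_span_iff, ← Set.range_comp, Submodule.mem_span_range_iff_exists_fun] at h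
    obtain ⟨c, rfl⟩ := h
    have := fun i => (coneOf_veronese_image d X _).mp (rep_mem_coneOf (hy i))
    choose a ha A hA h using this
    refine ⟨A, hA, fun i => c i * a i, Finset.sum_congr rfl fun i _ => ?_⟩
    simp only [Function.comp, h, mul_smul]
  · rintro ⟨A, hA, c, h⟩
    choose hA0 hAX using hA
    refine ⟨fun i => Projectivization.mk ℂ _ (veroneseVec_ne_zero d (hA0 i)),
      fun i => ⟨_, hAX i, rfl⟩, ?_⟩
    rw [mk_mem_span_iff, h]
    refine Submodule.sum_mem _ fun i _ => Submodule.smul_mem _ _ ?_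
    obtain ⟨a, ha⟩ := Projectivization.exists_smul_eq_mk_rep ℂ _ (veroneseVec_ne_zero d (hA0 i))
    have : ver d (A i) = (a⁻¹ : ℂˣ) • (a • veroneseVec d (A i)) := by
      rw [inv_smul_smul]; rfl
    rw [this, ha, Units.smul_def]
    exact Submodule.smul_mem _ _ (Submodule.subset_span ⟨_, ⟨i, rfl⟩, rfl⟩)

theorem mk_mem_secantVariety_iff {r d : ℕ} (hr : 1 ≤ r) {X : Set (PSpace σ)} (hX : X.Nonempty)
    {z : Sym σ d → ℂ} (hz : z ≠ 0) :
    Projectivization.mk ℂ z hz ∈ secantVariety r (veronese d '' X) ↔ IsSecantVec r d X z := by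
  rw [secantVariety, mem_closure_iff_vanishesAt]
  have key : ∀ (F : MvPolynomial (Sym σ d) ℂ) (m : ℕ), F.IsHomogeneous m →
      ((∀ p ∈ {p | ∃ y : Fin r → PSpace (Sym σ d), (∀ i, y i ∈ veronese d '' X) ∧
        p ∈ Projectivization.Subspace.span (Set.range y)}, VanishesAt F p) ↔
      (∀ A : Fin r → σ → ℂ, (∀ i, A i ∈ coneOf X) → ∀ c : Fin r → ℂ,
        eval (∑ i, c i • ver d (A i)) F = 0)) := by
    intro F m hF
    constructor
    · intro h
      have h' : ∀ A : Fin r → σ → ℂ, (∀ i, A i ∈ coneOf X) → ∀ c : Fin r → ℂ,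
          (∑ i, c i • ver d (A i)) ≠ 0 → eval (∑ i, c i • ver d (A i)) F = 0 := by
        intro A hA c h0
        rw [← vanishesAt_mk hF h0]
        exact h _ ((mk_mem_secant_iff h0).mpr ⟨A, hA, c, rfl⟩)
      intro A hA c
      -- The zero vector is not a projective point. There `F` vanishes because it vanishes at some
      -- nonzero vector of the secant cone and is homogeneous; this is where `1 ≤ r` and
      -- `X.Nonempty` enter.
      by_cases h0 : (∑ i, c i • ver d (A i)) = 0
      · rw [h0]
        obtain ⟨x, hx⟩ := hX
        have h1 := h' (fun _ => x.rep) (fun _ => rep_mem_coneOf hx) (Pi.single ⟨0, hr⟩ 1) (by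
          simp only [Pi.single_apply, ite_smul, one_smul, zero_smul, Finset.sum_ite_eq',
            Finset.mem_univ, if_true]
          exact veroneseVec_ne_zero d x.rep_nonzero)
        have h2 := eval_smul_of_isHomogeneous hF 0
          (∑ i, (Pi.single ⟨0, hr⟩ 1 : Fin r → ℂ) i • ver d x.rep)
        rwa [h1, zero_smul, mul_zero] at h2
      · exact h' A hA c h0
    · rintro h p hp
      rw [← p.mk_rep] at hp ⊢
      obtain ⟨A, hA, c, hc⟩ := (mk_mem_secant_iff p.rep_nonzero).mp hp
      rw [vanishesAt_mk hF, hc]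
      exact h A hA c
  constructor
  · intro h F m hF hv
    exact (vanishesAt_mk hF hz).mp (h F m hF ((key F m hF).mpr hv))
  · intro h F m hF hv
    exact (vanishesAt_mk hF hz).mpr (h F m hF ((key F m hF).mp hv))

/-- The homogeneous components at `z` are the coefficients of the polynomial `t ↦ F (t z)`, which
vanishes identically because `S` is a cone. -/
theorem eval_homogeneousComponent_eq_zero {N : Type} {S : Set (N → ℂ)}
    (hS : ∀ z ∈ S, ∀ t : ℂ, t • z ∈ S) {F : MvPolynomial N ℂ} (hF : ∀ z ∈ S, eval z F = 0) (m : ℕ)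
    {z : N → ℂ} (hz : z ∈ S) : eval z (homogeneousComponent m F) = 0 := by
  by_cases hm : m ∈ Finset.range (F.totalDegree + 1)
  swap
  · rw [homogeneousComponent_eq_zero _ _ (by simpa using hm), map_zero]
  set p : Polynomial ℂ := ∑ k ∈ Finset.range (F.totalDegree + 1),
    Polynomial.monomial k (eval z (homogeneousComponent k F)) with hp
  have h0 : p = 0 := by
    refine Polynomial.funext fun t => ?_
    rw [Polynomial.eval_zero, ← hF _ (hS z hz t)]
    conv_rhs => rw [← sum_homogeneousComponent F]
    rw [hp, Polynomial.eval_finsetSum, map_sum]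
    refine Finset.sum_congr rfl fun k _ => ?_
    rw [eval_smul_of_isHomogeneous (homogeneousComponent_isHomogeneous k F)]
    simp [mul_comm]
  have := congrArg (fun q => Polynomial.coeff q m) h0
  simp only [hp, Polynomial.finsetSum_coeff, Polynomial.coeff_monomial, Finset.sum_ite_eq', hm,
    if_true, Polynomial.coeff_zero] at this
  exact this

/-- The sums of `r` multiples of powers form a cone, so homogeneity of the test polynomial can be
dropped. This is the form that `exists_place` needs. -/
theorem IsSecantVec.eval_eq_zero {r d : ℕ} {X : Set (PSpace σ)} {z : Sym σ d → ℂ}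
    (h : IsSecantVec r d X z) {F : MvPolynomial (Sym σ d) ℂ}
    (hF : ∀ A : Fin r → σ → ℂ, (∀ i, A i ∈ coneOf X) → ∀ c : Fin r → ℂ,
      eval (∑ i, c i • ver d (A i)) F = 0) : eval z F = 0 := by
  rw [← sum_homogeneousComponent F, map_sum]
  refine Finset.sum_eq_zero fun m _ => ?_
  refine h _ m (homogeneousComponent_isHomogeneous m F) fun A hA c => ?_
  refine eval_homogeneousComponent_eq_zero
    (S := {z | ∃ A : Fin r → σ → ℂ, (∀ i, A i ∈ coneOf X) ∧ ∃ c : Fin r → ℂ,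
      z = ∑ i, c i • ver d (A i)}) ?_ ?_ m ⟨A, hA, c, rfl⟩
  · rintro _ ⟨A, hA, c, rfl⟩ t
    refine ⟨A, hA, fun i => t * c i, ?_⟩
    simp only [Finset.smul_sum, mul_smul]
  · rintro _ ⟨A, hA, c, rfl⟩
    exact hF A hA c

end SecVec

/-! ### Limits of secant lines of `X` at a point -/

section Limits

variable {σ : Type} [Fintype σ]

/-- A nonzero vector over the fraction field of a valuation ring can be normalized. -/
theorem exists_normalization {K : Type*} [Field K] (O : ValuationSubring K) {A : σ → K}
    (hA : A ≠ 0) : ∃ (c : K) (a : σ → O), c ≠ 0 ∧ (∀ n, (a n : K) = c * A n) ∧ ∃ n, a n = 1 := by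
  obtain ⟨k, hk⟩ := Function.ne_iff.mp hA
  have : Nonempty σ := ⟨k⟩
  obtain ⟨l, -, hl⟩ := Finset.exists_max_image Finset.univ (fun n => O.valuation (A n))
    Finset.univ_nonempty
  have hl0 : A l ≠ 0 := by
    intro h0
    have h1 := hl k (Finset.mem_univ k)
    rw [h0, map_zero, le_zero_iff, map_eq_zero] at h1
    exact hk h1
  have hmem : ∀ n, (A l)⁻¹ * A n ∈ O := by
    intro n
    rw [← O.valuation_le_one_iff, map_mul, map_inv₀]
    refine inv_mul_le_one_of_le₀ (hl n (Finset.mem_univ n)) zero_le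
  exact ⟨(A l)⁻¹, fun n => ⟨_, hmem n⟩, inv_ne_zero hl0, fun n => rfl, l,
    Subtype.ext (inv_mul_cancel₀ hl0)⟩

/-- The vector `a` over the valuation ring is a normalized form of the vector of functions `A`. -/
def Place.IsNormalForm {W : Type} (P : Place W) (A : W → σ → ℂ) (a : σ → P.O) : Prop :=
  (∃ n, a n = 1) ∧ ∃ c : P.K, c ≠ 0 ∧ ∀ n, (a n : P.K) = c * P.ψ fun w => A w n

/-- Since `A w ≠ 0` for every `w`, the coordinate functions generate the unit ideal of `W → ℂ`, so
they do not all become zero in the field of the place. -/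
theorem Place.exists_isNormalForm {W : Type} (P : Place W) {A : W → σ → ℂ} (hA : ∀ w, A w ≠ 0) :
    ∃ a : σ → P.O, P.IsNormalForm A a := by
  have h0 : (fun n => P.ψ fun w => A w n) ≠ 0 := by
    intro h
    classical
    choose k hk using fun w => Function.ne_iff.mp (hA w)
    have h1 : (∑ n, (fun w => if k w = n then (A w n)⁻¹ else 0) * (fun w => A w n))
        = (1 : W → ℂ) := by
      funext w
      simp only [Finset.sum_apply, Pi.mul_apply, ite_mul, zero_mul, Finset.sum_ite_eq,
        Finset.mem_univ, if_true, Pi.one_apply]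
      exact inv_mul_cancel₀ (hk w)
    have h2 := congrArg P.ψ h1
    rw [map_sum, map_one, Finset.sum_eq_zero] at h2
    · exact zero_ne_one h2
    · intro n _
      have : P.ψ (fun w => A w n) = 0 := congrFun h n
      rw [map_mul, this, mul_zero]
  obtain ⟨c, a, hc, ha, hn⟩ := exists_normalization P.O h0
  exact ⟨a, hn, c, hc, ha⟩

/-- If `x ^ (d - 1) v + ∑ y_j ^ d` lies on the secant variety, then `v` lies on a limit of secant
lines of `X` at `x`. -/
theorem IsSecantVec.exists_secant_limit {m d : ℕ} (hd : 2 * m + 3 ≤ d) {X : Set (PSpace σ)}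
    {x v : σ → ℂ} {y : Fin m → σ → ℂ}
    (h : IsSecantVec (m + 2) d X (verDeriv d x v + ∑ j, ver d (y j)))
    (hxv : Indep x v) (hxy : ∀ j, Indep x (y j)) (hy : ∀ j j', j ≠ j' → Indep (y j) (y j')) :
    ∃ (W : Type) (P : Place W) (A₀ A₁ : W → σ → ℂ) (a₀ a₁ : σ → P.O),
      (∀ w, A₀ w ∈ coneOf X) ∧ (∀ w, A₁ w ∈ coneOf X) ∧
      P.IsNormalForm A₀ a₀ ∧ P.IsNormalForm A₁ a₁ ∧
      ¬ Indep (P.π ∘ a₀) (P.ρ ∘ x) ∧ ¬ Indep (P.π ∘ a₁) (P.ρ ∘ x) ∧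
      ∀ w : σ → P.O, w ⬝ᵥ a₀ = 0 → w ⬝ᵥ a₁ = 0 → (P.π ∘ w) ⬝ᵥ (P.ρ ∘ v) = 0 := by
  classical
  -- All choices of points and coefficients at once: the generic secant vector is a vector of
  -- functions on `W`.
  let W := {p : (Fin (m + 2) → σ → ℂ) × (Fin (m + 2) → ℂ) // ∀ i, p.1 i ∈ coneOf X}
  obtain ⟨P, Z, hZ, hZp⟩ := exists_place (fun (w : W) => ∑ i, w.1.2 i • ver d (w.1.1 i))
    (verDeriv d x v + ∑ j, ver d (y j))
    (fun F hF => h.eval_eq_zero fun A hA c => hF ⟨(A, c), hA⟩)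
  choose a ha using fun i => P.exists_isNormalForm (A := fun w : W => w.1.1 i)
    (fun w => (w.2 i).choose)
  choose ha1 c hc0 hc using ha
  have hver : ∀ i (s : Sym σ d), ((ver d (a i) s : P.O) : P.K)
      = c i ^ d * P.ψ (fun w : W => ver d (w.1.1 i) s) := by
    intro i s
    have h1 : P.O.subtype (ver d (a i) s) = ver d (P.O.subtype ∘ a i) s := map_ver _ _ _
    have h2 : P.O.subtype ∘ a i = c i • fun n => P.ψ fun w : W => w.1.1 i n := by
      funext n
      exact hc i n
    change P.O.subtype (ver d (a i) s) = _
    rw [h1, h2, ver_smul]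
    simp only [Pi.smul_apply, smul_eq_mul]
    congr 1
    have h3 := map_ver P.ψ (fun (n : σ) (w : W) => w.1.1 i n) s
    rw [show (fun n => P.ψ fun w : W => w.1.1 i n)
      = P.ψ ∘ (fun (n : σ) (w : W) => w.1.1 i n) from rfl, ← h3]
    congr 1
    funext w
    exact map_ver (Pi.evalRingHom (fun _ : W => ℂ) w) _ s
  obtain ⟨i₀, i₁, h0, h1, h2⟩ := SecantVeronese.exists_secant_limit hd a ha1
    -- Normalizing the `i`-th point multiplies its `d`-th power by `c i ^ d`, which the coefficient
    -- compensates.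
    (fun i => P.ψ (fun w => w.1.2 i) * (c i ^ d)⁻¹) Z (fun s => by
      rw [hZ]
      have : (fun w : W => (∑ i, w.1.2 i • ver d (w.1.1 i)) s)
          = ∑ i, (fun w : W => w.1.2 i) * (fun w : W => ver d (w.1.1 i) s) := by
        funext w
        simp [Finset.sum_apply]
      rw [this, map_sum]
      refine Finset.sum_congr rfl fun i _ => ?_
      rw [hver, map_mul, mul_assoc, inv_mul_cancel_left₀ (pow_ne_zero _ (hc0 i))])
    (P.ρ ∘ x) (P.ρ ∘ v) (fun j => P.ρ ∘ y j) (by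
      funext s
      simp only [Function.comp_apply, hZp, Pi.add_apply, Finset.sum_apply, map_add, map_sum,
        map_ver, map_verDeriv])
    (hxv.map _) (fun j => (hxy j).map _) (fun j j' hj => (hy j j' hj).map _)
  exact ⟨W, P, fun w => w.1.1 i₀, fun w => w.1.1 i₁, a i₀, a i₁, fun w => w.2 i₀, fun w => w.2 i₁,
    ⟨ha1 i₀, c i₀, hc0 i₀, hc i₀⟩, ⟨ha1 i₁, c i₁, hc0 i₁, hc i₁⟩, h0, h1, h2⟩

/-- Near `x`, the set `X` consists of smooth branches with tangent vectors in `T`. -/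
def SmoothBranches (X : Set (PSpace σ)) (x : σ → ℂ) (T : Set (σ → ℂ)) : Prop :=
  ∀ (W : Type) (P : Place W) (A A' : W → σ → ℂ) (a a' : σ → P.O),
    (∀ w, A w ∈ coneOf X) → (∀ w, A' w ∈ coneOf X) → P.IsNormalForm A a → P.IsNormalForm A' a' →
    ¬ Indep (P.π ∘ a) (P.ρ ∘ x) → ¬ Indep (P.π ∘ a') (P.ρ ∘ x) →
    ∃ τ ∈ T, ∃ τ' ∈ T, ∃ (u u' : P.K) (ε ε' : P.O) (b b' : σ → P.O),
      (∀ n, (a n : P.K) = u * (P.j (x n) + ε * b n : P.O)) ∧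
      (∀ n, (a' n : P.K) = u' * (P.j (x n) + ε' * b' n : P.O)) ∧
      P.π ε = 0 ∧ P.π ε' = 0 ∧ P.π ∘ b = P.ρ ∘ τ ∧ P.π ∘ b' = P.ρ ∘ τ' ∧
      (τ = τ' → ∃ c : σ → P.O, P.π ∘ c = P.ρ ∘ τ ∧ ∀ n, ε * b n - ε' * b' n = (ε - ε') * c n)

/-- The constant lift of `l` kills `e` and `B` only modulo the maximal ideal. Since some two by two
minor `Δ` of `e` and `B` is a unit, Cramer's rule in two coordinates corrects it to kill both
exactly, and the correction reduces to zero. -/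
theorem exists_form_lift [DecidableEq σ] {W : Type} (P : Place W) {x : σ → ℂ} {e B : σ → P.O}
    (he : P.π ∘ e = P.ρ ∘ x) (h : Indep (P.ρ ∘ x) (P.π ∘ B)) (l : σ → ℂ) (hx : l ⬝ᵥ x = 0)
    (hB : (P.ρ ∘ l) ⬝ᵥ (P.π ∘ B) = 0) :
    ∃ w : σ → P.O, w ⬝ᵥ e = 0 ∧ w ⬝ᵥ B = 0 ∧ P.π ∘ w = P.ρ ∘ l := by
  rw [← he] at h
  obtain ⟨k, n, hkn⟩ := h
  set Δ : P.O := e k * B n - e n * B k with hΔ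
  have hu : IsUnit Δ := by
    rw [← IsLocalRing.residue_ne_zero_iff_isUnit]
    simpa [hΔ] using hkn
  obtain ⟨u, hu⟩ := hu.exists_right_inv
  set f : P.O := (P.j ∘ l) ⬝ᵥ e
  set g : P.O := (P.j ∘ l) ⬝ᵥ B
  have hf : P.π f = 0 := by
    rw [residue_dotProduct, he]
    have : P.ρ (l ⬝ᵥ x) = 0 := by rw [hx, map_zero]
    simpa [dotProduct, map_sum, Place.ρ_apply] using this
  have hg : P.π g = 0 := by
    rw [residue_dotProduct]
    exact hB
  refine ⟨P.j ∘ l - (u * (f * B n - g * e n)) • Pi.single k 1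
    - (u * (g * e k - f * B k)) • Pi.single n 1, ?_, ?_, ?_⟩
  · simp only [sub_dotProduct, smul_dotProduct, single_dotProduct, one_mul, smul_eq_mul]
    linear_combination (-f) * hu
  · simp only [sub_dotProduct, smul_dotProduct, single_dotProduct, one_mul, smul_eq_mul]
    linear_combination (-g) * hu
  · funext i
    simp [hf, hg, Place.ρ_apply]

/-- On a variety with smooth branches at `x`, limits of secant lines at `x` are contained in the
spans of `x` and two tangent vectors. -/
theorem SmoothBranches.exists_tangents {X : Set (PSpace σ)} {x : σ → ℂ} {T : Set (σ → ℂ)}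
    (hT : SmoothBranches X x T) (hT1 : ∀ τ ∈ T, ∃ p : σ → ℂ, p ⬝ᵥ x = 0 ∧ p ⬝ᵥ τ ≠ 0)
    (hT2 : ∀ τ ∈ T, ∀ τ' ∈ T, τ ≠ τ' → ∃ p : σ → ℂ, p ⬝ᵥ x = 0 ∧ p ⬝ᵥ τ ≠ 0 ∧ p ⬝ᵥ τ' = 0)
    {m d : ℕ} (hd : 2 * m + 3 ≤ d) {v : σ → ℂ} {y : Fin m → σ → ℂ}
    (h : IsSecantVec (m + 2) d X (verDeriv d x v + ∑ j, ver d (y j)))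
    (hxv : Indep x v) (hxy : ∀ j, Indep x (y j)) (hy : ∀ j j', j ≠ j' → Indep (y j) (y j')) :
    ∃ τ ∈ T, ∃ τ' ∈ T, ∀ l : σ → ℂ, l ⬝ᵥ x = 0 → l ⬝ᵥ τ = 0 → l ⬝ᵥ τ' = 0 → l ⬝ᵥ v = 0 := by
  classical
  obtain ⟨W, P, A, A', a, a', hA, hA', hAa, hAa', hax, hax', hlim⟩ :=
    h.exists_secant_limit hd hxv hxy hy
  obtain ⟨τ, hτ, τ', hτ', u, u', ε, ε', b, b', ha, ha', hε, hε', hb, hb', hc⟩ :=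
    hT W P A A' a a' hA hA' hAa hAa' hax hax'
  refine ⟨τ, hτ, τ', hτ', fun l hx hlτ hlτ' => ?_⟩
  have hρ : ∀ p q : σ → ℂ, P.ρ (p ⬝ᵥ q) = (P.ρ ∘ p) ⬝ᵥ (P.ρ ∘ q) := by
    intro p q
    simp [dotProduct, map_sum]
  have kill : ∀ (w a e : σ → P.O) (u : P.K), (∀ n, (a n : P.K) = u * (e n : P.K)) →
      w ⬝ᵥ e = 0 → w ⬝ᵥ a = 0 := by
    intro w a e u ha he
    apply Subtype.val_injective
    have h1 : ((w ⬝ᵥ a : P.O) : P.K) = u * ((w ⬝ᵥ e : P.O) : P.K) := by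
      change P.O.subtype _ = u * P.O.subtype _
      simp only [dotProduct, map_sum, map_mul, Finset.mul_sum]
      refine Finset.sum_congr rfl fun n _ => ?_
      change (w n : P.K) * (a n : P.K) = u * ((w n : P.K) * (e n : P.K))
      rw [ha]; ring
    rw [h1, he]
    simp
  set e : σ → P.O := fun n => P.j (x n) + ε * b n
  set e' : σ → P.O := fun n => P.j (x n) + ε' * b' n
  have he : P.π ∘ e = P.ρ ∘ x := by
    funext n
    simp [e, hε, Place.ρ_apply]
  have he' : P.π ∘ e' = P.ρ ∘ x := by
    funext n
    simp [e', hε', Place.ρ_apply]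
  -- it suffices to find a vector spanning the secant line together with `e` (or `e'`)
  have finish : ∀ w : σ → P.O, w ⬝ᵥ e = 0 → w ⬝ᵥ e' = 0 → P.π ∘ w = P.ρ ∘ l → l ⬝ᵥ v = 0 := by
    intro w hw hw' hwl
    have := hlim w (kill w a e u ha hw) (kill w a' e' u' ha' hw')
    rw [hwl, ← hρ] at this
    exact (map_eq_zero P.ρ).mp this
  have indep : ∀ (p : σ → ℂ) (B : σ → P.κ), p ⬝ᵥ x = 0 → (P.ρ ∘ p) ⬝ᵥ B ≠ 0 →
      Indep (P.ρ ∘ x) B := by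
    intro p B hpx hpB
    have hx0 : x ≠ 0 := hxv.symm.ne_zero
    by_contra hcon
    have hx0' : P.ρ ∘ x ≠ 0 := by
      intro h0
      refine hx0 (funext fun n => ?_)
      exact (map_eq_zero P.ρ).mp (congrFun h0 n)
    obtain ⟨s, rfl⟩ := (not_indep_iff hx0').mp fun h => hcon h.symm
    apply hpB
    rw [dotProduct_smul, ← hρ, hpx, map_zero, smul_zero]
  have diff : ∀ (w e₁ e₂ B : σ → P.O) (s : P.O), (∀ n, e₁ n - e₂ n = s * B n) →
      w ⬝ᵥ e₁ = 0 → w ⬝ᵥ B = 0 → w ⬝ᵥ e₂ = 0 := by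
    intro w e₁ e₂ B s hs h1 hB
    have : e₂ = e₁ - s • B := by
      funext n
      simp only [Pi.sub_apply, Pi.smul_apply, smul_eq_mul, ← hs]
      ring
    rw [this, dotProduct_sub, dotProduct_smul, h1, hB, smul_zero, sub_zero]
  have res : ∀ (b b' : σ → P.O) (η : P.O) (τ τ' : σ → ℂ) (l : σ → ℂ), P.π ∘ b = P.ρ ∘ τ →
      P.π ∘ b' = P.ρ ∘ τ' → (P.ρ ∘ l) ⬝ᵥ (P.π ∘ (b - η • b'))
        = P.ρ (l ⬝ᵥ τ) - P.π η * P.ρ (l ⬝ᵥ τ') := by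
    intro b b' η τ τ' l hb hb'
    have : P.π ∘ (b - η • b') = P.ρ ∘ τ - P.π η • (P.ρ ∘ τ') := by
      rw [← hb, ← hb']
      funext n
      simp
    rw [this, dotProduct_sub, dotProduct_smul, hρ, hρ, smul_eq_mul]
  -- For equal tangents, `e - e'` is a multiple of a vector `c` reducing to `τ`; a form killing `e`
  -- and `c` therefore kills both points, and the limit of the secant line is `⟨x, τ⟩`.
  by_cases hne : τ = τ'
  · obtain ⟨c, hcτ, hc⟩ := hc hne
    obtain ⟨p, hpx, hpτ⟩ := hT1 τ hτ
    obtain ⟨w, hwe, hwc, hwl⟩ := exists_form_lift P he (B := c) (indep p _ hpx (by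
      rw [hcτ, ← hρ]; exact (map_ne_zero P.ρ).mpr hpτ)) l hx (by rw [hcτ, ← hρ, hlτ, map_zero])
    refine finish w hwe (diff w e e' c (ε - ε') (fun n => ?_) hwe hwc) hwl
    rw [← hc]
    simp only [e, e']
    ring
  -- For different tangents, divide by the larger of the two parameters: if `ε' = ε η`, then `e - e'
  -- = ε (b - η b')`, and `b - η b'` reduces to `τ - η τ'`, which is independent of `x` by `hT2`.
  · rcases ValuationRing.dvd_total ε ε' with ⟨η, hη⟩ | ⟨η, hη⟩
    · obtain ⟨p, hpx, hpτ, hpτ'⟩ := hT2 τ hτ τ' hτ' hne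
      obtain ⟨w, hwe, hwc, hwl⟩ := exists_form_lift P he (B := b - η • b') (indep p _ hpx (by
        rw [res b b' η τ τ' p hb hb', hpτ', map_zero, mul_zero, sub_zero]
        exact (map_ne_zero P.ρ).mpr hpτ)) l hx (by
        rw [res b b' η τ τ' l hb hb', hlτ, hlτ', map_zero, mul_zero, sub_zero])
      refine finish w hwe (diff w e e' _ ε (fun n => ?_) hwe hwc) hwl
      simp only [e, e', hη, Pi.sub_apply, Pi.smul_apply, smul_eq_mul]
      ring
    · obtain ⟨p, hpx, hpτ', hpτ⟩ := hT2 τ' hτ' τ hτ (Ne.symm hne)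
      obtain ⟨w, hwe, hwc, hwl⟩ := exists_form_lift P he' (B := b' - η • b) (indep p _ hpx (by
        rw [res b' b η τ' τ p hb' hb, hpτ, map_zero, mul_zero, sub_zero]
        exact (map_ne_zero P.ρ).mpr hpτ')) l hx (by
        rw [res b' b η τ' τ l hb' hb, hlτ, hlτ', map_zero, mul_zero, sub_zero])
      refine finish w (diff w e' e _ ε' (fun n => ?_) hwe hwc) hwe hwl
      simp only [e, e', hη, Pi.sub_apply, Pi.smul_apply, smul_eq_mul]
      ring

end Limits

end SecantVeronese

/-! ### Tangent vectors to arcs -/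

namespace SecantVeronese

open MvPolynomial hiding zeroLocus
open Topology

section Arcs

variable {σ : Type}

/-- The vector `τ` is tangent at `x` to an arc in the cone over `X`. -/
def IsArcTangent [Fintype σ] (X : Set (PSpace σ)) (x τ : σ → ℂ) : Prop :=
  ∃ A : ℂ → σ → ℂ, A 0 = x ∧ (∀ᶠ ε in 𝓝 0, A ε ∈ coneOf X) ∧ HasDerivAt A τ 0

theorem hasDerivAt_multiset_prod [Fintype σ] {A : ℂ → σ → ℂ} {τ : σ → ℂ} (hA : HasDerivAt A τ 0)
    (s : Multiset σ) :
    HasDerivAt (fun ε => (s.map (A ε)).prod) (multisetDeriv (A 0) τ s) 0 := by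
  induction s using Multiset.induction with
  | empty => simpa [multisetDeriv_zero] using hasDerivAt_const (0 : ℂ) (1 : ℂ)
  | cons a s ih =>
    simp only [Multiset.map_cons, Multiset.prod_cons]
    rw [multisetDeriv_cons]
    exact ((hasDerivAt_pi.mp hA) a).mul ih

theorem hasDerivAt_ver [Fintype σ] [DecidableEq σ] (d : ℕ) {A : ℂ → σ → ℂ} {τ : σ → ℂ}
    (hA : HasDerivAt A τ 0) :
    HasDerivAt (fun ε => ver d (A ε)) (verDeriv d (A 0) τ) 0 :=
  hasDerivAt_pi.mpr fun s => hasDerivAt_multiset_prod hA s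

theorem hasDerivAt_eval [Fintype σ] (F : MvPolynomial σ ℂ) {A : ℂ → σ → ℂ} {τ : σ → ℂ}
    (hA : HasDerivAt A τ 0) :
    HasDerivAt (fun ε => eval (A ε) F) (∑ i, eval (A 0) (pderiv i F) * τ i) 0 := by
  classical
  induction F using MvPolynomial.induction_on with
  | C a => simpa using hasDerivAt_const (0 : ℂ) a
  | add p q hp hq =>
    simp only [map_add, add_mul, Finset.sum_add_distrib]
    exact hp.add hq
  | mul_X p n hp =>
    simp only [map_mul, eval_X]
    refine (hp.mul ((hasDerivAt_pi.mp hA) n)).congr_deriv ?_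
    simp only [Derivation.leibniz, pderiv_X, smul_eq_mul, map_add, map_mul, eval_X, add_mul,
      Finset.sum_add_distrib]
    rw [add_comm]
    congr 1
    · rw [Finset.sum_eq_single n]
      · simp
      · intro i _ hi
        simp [hi.symm]
      · simp
    · rw [Finset.sum_mul]
      exact Finset.sum_congr rfl fun i _ => by ring

variable [Fintype σ] {X : Set (PSpace σ)} {x τ τ' : σ → ℂ}

theorem IsArcTangent.mem_coneOf (h : IsArcTangent X x τ) : x ∈ coneOf X := by
  obtain ⟨A, rfl, hA, -⟩ := h
  exact hA.self_of_nhds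

/-- If `A` is an arc with velocity `τ`, then `(1 + a ε) A (b ε)` has velocity `a x + b τ`. -/
theorem IsArcTangent.smul_add (h : IsArcTangent X x τ) (a b : ℂ) :
    IsArcTangent X x (a • x + b • τ) := by
  obtain ⟨A, rfl, hA, hd⟩ := h
  have h1 : HasDerivAt (fun ε : ℂ => b * ε) b 0 := by
    simpa using (hasDerivAt_id (0 : ℂ)).const_mul b
  have h2 : HasDerivAt (fun ε : ℂ => 1 + a * ε) a 0 := by
    simpa using ((hasDerivAt_id (0 : ℂ)).const_mul a).const_add 1
  have ht1 : Filter.Tendsto (fun ε : ℂ => b * ε) (𝓝 0) (𝓝 0) := by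
    simpa using h1.continuousAt.tendsto
  have ht2 : Filter.Tendsto (fun ε : ℂ => 1 + a * ε) (𝓝 0) (𝓝 1) := by
    simpa using h2.continuousAt.tendsto
  refine ⟨fun ε => (1 + a * ε) • A (b * ε), by simp, ?_, ?_⟩
  · filter_upwards [ht1.eventually hA, ht2.eventually_ne one_ne_zero] with ε h3 h4
    exact smul_mem_coneOf h3 h4
  · have h3 : HasDerivAt (fun ε : ℂ => A (b * ε)) (b • τ) 0 := by
      have hd' : HasDerivAt A τ (b * 0) := by simpa using hd
      exact hd'.scomp (0 : ℂ) h1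
    refine (h2.smul h3).congr_deriv ?_
    simp [add_comm]

theorem isArcTangent_univ {x : σ → ℂ} (hx : x ≠ 0) (v : σ → ℂ) : IsArcTangent Set.univ x v := by
  have h1 : HasDerivAt (fun ε : ℂ => x + ε • v) v 0 := by
    simpa using ((hasDerivAt_id (0 : ℂ)).smul_const v).const_add x
  refine ⟨fun ε => x + ε • v, by simp, ?_, h1⟩
  have : Filter.Tendsto (fun ε : ℂ => x + ε • v) (𝓝 0) (𝓝 x) := by
    simpa using h1.continuousAt.tendsto
  filter_upwards [this.eventually_ne hx] with ε hε
  exact ⟨hε, trivial⟩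

/-- Chain rule along the arc, on which `F` is identically zero. The scalar `c` accounts for
`affineTangentSpace` using the chosen representative of the point. -/
theorem IsArcTangent.sum_pderiv_eq_zero (h : IsArcTangent X x τ) {F : MvPolynomial σ ℂ} {m : ℕ}
    (hF : F.IsHomogeneous m) (hX : ∀ y ∈ X, VanishesAt F y) {c : ℂ} (hc : c ≠ 0) :
    ∑ i, eval (c • x) (pderiv i F) * τ i = 0 := by
  obtain ⟨A, rfl, hA, hd⟩ := h
  have h1 := hasDerivAt_eval F (hd.const_smul c)
  have h2 : (fun ε => eval ((c • A) ε) F) =ᶠ[𝓝 0] fun _ => 0 := by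
    filter_upwards [hA] with ε hε
    obtain ⟨h0, h3⟩ := smul_mem_coneOf hε hc
    exact (vanishesAt_mk hF h0).mp (hX _ h3)
  have h3 := h1.unique ((hasDerivAt_const (0 : ℂ) (0 : ℂ)).congr_of_eventuallyEq h2)
  have h4 : c * ∑ i, eval (c • A 0) (pderiv i F) * τ i = 0 := by
    rw [Finset.mul_sum]
    refine Eq.trans (Finset.sum_congr rfl fun i _ => ?_) h3
    simp only [Pi.smul_apply, smul_eq_mul]
    ring
  exact (mul_eq_zero.mp h4).resolve_left hc

/-- Both arcs start at `x`, so `t⁻¹ (A t ^ d - A' t ^ d)` tends to the derivative in the direction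
`τ - τ'`. Polynomials are continuous, so an equation of the secant cone persists in the limit. -/
theorem isSecantVec_of_isArcTangent [DecidableEq σ] {m d : ℕ} (h : IsArcTangent X x τ)
    (h' : IsArcTangent X x τ')
    {y : Fin m → σ → ℂ} (hy : ∀ j, y j ∈ coneOf X) :
    IsSecantVec (m + 2) d X (verDeriv d x (τ - τ') + ∑ j, ver d (y j)) := by
  obtain ⟨A, hA0, hA, hd⟩ := h
  obtain ⟨A', hA0', hA', hd'⟩ := h'
  intro F k hF hv
  have h1 := (hasDerivAt_ver d hd).sub (hasDerivAt_ver d hd')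
  rw [hA0, hA0', ← verDeriv_sub, hasDerivAt_iff_tendsto_slope_zero] at h1
  have h2 : Filter.Tendsto (fun t : ℂ => eval (t⁻¹ • (ver d (A t) - ver d (A' t))
      + ∑ j, ver d (y j)) F) (𝓝[≠] 0) (𝓝 (eval (verDeriv d x (τ - τ') + ∑ j, ver d (y j)) F)) := by
    refine ((MvPolynomial.continuous_eval F).tendsto _).comp (Filter.Tendsto.add_const _ ?_)
    convert h1 using 3 with t
    simp [hA0, hA0']
  refine tendsto_nhds_unique h2 (tendsto_const_nhds.congr' ?_)
  filter_upwards [nhdsWithin_le_nhds hA, nhdsWithin_le_nhds hA'] with t ht ht'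
  have h3 := hv (Fin.cons (A t) (Fin.cons (A' t) y)) (by
    intro i
    refine Fin.cases ht (fun i => ?_) i
    refine Fin.cases ht' (fun i => ?_) i
    exact hy i) (Fin.cons t⁻¹ (Fin.cons (-t⁻¹) fun _ => 1))
  rw [Fin.sum_univ_succ, Fin.sum_univ_succ] at h3
  simp only [Fin.cons_zero, Fin.cons_succ, one_smul] at h3
  rw [← h3]
  congr 1
  rw [smul_sub, neg_smul, ← add_assoc, sub_eq_add_neg]

/-- Difference quotients lie in the span, which is closed because it is finite dimensional. -/
theorem verDeriv_mem_span [DecidableEq σ] (d : ℕ) (h : IsArcTangent X x τ) :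
    verDeriv d x τ ∈ Submodule.span ℂ (ver d '' coneOf X) := by
  obtain ⟨A, hA0, hA, hd⟩ := h
  have h1 := hasDerivAt_ver d hd
  rw [hA0, hasDerivAt_iff_tendsto_slope_zero] at h1
  have hcl : IsClosed (Submodule.span ℂ (ver d '' coneOf X) : Set (Sym σ d → ℂ)) :=
    Submodule.closed_of_finiteDimensional _
  refine hcl.mem_of_tendsto h1 ?_
  filter_upwards [nhdsWithin_le_nhds hA] with t ht
  refine Submodule.smul_mem _ _ (Submodule.sub_mem _ ?_ ?_)
  · rw [zero_add]
    exact Submodule.subset_span ⟨_, ht, rfl⟩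
  · exact Submodule.subset_span ⟨_, hA.self_of_nhds, rfl⟩

end Arcs

/-! ### Curves in projective space -/

section Curve

variable {σ : Type}

theorem isClosed_singleton (p : PSpace σ) : IsClosed ({p} : Set (PSpace σ)) := by
  rw [← closure_subset_iff_isClosed]
  intro q hq
  rw [mem_closure_iff_vanishesAt] at hq
  have h : ¬ Indep q.rep p.rep := by
    rintro ⟨k, l, h⟩
    have h1 := hq (X k * C (p.rep l) - X l * C (p.rep k)) 1 (by
      refine IsHomogeneous.sub ?_ ?_ <;>
      · simpa using (isHomogeneous_X ℂ _).mul (isHomogeneous_C σ _)) (by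
      rintro _ rfl
      simp [VanishesAt]
      ring)
    exact h (by simpa [VanishesAt] using h1)
  obtain ⟨c, hc⟩ := (not_indep_iff p.rep_nonzero).mp h
  rw [Set.mem_singleton_iff, ← q.mk_rep, ← p.mk_rep, Projectivization.mk_eq_mk_iff']
  exact ⟨c, hc.symm⟩

/-- If neither closed set contains `X`, each has an equation not vanishing on all of `X`, while the
product of these two equations vanishes on `X`. -/
theorem isIrreducible_of_forall_mul {X : Set (PSpace σ)} (hne : X.Nonempty)
    (h : ∀ (F G : MvPolynomial σ ℂ) (m k : ℕ), F.IsHomogeneous m → G.IsHomogeneous k →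
      (∀ x ∈ X, VanishesAt F x ∨ VanishesAt G x) →
      (∀ x ∈ X, VanishesAt F x) ∨ ∀ x ∈ X, VanishesAt G x) : IsIrreducible X := by
  refine ⟨hne, isPreirreducible_iff_isClosed_union_isClosed.mpr fun Z₁ Z₂ h₁ h₂ hX => ?_⟩
  obtain ⟨E₁, hE₁, rfl⟩ := isClosed_iff_isAlgebraicSet.mp h₁
  obtain ⟨E₂, hE₂, rfl⟩ := isClosed_iff_isAlgebraicSet.mp h₂
  by_contra! hcon
  obtain ⟨⟨x, hx, hx1⟩, ⟨y, hy, hy1⟩⟩ := And.imp Set.not_subset.mp Set.not_subset.mp hcon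
  simp only [zeroLocus, Set.mem_ofPred_eq, not_forall] at hx1 hy1
  obtain ⟨F, hF, hFx⟩ := hx1
  obtain ⟨G, hG, hGy⟩ := hy1
  obtain ⟨m, hm⟩ := hE₁ F hF
  obtain ⟨k, hk⟩ := hE₂ G hG
  rcases h F G m k hm hk fun z hz => (hX hz).imp (fun h => h F hF) fun h => h G hG with h | h
  · exact hFx (h x hx)
  · exact hGy (h y hy)

/-- An irreducible closed subset of projective space in which every proper hypersurface section is
finite. -/
structure IsProjCurve (X : Set (PSpace σ)) : Prop where
  isVariety : IsVariety X
  finite : ∀ (F : MvPolynomial σ ℂ) (m : ℕ), F.IsHomogeneous m → (∃ x ∈ X, ¬ VanishesAt F x) →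
    {x ∈ X | VanishesAt F x}.Finite

theorem eq_singleton_of_finite {Y : Type*} [TopologicalSpace Y] {S : Set Y}
    (hcl : ∀ y ∈ S, IsClosed ({y} : Set Y)) (hS : IsIrreducible S) (hfin : S.Finite) :
    ∃ y, S = {y} := by
  classical
  obtain ⟨z, hz, hSz⟩ := isIrreducible_iff_sUnion_isClosed.mp hS
    (hfin.toFinset.image fun y => {y}) (by
      intro z hz
      obtain ⟨y, hy, rfl⟩ := Finset.mem_image.mp hz
      exact hcl y (by simpa using hy)) (by
      intro y hy
      exact ⟨{y}, by simpa using hy, rfl⟩)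
  obtain ⟨y, hy, rfl⟩ := Finset.mem_image.mp hz
  exact ⟨y, subset_antisymm hSz (by simpa using hy)⟩

theorem IsProjCurve.infinite {X : Set (PSpace σ)} (hX : IsProjCurve X) {x y : PSpace σ} (hx : x ∈ X)
    (hy : y ∈ X) (hxy : x ≠ y) : X.Infinite := by
  intro hfin
  obtain ⟨z, rfl⟩ := eq_singleton_of_finite (fun y _ => isClosed_singleton y) hX.isVariety.2 hfin
  exact hxy ((Set.mem_singleton_iff.mp hx).trans (Set.mem_singleton_iff.mp hy).symm)

/-- A proper closed subset lies in a proper hypersurface section and is finite, so the irreducible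
closed subsets are the points and `X`; the second point makes these different. -/
theorem IsProjCurve.topologicalKrullDim_eq {X : Set (PSpace σ)} (hX : IsProjCurve X)
    {x y : PSpace σ} (hx : x ∈ X) (hy : y ∈ X) (hxy : x ≠ y) : topologicalKrullDim X = 1 := by
  have hirr : IrreducibleSpace X := isIrreducible_iff_irreducibleSpace.mp hX.isVariety.2
  have hcl : ∀ y : X, IsClosed ({y} : Set X) := by
    intro y
    have : ({y} : Set X) = Subtype.val ⁻¹' {y.1} := by
      ext z
      simp [Subtype.ext_iff]
    rw [this]
    exact (isClosed_singleton y.1).preimage continuous_subtype_val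
  let top : TopologicalSpace.IrreducibleCloseds X :=
    ⟨Set.univ, IrreducibleSpace.isIrreducible_univ X, isClosed_univ⟩
  let pt : X → TopologicalSpace.IrreducibleCloseds X := fun y =>
    ⟨{y}, isIrreducible_singleton, hcl y⟩
  refine le_antisymm ?_ ?_
  · refine Order.krullDim_le_one_iff.mpr fun Z => ?_
    by_cases hZ : (Z : Set X) = Set.univ
    · exact Or.inr fun Z' _ => by
        change (Z' : Set X) ⊆ (Z : Set X)
        rw [hZ]
        exact Set.subset_univ _
    · left
      have hfin : (Z : Set X).Finite := by
        obtain ⟨Z', hZ', hZZ'⟩ := isClosed_induced_iff.mp Z.isClosed'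
        obtain ⟨E, hE, rfl⟩ := isClosed_iff_isAlgebraicSet.mp hZ'
        have : ∃ F ∈ E, ∃ x ∈ X, ¬ VanishesAt F x := by
          by_contra! hcon
          apply hZ
          change Z.carrier = _
          rw [← hZZ']
          exact Set.eq_univ_of_forall fun z F hF => hcon F hF z.1 z.2
        obtain ⟨F, hF, hFx⟩ := this
        obtain ⟨m, hm⟩ := hE F hF
        refine ((hX.finite F m hm hFx).preimage
          (f := (Subtype.val : X → PSpace σ)) Subtype.val_injective.injOn).subset ?_
        intro z hz
        change z ∈ Z.carrier at hz
        rw [← hZZ'] at hz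
        exact ⟨z.2, hz F hF⟩
      obtain ⟨z, hz⟩ := eq_singleton_of_finite (fun y _ => hcl y) Z.isIrreducible' hfin
      intro Z' hZ'
      change Z.carrier ⊆ Z'.carrier
      have h1 : Z'.carrier ⊆ Z.carrier := hZ'
      rw [hz] at h1 ⊢
      obtain ⟨w, hw⟩ := Z'.isIrreducible'.nonempty
      have := Set.mem_singleton_iff.mp (h1 hw)
      rw [← this]
      exact Set.singleton_subset_iff.mpr hw
  · refine Order.one_le_krullDim_iff.mpr ⟨pt ⟨x, hx⟩, top, lt_of_le_of_ne ?_ ?_⟩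
    · change ({⟨x, hx⟩} : Set X) ⊆ Set.univ
      exact Set.subset_univ _
    · intro h
      have h1 : ({⟨x, hx⟩} : Set X) = Set.univ := congrArg (fun Z => Z.carrier) h
      have h2 : (⟨y, hy⟩ : X) ∈ ({⟨x, hx⟩} : Set X) := h1 ▸ Set.mem_univ _
      exact hxy (congrArg Subtype.val (Set.mem_singleton_iff.mp h2)).symm

end Curve

end SecantVeronese

/-! ### Points with several smooth branches -/

namespace SecantVeronese

open MvPolynomial hiding zeroLocus
open Topology

section Multibranch

variable {σ : Type} [Fintype σ]

/-- Near `x`, the set `X` consists of smooth branches with tangent vectors in the finite set `T`,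
and the spans of `x` and two elements of `T` contain `N` different hyperplanes. -/
structure IsMultibranchPoint (N : ℕ) (X : Set (PSpace σ)) (x : σ → ℂ) (T : Set (σ → ℂ)) :
    Prop where
  finite : T.Finite
  nonempty : T.Nonempty
  branches : SmoothBranches X x T
  tangent : ∀ τ ∈ T, IsArcTangent X x τ
  indep : ∀ τ ∈ T, ∃ p : σ → ℂ, p ⬝ᵥ x = 0 ∧ p ⬝ᵥ τ ≠ 0
  indep_pair : ∀ τ ∈ T, ∀ τ' ∈ T, τ ≠ τ' → ∃ p : σ → ℂ, p ⬝ᵥ x = 0 ∧ p ⬝ᵥ τ ≠ 0 ∧ p ⬝ᵥ τ' = 0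
  span_eq_top : Submodule.span ℂ (insert x T) = ⊤
  planes : ∃ l : Fin N → σ → ℂ,
    (∀ a z, l a ⬝ᵥ z = 0 → ∃ τ ∈ T, ∃ τ' ∈ T, z ∈ Submodule.span ℂ {x, τ, τ'}) ∧
    ∀ a b, a ≠ b → ∃ z, l a ⬝ᵥ z = 0 ∧ l b ⬝ᵥ z ≠ 0

omit [Fintype σ] in
theorem eval_eq_zero_of_mem_span {G : MvPolynomial σ ℂ} (hG : G.IsHomogeneous 1)
    {S : Set (σ → ℂ)} (hS : ∀ z ∈ S, eval z G = 0) {z : σ → ℂ} (hz : z ∈ Submodule.span ℂ S) :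
    eval z G = 0 := by
  induction hz using Submodule.span_induction with
  | mem z hz => exact hS z hz
  | zero =>
    have h := eval_smul_of_isHomogeneous hG 0 (0 : σ → ℂ)
    rwa [zero_smul, pow_one, zero_mul] at h
  | smul c z _ hz => rw [eval_smul_of_isHomogeneous hG, hz, mul_zero]
  | add z w _ _ hz hw =>
    suffices h : eval (z + w) G = eval z G + eval w G by rw [h, hz, hw, add_zero]
    rw [eval_eq, eval_eq, eval_eq, ← Finset.sum_add_distrib]
    refine Finset.sum_congr rfl fun s hs => ?_
    have h1 : s.degree = 1 := by
      rw [Finsupp.degree_eq_weight_one]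
      exact hG (mem_support_iff.mp hs)
    obtain ⟨i, rfl⟩ : s ∈ Set.range fun i : σ => Finsupp.single i 1 := by
      rw [Finsupp.range_single_one]
      exact h1
    simp [mul_add]

theorem exists_dotProduct_of_notMem [DecidableEq σ] {S : Submodule ℂ (σ → ℂ)} {v : σ → ℂ}
    (hv : v ∉ S) : ∃ l : σ → ℂ, l ⬝ᵥ v ≠ 0 ∧ ∀ z ∈ S, l ⬝ᵥ z = 0 := by
  obtain ⟨f, hfv, hf⟩ := Submodule.exists_le_ker_of_notMem hv
  have h : ∀ z, (fun i => f (Pi.single i 1)) ⬝ᵥ z = f z := by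
    intro z
    conv_rhs => rw [pi_eq_sum_univ' z]
    simp [dotProduct, map_sum, map_smul, mul_comm]
  exact ⟨fun i => f (Pi.single i 1), by rwa [h], fun z hz => by rw [h]; exact hf hz⟩

omit [Fintype σ] in
theorem indep_of_mk_ne {x y : σ → ℂ} (hx : x ≠ 0) (hy : y ≠ 0)
    (h : Projectivization.mk ℂ x hx ≠ Projectivization.mk ℂ y hy) : Indep x y := by
  by_contra hcon
  obtain ⟨c, hc⟩ := (not_indep_iff hy).mp hcon
  exact h ((Projectivization.mk_eq_mk_iff' ℂ _ _ _ _).mpr ⟨c, hc.symm⟩)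

omit [Fintype σ] in
theorem exists_indep_points {X : Set (PSpace σ)} (hX : X.Infinite) {x : σ → ℂ} (hx : x ≠ 0)
    (m : ℕ) : ∃ y : Fin m → σ → ℂ, (∀ j, y j ∈ coneOf X) ∧ (∀ j, Indep x (y j)) ∧
      ∀ j j', j ≠ j' → Indep (y j) (y j') := by
  have h1 : (X \ {Projectivization.mk ℂ x hx}).Infinite := hX.sdiff (Set.finite_singleton _)
  have := h1.to_subtype
  let f := Infinite.natEmbedding ↥(X \ {Projectivization.mk ℂ x hx})
  refine ⟨fun j => (f j).1.rep, fun j => rep_mem_coneOf (f j).2.1, fun j => ?_, fun j j' hj => ?_⟩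
  · refine indep_of_mk_ne hx (f j).1.rep_nonzero ?_
    rw [Projectivization.mk_rep]
    exact fun h => (f j).2.2 h.symm
  · refine indep_of_mk_ne (f j).1.rep_nonzero (f j').1.rep_nonzero ?_
    rw [Projectivization.mk_rep, Projectivization.mk_rep]
    exact fun h => hj (Fin.ext (f.injective (Subtype.ext h)))

omit [Fintype σ] in
theorem exists_notMem_of_ne_top {ι : Type*} [Finite ι] (S : ι → Submodule ℂ (σ → ℂ))
    (hS : ∀ i, S i ≠ ⊤) : ∃ v, ∀ i, v ∉ S i := by
  by_contra! hcon
  obtain ⟨i, hi⟩ := Subspace.exists_eq_top_of_iUnion_eq_univ (p := S)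
    (Set.eq_univ_of_forall fun v => Set.mem_iUnion.mpr (hcon v))
  exact hS i hi

namespace IsMultibranchPoint

variable {N : ℕ} {X : Set (PSpace σ)} {x : σ → ℂ} {T : Set (σ → ℂ)}

theorem mem_coneOf (h : IsMultibranchPoint N X x T) : x ∈ coneOf X :=
  (h.tangent _ h.nonempty.some_mem).mem_coneOf

theorem ne_zero (h : IsMultibranchPoint N X x T) : x ≠ 0 := h.mem_coneOf.choose

/-- An arc staying at the point `x` would have velocity proportional to `x`, which a form vanishing
at `x` but not at `τ` excludes. -/
theorem exists_mem_ne (h : IsMultibranchPoint N X x T) (hx : x ≠ 0) :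
    ∃ y ∈ X, y ≠ Projectivization.mk ℂ x hx := by
  by_contra! hcon
  obtain ⟨τ, hτ⟩ := h.nonempty
  obtain ⟨p, hpx, hpτ⟩ := h.indep τ hτ
  obtain ⟨A, hA0, hA, hd⟩ := h.tangent τ hτ
  have h1 : HasDerivAt (fun ε => p ⬝ᵥ A ε) (p ⬝ᵥ τ) 0 :=
    HasDerivAt.fun_sum fun i _ => ((hasDerivAt_pi.mp hd) i).const_mul (p i)
  have h2 : (fun ε => p ⬝ᵥ A ε) =ᶠ[𝓝 0] fun _ => 0 := by
    filter_upwards [hA] with ε ⟨h0, hε⟩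
    obtain ⟨c, hc⟩ := (Projectivization.mk_eq_mk_iff' ℂ _ _ _ _).mp (hcon _ hε)
    rw [← hc, dotProduct_smul, hpx, smul_zero]
  exact hpτ (h1.unique ((hasDerivAt_const (0 : ℂ) (0 : ℂ)).congr_of_eventuallyEq h2))

/-- The space has dimension four, so each of the finitely many spans is proper, and finitely many
proper subspaces do not cover a complex vector space. -/
theorem exists_generic (h : IsMultibranchPoint N X x T) (hσ : Fintype.card σ = 4) :
    ∃ v : σ → ℂ, ∀ τ ∈ T, ∀ τ' ∈ T, v ∉ Submodule.span ℂ {x, τ, τ'} := by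
  have := h.finite.to_subtype
  obtain ⟨v, hv⟩ := exists_notMem_of_ne_top
    (fun i : T × T => Submodule.span ℂ {x, i.1.1, i.2.1}) (by
      intro i htop
      have h1 := finrank_span_le_card (R := ℂ) ({x, i.1.1, i.2.1} : Set (σ → ℂ))
      rw [htop, finrank_top, Module.finrank_fintype_fun_eq_card, hσ] at h1
      have h2 : ({x, i.1.1, i.2.1} : Set (σ → ℂ)).toFinset.card ≤ 3 := by
        classical
        simp only [Set.toFinset_insert, Set.toFinset_singleton]
        exact Finset.card_le_three
      omega)
  exact ⟨v, fun τ hτ τ' hτ' => hv (⟨τ, hτ⟩, ⟨τ', hτ'⟩)⟩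

theorem affineTangentSpace_eq_top (h : IsMultibranchPoint N X x T) (hx : x ≠ 0) :
    affineTangentSpace X (Projectivization.mk ℂ x hx) = ⊤ := by
  rw [eq_top_iff, ← h.span_eq_top, Submodule.span_le]
  obtain ⟨c, hc⟩ := Projectivization.exists_smul_eq_mk_rep ℂ x hx
  have key : ∀ τ, IsArcTangent X x τ → τ ∈ affineTangentSpace X (Projectivization.mk ℂ x hx) := by
    intro τ hτ F m hF hX
    rw [← hc, Units.smul_def]
    exact hτ.sum_pderiv_eq_zero hF hX c.ne_zero
  intro v hv
  rcases Set.mem_insert_iff.mp hv with rfl | hv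
  · refine key _ ?_
    simpa using (h.tangent _ h.nonempty.some_mem).smul_add 1 0
  · exact key _ (h.tangent v hv)

theorem isSingularVariety (h : IsMultibranchPoint N X x T) (hσ : Fintype.card σ = 4)
    (hX : IsProjCurve X) : IsSingularVariety X ∧ topologicalKrullDim X = 1 ∧ X.Infinite := by
  obtain ⟨hx, hxX⟩ := h.mem_coneOf
  obtain ⟨y, hy, hyx⟩ := h.exists_mem_ne hx
  have hdim := hX.topologicalKrullDim_eq hy hxX hyx
  refine ⟨⟨hX.isVariety, _, hxX, ?_⟩, hdim, hX.infinite hy hxX hyx⟩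
  rw [hdim, h.affineTangentSpace_eq_top hx, finrank_top, Module.finrank_fintype_fun_eq_card, hσ]
  norm_cast

variable [DecidableEq σ]

omit [DecidableEq σ] in
theorem indep_of_notMem (h : IsMultibranchPoint N X x T) {v : σ → ℂ}
    (hv : ∀ τ ∈ T, ∀ τ' ∈ T, v ∉ Submodule.span ℂ {x, τ, τ'}) : Indep x v := by
  by_contra hcon
  obtain ⟨c, rfl⟩ := (not_indep_iff h.ne_zero).mp fun h => hcon h.symm
  obtain ⟨τ, hτ⟩ := h.nonempty
  exact hv τ hτ τ hτ (Submodule.smul_mem _ _ (Submodule.subset_span (by simp)))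

theorem not_isSecantVec (h : IsMultibranchPoint N X x T) {v : σ → ℂ}
    (hv : ∀ τ ∈ T, ∀ τ' ∈ T, v ∉ Submodule.span ℂ {x, τ, τ'}) {m d : ℕ} (hd : 2 * m + 3 ≤ d)
    {y : Fin m → σ → ℂ} (hxy : ∀ j, Indep x (y j)) (hy : ∀ j j', j ≠ j' → Indep (y j) (y j')) :
    ¬ IsSecantVec (m + 2) d X (verDeriv d x v + ∑ j, ver d (y j)) := by
  intro hs
  obtain ⟨τ, hτ, τ', hτ', hl⟩ := h.branches.exists_tangents h.indep h.indep_pair hd hs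
    (h.indep_of_notMem hv) hxy hy
  obtain ⟨l, hlv, hl0⟩ := exists_dotProduct_of_notMem (hv τ hτ τ' hτ')
  exact hlv (hl l (hl0 _ (Submodule.subset_span (by simp)))
    (hl0 _ (Submodule.subset_span (by simp))) (hl0 _ (Submodule.subset_span (by simp))))

theorem isSecantVec_of_mem_span (h : IsMultibranchPoint N X x T) {v τ τ' : σ → ℂ} (hτ : τ ∈ T)
    (hτ' : τ' ∈ T) (hv : v ∈ Submodule.span ℂ {x, τ, τ'}) {m : ℕ} (d : ℕ)
    {y : Fin m → σ → ℂ} (hy : ∀ j, y j ∈ coneOf X) :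
    IsSecantVec (m + 2) d X (verDeriv d x v + ∑ j, ver d (y j)) := by
  obtain ⟨a, b, c, rfl⟩ := Submodule.mem_span_triple.mp hv
  -- Write `a x + b τ + c τ'` as the difference of the velocities `a x + b τ` and `-c τ'`.
  have h1 := isSecantVec_of_isArcTangent (d := d) ((h.tangent τ hτ).smul_add a b)
    ((h.tangent τ' hτ').smul_add 0 (-c)) hy
  rwa [zero_smul, zero_add, neg_smul, sub_neg_eq_add] at h1

/-- The derivative is linear in `v`, and `x` and `T` span everything: `x` contributes a multiple of
`x ^ d`, each tangent a limit of difference quotients. -/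
theorem verDeriv_mem_span_ver (h : IsMultibranchPoint N X x T) (d : ℕ) (v : σ → ℂ) :
    verDeriv d x v ∈ Submodule.span ℂ (ver d '' coneOf X) := by
  have hv : v ∈ Submodule.span ℂ (insert x T) := h.span_eq_top ▸ Submodule.mem_top
  induction hv using Submodule.span_induction with
  | mem v hv =>
    rcases Set.mem_insert_iff.mp hv with rfl | hv
    · rw [verDeriv_self]
      exact Submodule.smul_mem _ _ (Submodule.subset_span ⟨_, h.mem_coneOf, rfl⟩)
    · exact verDeriv_mem_span d (h.tangent v hv)
  | zero =>
    rw [← zero_smul ℂ x, verDeriv_smul, zero_smul]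
    exact Submodule.zero_mem _
  | add v w _ _ hv hw =>
    rw [verDeriv_add]
    exact Submodule.add_mem _ hv hw
  | smul c v _ hv =>
    rw [verDeriv_smul]
    exact Submodule.smul_mem _ _ hv

omit [Fintype σ] [DecidableEq σ] in
theorem mk_mem_linearSpan {d : ℕ} {X : Set (PSpace σ)} {z : Sym σ d → ℂ} (hz : z ≠ 0)
    (h : z ∈ Submodule.span ℂ (ver d '' coneOf X)) :
    Projectivization.mk ℂ z hz ∈ linearSpan (veronese d '' X) := by
  refine (mk_mem_span_iff hz).mpr (Submodule.span_le.mpr ?_ h)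
  rintro _ ⟨v, ⟨hv, hvX⟩, rfl⟩
  obtain ⟨a, ha⟩ := Projectivization.exists_smul_eq_mk_rep ℂ _ (veroneseVec_ne_zero d hv)
  have h1 : ver d v = (a⁻¹ : ℂˣ) • (a • veroneseVec d v) := by
    rw [inv_smul_smul]; rfl
  rw [h1, ha, Units.smul_def]
  exact Submodule.smul_mem _ _ (Submodule.subset_span ⟨_, ⟨_, hvX, rfl⟩, rfl⟩)

omit [Fintype σ] [DecidableEq σ] in
theorem isSecantVec_zero {r d : ℕ} {X : Set (PSpace σ)} (hX : (coneOf X).Nonempty) :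
    IsSecantVec r d X 0 := by
  intro F m hF hv
  obtain ⟨x, hx⟩ := hX
  simpa using hv (fun _ => x) (fun _ => hx) 0

omit [Fintype σ] [DecidableEq σ] in
theorem eval_eq_zero_of_secantVariety {r d : ℕ} (hr : 1 ≤ r) {X : Set (PSpace σ)}
    (hX : X.Nonempty) {F : MvPolynomial (Sym σ d) ℂ} {m : ℕ} (hF : F.IsHomogeneous m)
    (h : ∀ p ∈ secantVariety r (veronese d '' X), VanishesAt F p) {z : Sym σ d → ℂ}
    (hz : IsSecantVec r d X z) : eval z F = 0 := by
  by_cases hz0 : z = 0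
  · obtain ⟨y, hy⟩ := hX
    have hne : ver d y.rep ≠ 0 := veroneseVec_ne_zero d y.rep_nonzero
    have h1 : eval (ver d y.rep) F = 0 := by
      rw [← vanishesAt_mk hF hne]
      refine h _ (subset_closure ⟨fun _ => Projectivization.mk ℂ _ hne, fun _ => ?_, ?_⟩)
      · exact ⟨Projectivization.mk ℂ _ y.rep_nonzero, by rwa [y.mk_rep], rfl⟩
      · exact Projectivization.Subspace.subset_span _ ⟨⟨0, hr⟩, rfl⟩
    have h2 := eval_smul_of_isHomogeneous hF 0 (ver d y.rep)
    rw [h1, zero_smul, mul_zero] at h2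
    rw [hz0, h2]
  · rw [← vanishesAt_mk hF hz0]
    exact h _ ((mk_mem_secantVariety_iff hr hX hz0).mpr hz)

/-- The separating point: it lies on the secant variety of the Veronese variety and on the linear
span, but not on the secant variety of `v_d(X)`. -/
theorem exists_separating (h : IsMultibranchPoint N X x T) (hinf : X.Infinite) {v : σ → ℂ}
    (hv : ∀ τ ∈ T, ∀ τ' ∈ T, v ∉ Submodule.span ℂ {x, τ, τ'}) {m d : ℕ} (hd : 2 * m + 3 ≤ d)
    {y : Fin m → σ → ℂ} (hyX : ∀ j, y j ∈ coneOf X) (hxy : ∀ j, Indep x (y j))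
    (hy : ∀ j j', j ≠ j' → Indep (y j) (y j')) :
    ∃ hP : verDeriv d x v + ∑ j, ver d (y j) ≠ 0,
      Projectivization.mk ℂ _ hP ∉ secantVariety (m + 2) (veronese d '' X) ∧
      Projectivization.mk ℂ _ hP ∈ secantVariety (m + 2) (Set.range (veronese (σ := σ) d)) ∧
      Projectivization.mk ℂ _ hP ∈ linearSpan (veronese d '' X) := by
  have hns := h.not_isSecantVec hv hd hxy hy
  have hP : verDeriv d x v + ∑ j, ver d (y j) ≠ 0 := by
    intro h0
    rw [h0] at hns
    exact hns (isSecantVec_zero ⟨x, h.mem_coneOf⟩)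
  refine ⟨hP, ?_, ?_, ?_⟩
  · rwa [mk_mem_secantVariety_iff (by omega) hinf.nonempty]
  · rw [← Set.image_univ, mk_mem_secantVariety_iff (by omega)
      (hinf.nonempty.mono (Set.subset_univ _))]
    have h1 := isSecantVec_of_isArcTangent (d := d) (isArcTangent_univ h.ne_zero v)
      (isArcTangent_univ h.ne_zero 0) (y := y) (fun j => ⟨(hyX j).choose, trivial⟩)
    rwa [sub_zero] at h1
  · exact mk_mem_linearSpan hP (Submodule.add_mem _ (h.verDeriv_mem_span_ver d v)
      (Submodule.sum_mem _ fun j _ => Submodule.subset_span ⟨_, hyX j, rfl⟩))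

theorem secantVariety_ne (h : IsMultibranchPoint N X x T) (hσ : Fintype.card σ = 4)
    (hinf : X.Infinite) {r d : ℕ} (hr : 2 ≤ r) (hd : 2 * r - 1 ≤ d) :
    secantVariety r (veronese d '' X) ≠
      secantVariety r (Set.range (veronese (σ := σ) d)) ∩ linearSpan (veronese d '' X) := by
  obtain ⟨m, rfl⟩ : ∃ m, r = m + 2 := ⟨r - 2, by omega⟩
  obtain ⟨v, hv⟩ := h.exists_generic hσ
  obtain ⟨y, hyX, hxy, hy⟩ := exists_indep_points hinf h.ne_zero m
  obtain ⟨hP, h1, h2, h3⟩ := h.exists_separating hinf hv (d := d) (by omega) hyX hxy hy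
  exact fun heq => h1 (heq ▸ ⟨h2, h3⟩)

-- On the line `v + s w` there are `N` points at which the corresponding vector is on the secant
-- variety, and the point `s = 0` at which it is not. An equation of degree less than `N` restricts
-- to a polynomial in `s` with `N` roots, which cannot separate them.
open Polynomial in
theorem not_isCutOutInDegreeLE (h : IsMultibranchPoint N X x T) (hσ : Fintype.card σ = 4)
    (hinf : X.Infinite) {r d q : ℕ} (hr : 2 ≤ r) (hd : 2 * r - 1 ≤ d) (hq : q < N) :
    ¬ IsCutOutInDegreeLE q (secantVariety r (veronese d '' X)) := by
  obtain ⟨m, rfl⟩ : ∃ m, r = m + 2 := ⟨r - 2, by omega⟩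
  obtain ⟨v, hv⟩ := h.exists_generic hσ
  obtain ⟨y, hyX, hxy, hy⟩ := exists_indep_points hinf h.ne_zero m
  obtain ⟨hP, h1, -, -⟩ := h.exists_separating hinf hv (d := d) (by omega) hyX hxy hy
  rintro ⟨E, hE, heq⟩
  obtain ⟨l, hl, hll⟩ := h.planes
  have hlv : ∀ a, l a ⬝ᵥ v ≠ 0 := by
    intro a ha
    obtain ⟨τ, hτ, τ', hτ', hmem⟩ := hl a v ha
    exact hv τ hτ τ' hτ' hmem
  -- a line through `v` meeting the hyperplanes in different points
  let f : Fin N ⊕ {p : Fin N × Fin N // p.1 ≠ p.2} → σ → ℂ :=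
    Sum.elim l fun p => (l p.1.1 ⬝ᵥ v) • l p.1.2 - (l p.1.2 ⬝ᵥ v) • l p.1.1
  have hf : ∀ i, ∃ z, f i ⬝ᵥ z ≠ 0 := by
    rintro (a | ⟨⟨a, b⟩, hab⟩)
    · exact ⟨v, hlv a⟩
    · obtain ⟨z, hz, hz'⟩ := hll a b hab
      refine ⟨z, ?_⟩
      simp only [f, Sum.elim_inr, sub_dotProduct, smul_dotProduct, hz, smul_zero, sub_zero]
      exact mul_ne_zero (hlv a) hz'
  obtain ⟨w, hw⟩ := exists_notMem_of_ne_top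
    (fun i => LinearMap.ker (Fintype.linearCombination ℂ (f i))) (by
      intro i htop
      obtain ⟨z, hz⟩ := hf i
      have h2 : z ∈ LinearMap.ker (Fintype.linearCombination ℂ (f i)) := htop ▸ Submodule.mem_top
      rw [LinearMap.mem_ker, Fintype.linearCombination_apply] at h2
      exact hz (by rw [dotProduct_comm]; exact h2))
  have hw' : ∀ i, f i ⬝ᵥ w ≠ 0 := by
    intro i h0
    refine hw i ?_
    rw [LinearMap.mem_ker, Fintype.linearCombination_apply]
    rw [dotProduct_comm] at h0
    exact h0
  have hlw : ∀ a, l a ⬝ᵥ w ≠ 0 := fun a => hw' (Sum.inl a)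
  -- The parameter at which the line meets the plane `l a`. That `w` is not killed by the second
  -- kind of forms in `f` makes these parameters distinct.
  let s : Fin N → ℂ := fun a => -(l a ⬝ᵥ v) / (l a ⬝ᵥ w)
  have hs : Function.Injective s := by
    intro a b hab
    by_contra hne
    refine hw' (Sum.inr ⟨(a, b), hne⟩) ?_
    simp only [f, Sum.elim_inr, sub_dotProduct, smul_dotProduct, smul_eq_mul]
    simp only [s] at hab
    rw [div_eq_div_iff (hlw a) (hlw b)] at hab
    linear_combination -hab
  have hsec : ∀ a, IsSecantVec (m + 2) d X
      (verDeriv d x (v + s a • w) + ∑ j, ver d (y j)) := by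
    intro a
    obtain ⟨τ, hτ, τ', hτ', hmem⟩ := hl a (v + s a • w) (by
      rw [dotProduct_add, dotProduct_smul, smul_eq_mul, div_mul_cancel₀ _ (hlw a)]
      ring)
    exact h.isSecantVec_of_mem_span hτ hτ' hmem d hyX
  apply h1
  rw [heq]
  intro F hF
  obtain ⟨k, hk, hFk⟩ := hE F hF
  rw [vanishesAt_mk hFk]
  set p : Sym σ d → ℂ[X] := fun t =>
    Polynomial.C ((verDeriv d x v + ∑ j, ver d (y j)) t) +
      Polynomial.X * Polynomial.C (verDeriv d x w t) with hp
  have heval : ∀ c : ℂ, (MvPolynomial.aeval p F).eval c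
      = MvPolynomial.eval (verDeriv d x (v + c • w) + ∑ j, ver d (y j)) F := by
    intro c
    rw [← Polynomial.coe_evalRingHom, MvPolynomial.aeval_def, MvPolynomial.hom_eval₂]
    have h2 : (Polynomial.evalRingHom c).comp (algebraMap ℂ ℂ[X]) = RingHom.id ℂ := by
      ext
      simp
    rw [h2, MvPolynomial.eval₂_id]
    congr 1
    congr 1
    funext t
    simp only [hp, verDeriv_add, verDeriv_smul, Polynomial.coe_evalRingHom,
      Polynomial.eval_add, Polynomial.eval_mul, Polynomial.eval_C, Polynomial.eval_X, Pi.add_apply,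
      Pi.smul_apply, smul_eq_mul]
    ring
  have h0 : MvPolynomial.aeval p F = 0 := by
    refine Polynomial.eq_zero_of_natDegree_lt_card_of_eval_eq_zero _ hs (fun a => ?_) ?_
    · rw [heval]
      refine eval_eq_zero_of_secantVariety (by omega) hinf.nonempty hFk (fun z hz => ?_) (hsec a)
      rw [heq] at hz
      exact hz F hF
    · have h3 := MvPolynomial.aeval_natDegree_le (n := 1) F (hFk.totalDegree_le.trans hk) p (by
        intro t
        generalize ha : (verDeriv d x v + ∑ j, ver d (y j)) t = a
        simp only [hp, ha]
        compute_degree)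
      rw [Fintype.card_fin]
      omega
  have h4 := heval 0
  rw [h0, Polynomial.eval_zero, zero_smul, add_zero] at h4
  exact h4.symm

-- By the Leibniz rule the catalecticant at this vector is a sum of two matrices of rank one.
omit [Fintype σ] [DecidableEq σ] in
theorem eval_catalecticant_det (x v : σ → ℂ) (a b : ℕ) (f : Fin 3 → Sym σ a) (g : Fin 3 → Sym σ b) :
    eval (verDeriv (a + b) x v) ((catalecticant σ a b).submatrix f g).det = 0 := by
  have h1 : ∀ i j, eval (verDeriv (a + b) x v) ((catalecticant σ a b).submatrix f g i j)
      = verDeriv a x v (f i) * ver b x (g j) + ver a x (f i) * verDeriv b x v (g j) := by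
    intro i j
    simp only [catalecticant, Matrix.submatrix_apply, Matrix.of_apply, eval_X, verDeriv, ver,
      Sym.coe_append, multisetDeriv_add]
  rw [Matrix.det_fin_three]
  simp only [map_sub, map_add, map_mul, h1]
  ring

theorem not_eksHolds (h : IsMultibranchPoint N X x T) (hσ : Fintype.card σ = 4)
    (hinf : X.Infinite) : ¬ EKSHolds X := by
  rintro ⟨r₀, hr₀, heks⟩
  obtain ⟨v, hv⟩ := h.exists_generic hσ
  -- One pair `(a, b)` with `2 ≤ r₀ (a, b)` suffices; `3 ≤ a` ensures `a + b ≥ 2 * 2 - 1`.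
  have hev : ∀ᶠ p in (Filter.atTop ×ˢ Filter.atTop : Filter (ℕ × ℕ)), 2 ≤ r₀ p ∧ 3 ≤ p.1 :=
    (hr₀.eventually (Filter.eventually_ge_atTop 2)).and
      ((Filter.eventually_ge_atTop 3).prod_inl _)
  obtain ⟨⟨a, b⟩, h2, h3⟩ := hev.exists
  have heq := heks a b 2 (by omega) h2
  obtain ⟨hP, h4, -, h5⟩ := h.exists_separating hinf hv (m := 0) (d := a + b)
    (by simp only at h3; omega) (y := Fin.elim0) (fun j => j.elim0) (fun j => j.elim0)
    (fun j => j.elim0)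
  apply h4
  rw [secantVariety, mem_closure_iff_vanishesAt]
  intro F k hF hFs
  have hmem : F ∈ rankIdeal 2 a b X := by
    rw [← heq]
    refine Ideal.subset_span ⟨k, hF, fun z hz => ?_⟩
    exact (mem_closure_iff_vanishesAt.mp hz) F k hF hFs
  rw [vanishesAt_mk hF]
  have hle : rankIdeal 2 a b X ≤ RingHom.ker
      (eval (verDeriv (a + b) x v + ∑ j : Fin 0, ver (a + b) (Fin.elim0 j))) := by
    rw [rankIdeal, Ideal.span_le]
    rintro G (⟨f, g, rfl⟩ | ⟨hG, hGX⟩)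
    · rw [SetLike.mem_coe, RingHom.mem_ker, Finset.univ_eq_empty, Finset.sum_empty, add_zero]
      exact eval_catalecticant_det x v a b f g
    · rw [SetLike.mem_coe, RingHom.mem_ker, ← vanishesAt_mk hG hP]
      have h6 : verDeriv (a + b) x v + ∑ j : Fin 0, ver (a + b) (Fin.elim0 j)
          ∈ Submodule.span ℂ (ver (a + b) '' coneOf X) := by
        rw [Finset.univ_eq_empty, Finset.sum_empty, add_zero]
        exact h.verDeriv_mem_span_ver _ v
      rw [vanishesAt_mk hG hP]
      refine eval_eq_zero_of_mem_span hG ?_ h6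
      rintro _ ⟨u, ⟨hu, huX⟩, rfl⟩
      have hu' : ver (a + b) u ≠ 0 := veroneseVec_ne_zero _ hu
      exact (vanishesAt_mk hG hu').mp (hGX _ ⟨_, huX, rfl⟩)
  exact hle hmem

end IsMultibranchPoint

end Multibranch

end SecantVeronese

/-! ### A family of complete intersection curves: local structure at a singular point -/

namespace SecantVeronese

open MvPolynomial hiding zeroLocus
open Topology

/-- A root in an extension field of a nonzero complex polynomial is a complex number. -/
theorem exists_root_of_eval₂_eq_zero {k : Type*} [Field k] (ρ : ℂ →+* k) {p : Polynomial ℂ}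
    (hp : p ≠ 0) {c : k} (hc : p.eval₂ ρ c = 0) : ∃ z : ℂ, p.eval z = 0 ∧ c = ρ z := by
  have h1 : c ∈ (p.map ρ).roots := by
    rw [Polynomial.mem_roots (by rwa [Ne, Polynomial.map_eq_zero]), Polynomial.IsRoot.def,
      Polynomial.eval_map, hc]
  rw [(IsAlgClosed.splits p).roots_map, Multiset.mem_map] at h1
  obtain ⟨z, hz, rfl⟩ := h1
  exact ⟨z, (Polynomial.mem_roots hp).mp hz, rfl⟩

/-! ### The local equation `a ^ n * (1 + a) = e ^ n` over a valuation ring -/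

section Branch

variable {W : Type} (P : Place W)

/-- If `a` divides `e`, say `e = a s`, then `s ^ n = 1 + a` is a unit, so `s` is a unit and `e`
divides `a` as well. For `e = 0` also `a = 0`, and `b = 1` satisfies the equation. -/
theorem exists_branch_param {n : ℕ} (hn : n ≠ 0) {a e : P.O} (ha : P.π a = 0)
    (h : a ^ n * (1 + a) = e ^ n) : ∃ b, a = e * b ∧ b ^ n * (1 + e * b) = 1 := by
  have hu : IsUnit (1 + a) := by
    rw [← IsLocalRing.residue_ne_zero_iff_isUnit]
    simp [ha]
  by_cases he : e = 0
  · subst he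
    rw [zero_pow hn, mul_eq_zero, pow_eq_zero_iff hn] at h
    exact ⟨1, by simpa using h.resolve_right hu.ne_zero, by simp⟩
  have key : ∀ b, a = e * b → b ^ n * (1 + e * b) = 1 := by
    intro b hb
    rw [hb, mul_pow, mul_assoc] at h
    exact mul_left_cancel₀ (pow_ne_zero n he) (by rw [h, mul_one])
  suffices h1 : e ∣ a by
    obtain ⟨b, hb⟩ := h1
    exact ⟨b, hb, key b hb⟩
  rcases ValuationRing.dvd_total e a with h1 | ⟨s, rfl⟩
  · exact h1
  · have ha0 : a ≠ 0 := by
      rintro rfl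
      simp at he
    have hs : s ^ n = 1 + a := by
      rw [mul_pow] at h
      exact (mul_left_cancel₀ (pow_ne_zero n ha0) h).symm
    have hsu : IsUnit s := (isUnit_pow_iff hn).mp (hs ▸ hu)
    obtain ⟨r, hr⟩ := hsu.exists_right_inv
    exact ⟨r, by rw [mul_assoc, hr, mul_one]⟩

theorem exists_root_of_branch {n : ℕ} (hn : n ≠ 0) {b e : P.O} (he : P.π e = 0)
    (h : b ^ n * (1 + e * b) = 1) : ∃ ζ : ℂ, ζ ^ n = 1 ∧ P.π b = P.ρ ζ := by
  have h1 : P.π b ^ n = 1 := by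
    have := congrArg P.π h
    simpa [he] using this
  obtain ⟨z, hz, hbz⟩ := exists_root_of_eval₂_eq_zero P.ρ
    (p := Polynomial.X ^ n - 1) (Polynomial.X_pow_sub_C_ne_zero (Nat.pos_of_ne_zero hn) 1)
    (c := P.π b) (by simp [h1])
  exact ⟨z, by simpa [sub_eq_zero] using hz, hbz⟩

/-- Subtracting the two equations gives `(S + e S') (b - b') = -(e - e') b' ^ (n + 1)`. The first
factor is a unit because it reduces to `n ζ ^ (n - 1)`. This is Hensel uniqueness in a form that
compares different parameters. -/
theorem exists_branch_diff {n : ℕ} (hn : n ≠ 0) {b b' e e' : P.O} (he : P.π e = 0)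
    (h : b ^ n * (1 + e * b) = 1) (h' : b' ^ n * (1 + e' * b') = 1) {ζ : ℂ} (hζ : ζ ^ n = 1)
    (hb : P.π b = P.ρ ζ) (hb' : P.π b' = P.ρ ζ) : ∃ w, b - b' = (e - e') * w := by
  set S := ∑ i ∈ Finset.range n, b ^ i * b' ^ (n - 1 - i)
  set S' := ∑ i ∈ Finset.range (n + 1), b ^ i * b' ^ (n - i)
  have h1 : S * (b - b') = b ^ n - b' ^ n := geom_sum₂_mul b b' n
  have h2 : S' * (b - b') = b ^ (n + 1) - b' ^ (n + 1) := geom_sum₂_mul b b' (n + 1)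
  have hζ0 : ζ ≠ 0 := by
    rintro rfl
    rw [zero_pow hn] at hζ
    exact zero_ne_one hζ
  have hu : IsUnit (S + e * S') := by
    rw [← IsLocalRing.residue_ne_zero_iff_isUnit]
    have h3 : P.π (S + e * S') = P.ρ (n * ζ ^ (n - 1)) := by
      rw [map_add, map_mul, he, zero_mul, add_zero, map_sum]
      simp only [map_mul, map_pow, hb, hb', ← pow_add, map_natCast]
      rw [Finset.sum_congr rfl (g := fun _ => P.ρ ζ ^ (n - 1)) (by
        intro i hi
        congr 1
        have := Finset.mem_range.mp hi
        omega)]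
      simp
    rw [h3]
    exact (map_ne_zero P.ρ).mpr (mul_ne_zero (Nat.cast_ne_zero.mpr hn) (pow_ne_zero _ hζ0))
  obtain ⟨u, hu⟩ := hu.exists_right_inv
  refine ⟨-u * b' ^ (n + 1), ?_⟩
  linear_combination (-(b - b')) * hu + u * h1 + u * e * h2 + u * (h - h')

end Branch

/-- There is an arc on the plane curve `a ^ n (1 + a) = ε ^ n` tangent to `a = ζ ε`. -/
theorem exists_branch_arc {n : ℕ} (hn : n ≠ 0) {ζ : ℂ} (hζ : ζ ^ n = 1) :
    ∃ a : ℂ → ℂ, a 0 = 0 ∧ (∀ᶠ ε in 𝓝 0, a ε ^ n * (1 + a ε) = ε ^ n) ∧ HasDerivAt a ζ 0 := by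
  have hζ0 : ζ ≠ 0 := by
    rintro rfl
    rw [zero_pow hn] at hζ
    exact zero_ne_one hζ
  -- An `n`-th root of `a ^ n (1 + a)` that is analytic near zero with derivative `ζ⁻¹`; the arc is
  -- its local inverse.
  set f : ℂ → ℂ := fun a => ζ⁻¹ * (a * (1 + a) ^ (n⁻¹ : ℂ)) with hf
  have hd : HasStrictDerivAt f ζ⁻¹ 0 := by
    have h1 : HasStrictDerivAt (fun a : ℂ => 1 + a) 1 0 := (hasStrictDerivAt_id 0).const_add 1
    have h2 := h1.cpow_const (c := (n⁻¹ : ℂ)) (by simp [Complex.slitPlane])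
    have h3 := ((hasStrictDerivAt_id (0 : ℂ)).mul h2).const_mul ζ⁻¹
    refine h3.congr_deriv ?_
    simp
  have hζ1 : ζ⁻¹ ≠ 0 := inv_ne_zero hζ0
  have hf0 : f 0 = 0 := by simp [hf]
  have hpow : ∀ a, f a ^ n = a ^ n * (1 + a) := by
    intro a
    simp only [hf, mul_pow, inv_pow, hζ, inv_one, one_mul]
    rw [Complex.cpow_nat_inv_pow _ hn]
  refine ⟨hd.localInverse f ζ⁻¹ 0 hζ1, ?_, ?_, ?_⟩
  · have := (hd.eventually_left_inverse hζ1).self_of_nhds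
    rwa [hf0] at this
  · have := hd.eventually_right_inverse hζ1
    rw [hf0] at this
    filter_upwards [this] with ε hε
    rw [← hpow, hε]
  · have := (hd.to_localInverse hζ1).hasDerivAt
    rwa [hf0, inv_inv] at this

/-- The form `x₀ (x_i ^ n - x₃ ^ n) + x_i ^ (n + 1)`. -/
noncomputable def branchForm (n : ℕ) (i : Fin 4) : MvPolynomial (Fin 4) ℂ :=
  X 0 * (X i ^ n - X 3 ^ n) + X i ^ (n + 1)

theorem branchForm_isHomogeneous (n : ℕ) (i : Fin 4) : (branchForm n i).IsHomogeneous (n + 1) := by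
  refine IsHomogeneous.add ?_ (by simpa using (isHomogeneous_X ℂ i).pow (n + 1))
  rw [add_comm n 1]
  refine (isHomogeneous_X ℂ 0).mul (IsHomogeneous.sub ?_ ?_)
  · simpa using (isHomogeneous_X ℂ i).pow n
  · simpa using (isHomogeneous_X ℂ (3 : Fin 4)).pow n

theorem eval_branchForm (n : ℕ) (i : Fin 4) (z : Fin 4 → ℂ) :
    eval z (branchForm n i) = z 0 * (z i ^ n - z 3 ^ n) + z i ^ (n + 1) := by
  simp [branchForm]

/-- The complete intersection curve defined by two forms `branchForm`. -/
def branchCurve (n n' : ℕ) : Set (PSpace (Fin 4)) := zeroLocus {branchForm n 1, branchForm n' 2}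

theorem mem_coneOf_branchCurve {n n' : ℕ} {z : Fin 4 → ℂ} : z ∈ coneOf (branchCurve n n') ↔
    z ≠ 0 ∧ z 0 * (z 1 ^ n - z 3 ^ n) + z 1 ^ (n + 1) = 0 ∧
      z 0 * (z 2 ^ n' - z 3 ^ n') + z 2 ^ (n' + 1) = 0 := by
  constructor
  · rintro ⟨h, hX⟩
    refine ⟨h, ?_, ?_⟩
    · rw [← eval_branchForm, ← vanishesAt_mk (branchForm_isHomogeneous n 1) h]
      exact hX _ (by simp)
    · rw [← eval_branchForm, ← vanishesAt_mk (branchForm_isHomogeneous n' 2) h]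
      exact hX _ (by simp)
  · rintro ⟨h, h1, h2⟩
    refine ⟨h, ?_⟩
    rintro F (rfl | rfl)
    · rwa [vanishesAt_mk (branchForm_isHomogeneous n 1) h, eval_branchForm]
    · rwa [vanishesAt_mk (branchForm_isHomogeneous n' 2) h, eval_branchForm]

/-- The singular point of `branchCurve`. -/
def branchPoint : Fin 4 → ℂ := ![1, 0, 0, 0]

/-- The tangent vectors of `branchCurve` at `branchPoint`. -/
def branchTangents (n n' : ℕ) : Set (Fin 4 → ℂ) :=
  {τ | ∃ ζ ξ : ℂ, ζ ^ n = 1 ∧ ξ ^ n' = 1 ∧ τ = ![0, ζ, ξ, 1]}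

theorem isArcTangent_branchCurve {n n' : ℕ} (hn : n ≠ 0) (hn' : n' ≠ 0) {τ : Fin 4 → ℂ}
    (hτ : τ ∈ branchTangents n n') : IsArcTangent (branchCurve n n') branchPoint τ := by
  obtain ⟨ζ, ξ, hζ, hξ, rfl⟩ := hτ
  obtain ⟨a, ha0, ha, had⟩ := exists_branch_arc hn hζ
  obtain ⟨b, hb0, hb, hbd⟩ := exists_branch_arc hn' hξ
  refine ⟨fun ε => ![1, a ε, b ε, ε], by simp [ha0, hb0, branchPoint], ?_, ?_⟩
  · filter_upwards [ha, hb] with ε h1 h2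
    refine mem_coneOf_branchCurve.mpr ⟨fun h => ?_, ?_, ?_⟩
    · simpa using congrFun h 0
    · simp only [Matrix.cons_val]
      linear_combination h1
    · simp only [Matrix.cons_val]
      linear_combination h2
  · refine hasDerivAt_pi.mpr fun i => ?_
    fin_cases i
    · exact hasDerivAt_const _ _
    · exact had
    · exact hbd
    · exact hasDerivAt_id _

/-- A point near `branchPoint` has first coordinate normalized to `1`, and its last coordinate
serves as the parameter `ε` of the branch; the other two coordinates are `ε b` and `ε b'` with `b`,
`b'` reducing to roots of unity. -/
theorem smoothBranches_branchCurve {n n' : ℕ} (hn : n ≠ 0) (hn' : n' ≠ 0) :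
    SmoothBranches (branchCurve n n') branchPoint (branchTangents n n') := by
  have single : ∀ (W : Type) (P : Place W) (A : W → Fin 4 → ℂ) (a : Fin 4 → P.O),
      (∀ w, A w ∈ coneOf (branchCurve n n')) → P.IsNormalForm A a →
      ¬ Indep (P.π ∘ a) (P.ρ ∘ branchPoint) → ∃ (ζ ξ : ℂ) (b b' : P.O),
        ζ ^ n = 1 ∧ ξ ^ n' = 1 ∧ P.π b = P.ρ ζ ∧ P.π b' = P.ρ ξ ∧ P.π (a 3) = 0 ∧
        b ^ n * (1 + a 3 * b) = 1 ∧ b' ^ n' * (1 + a 3 * b') = 1 ∧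
        a 0 = 1 ∧ a 1 = a 3 * b ∧ a 2 = a 3 * b' := by
    rintro W P A a hA ⟨⟨m, hm⟩, c, hc, ha⟩ hind
    have hres : ∀ i, i ≠ 0 → P.π (a i) = 0 := by
      intro i hi
      by_contra h
      refine hind ⟨i, 0, ?_⟩
      have h0 : branchPoint i = 0 := by fin_cases i <;> simp [branchPoint] at hi ⊢
      simp only [Function.comp_apply, h0, map_zero, mul_zero, sub_zero]
      simpa [branchPoint] using h
    have hm0 : m = 0 := by
      by_contra h
      have := hres m h
      rw [hm, map_one] at this
      exact one_ne_zero this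
    subst hm0
    have heq : ∀ (k : ℕ) (i : Fin 4), (∀ w, A w 0 * (A w i ^ k - A w 3 ^ k) + A w i ^ (k + 1) = 0) →
        a i ^ k * (1 + a i) = a 3 ^ k := by
      intro k i h
      have h1 : (fun w => A w 0) * ((fun w => A w i) ^ k - (fun w => A w 3) ^ k)
          + (fun w => A w i) ^ (k + 1) = 0 := funext h
      have h2 := congrArg P.ψ h1
      simp only [map_add, map_mul, map_sub, map_pow, map_zero] at h2
      have h3 : a 0 * (a i ^ k - a 3 ^ k) + a i ^ (k + 1) = 0 := by
        apply Subtype.val_injective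
        push_cast
        simp only [ha]
        linear_combination c ^ (k + 1) * h2
      rw [hm] at h3
      linear_combination h3
    obtain ⟨b, hb, hb1⟩ := exists_branch_param P hn (hres 1 (by simp))
      (heq n 1 fun w => (mem_coneOf_branchCurve.mp (hA w)).2.1)
    obtain ⟨b', hb', hb1'⟩ := exists_branch_param P hn' (hres 2 (by simp))
      (heq n' 2 fun w => (mem_coneOf_branchCurve.mp (hA w)).2.2)
    have h3 := hres 3 (by simp)
    obtain ⟨ζ, hζ, hbζ⟩ := exists_root_of_branch P hn h3 hb1
    obtain ⟨ξ, hξ, hbξ⟩ := exists_root_of_branch P hn' h3 hb1'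
    exact ⟨ζ, ξ, b, b', hζ, hξ, hbζ, hbξ, h3, hb1, hb1', hm, hb, hb'⟩
  intro W P A A' a a' hA hA' hAa hAa' hax hax'
  obtain ⟨ζ, ξ, b₁, b₂, hζ, hξ, hb₁, hb₂, h3, h1, h2, ha0, ha1, ha2⟩ := single W P A a hA hAa hax
  obtain ⟨ζ', ξ', b₁', b₂', hζ', hξ', hb₁', hb₂', h3', h1', h2', ha0', ha1', ha2'⟩ :=
    single W P A' a' hA' hAa' hax'
  refine ⟨![0, ζ, ξ, 1], ⟨ζ, ξ, hζ, hξ, rfl⟩, ![0, ζ', ξ', 1], ⟨ζ', ξ', hζ', hξ', rfl⟩, 1, 1,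
    a 3, a' 3, ![0, b₁, b₂, 1], ![0, b₁', b₂', 1], ?_, ?_, h3, h3', ?_, ?_, ?_⟩
  · intro i
    fin_cases i <;> simp [branchPoint, ha0, ha1, ha2]
  · intro i
    fin_cases i <;> simp [branchPoint, ha0', ha1', ha2']
  · funext i
    fin_cases i <;> simp [hb₁, hb₂]
  · funext i
    fin_cases i <;> simp [hb₁', hb₂']
  · intro heq
    have e1 : ζ = ζ' := by simpa using congrFun heq 1
    have e2 : ξ = ξ' := by simpa using congrFun heq 2
    subst e1 e2
    obtain ⟨w₁, hw₁⟩ := exists_branch_diff P hn h3 h1 h1' hζ hb₁ hb₁'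
    obtain ⟨w₂, hw₂⟩ := exists_branch_diff P hn' h3 h2 h2' hξ hb₂ hb₂'
    -- From `b - b' = (ε - ε') w` follows `ε b - ε' b' = (ε - ε') (b + ε' w)`.
    refine ⟨![0, b₁ + a' 3 * w₁, b₂ + a' 3 * w₂, 1], ?_, ?_⟩
    · funext i
      fin_cases i <;> simp [hb₁, hb₂, h3']
    · intro i
      fin_cases i
      · simp
      · simp only [Fin.mk_one, Matrix.cons_val]
        linear_combination a' 3 * hw₁
      · simp only [Fin.reduceFinMk, Matrix.cons_val]
        linear_combination a' 3 * hw₂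
      · simp

theorem isMultibranchPoint_branchCurve {n : ℕ} (hn : 2 ≤ n) :
    IsMultibranchPoint n (branchCurve n 2) branchPoint (branchTangents n 2) where
  finite := by
    have h : ∀ k : ℕ, k ≠ 0 → {z : ℂ | z ^ k = 1}.Finite := by
      intro k hk
      refine (Polynomial.finite_setOfPred_isRoot
        (Polynomial.X_pow_sub_C_ne_zero (Nat.pos_of_ne_zero hk) (1 : ℂ))).subset fun z hz => ?_
      have hz : z ^ k = 1 := hz
      simp [Polynomial.IsRoot, hz]
    refine (((h n (by omega)).prod (h 2 (by simp))).image
      fun p => ![0, p.1, p.2, 1]).subset ?_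
    rintro _ ⟨ζ, ξ, hζ, hξ, rfl⟩
    exact ⟨(ζ, ξ), ⟨hζ, hξ⟩, rfl⟩
  nonempty := ⟨_, 1, 1, by simp, by simp, rfl⟩
  branches := smoothBranches_branchCurve (by omega) (by simp)
  tangent τ hτ := isArcTangent_branchCurve (by omega) (by simp) hτ
  indep := by
    rintro _ ⟨ζ, ξ, -, -, rfl⟩
    exact ⟨![0, 0, 0, 1], by simp [branchPoint, dotProduct, Fin.sum_univ_succ],
      by simp [dotProduct, Fin.sum_univ_succ]⟩
  indep_pair := by
    rintro _ ⟨ζ, ξ, -, -, rfl⟩ _ ⟨ζ', ξ', -, -, rfl⟩ hne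
    by_cases h : ζ = ζ'
    · refine ⟨![0, 0, 1, -ξ'], by simp [branchPoint, dotProduct, Fin.sum_univ_succ], ?_,
        by simp [dotProduct, Fin.sum_univ_succ]⟩
      have : ξ - ξ' ≠ 0 := sub_ne_zero.mpr (by rintro rfl; exact hne (by rw [h]))
      simpa [dotProduct, Fin.sum_univ_succ, ← sub_eq_add_neg] using this
    · refine ⟨![0, 1, 0, -ζ'], by simp [branchPoint, dotProduct, Fin.sum_univ_succ], ?_,
        by simp [dotProduct, Fin.sum_univ_succ]⟩
      simpa [dotProduct, Fin.sum_univ_succ, ← sub_eq_add_neg, sub_eq_zero] using h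
  span_eq_top := by
    have hprim := Complex.isPrimitiveRoot_exp n (by omega)
    set ζ := Complex.exp (2 * Real.pi * Complex.I / n)
    have hζ1 : 1 - ζ ≠ 0 := sub_ne_zero.mpr (hprim.ne_one (by omega)).symm
    rw [eq_top_iff]
    intro z _
    have h0 : branchPoint ∈ Submodule.span ℂ (insert branchPoint (branchTangents n 2)) :=
      Submodule.subset_span (Set.mem_insert _ _)
    have h1 : ∀ α β : ℂ, α ^ n = 1 → β ^ 2 = 1 → ![0, α, β, 1] ∈
        Submodule.span ℂ (insert branchPoint (branchTangents n 2)) := fun α β hα hβ =>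
      Submodule.subset_span (Set.mem_insert_of_mem _ ⟨α, β, hα, hβ, rfl⟩)
    have hz : z = z 0 • branchPoint + ((z 1 - z 3) / (1 - ζ)) • (![0, 1, 1, 1] - ![0, ζ, 1, 1])
        + ((z 2 - z 3) / 2) • (![0, 1, 1, 1] - ![0, 1, -1, 1]) + z 3 • ![0, 1, 1, 1] := by
      funext i
      fin_cases i
      · simp [branchPoint]
      · simp [branchPoint]
        field_simp
        ring
      · simp [branchPoint]
        ring
      · simp [branchPoint]
    rw [hz]
    have h11 := h1 1 1 (by simp) (by simp)
    exact Submodule.add_mem _ (Submodule.add_mem _ (Submodule.add_mem _ (Submodule.smul_mem _ _ h0)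
      (Submodule.smul_mem _ _ (Submodule.sub_mem _ h11 (h1 ζ 1 hprim.pow_eq_one (by simp)))))
      (Submodule.smul_mem _ _ (Submodule.sub_mem _ h11 (h1 1 (-1) (by simp) (by simp)))))
      (Submodule.smul_mem _ _ h11)
  planes := by
    have hprim := Complex.isPrimitiveRoot_exp n (by omega)
    set ζ := Complex.exp (2 * Real.pi * Complex.I / n)
    have hζ : ∀ a : ℕ, (ζ ^ a) ^ n = 1 := fun a => by
      rw [← pow_mul, mul_comm, pow_mul, hprim.pow_eq_one, one_pow]
    -- The plane through `branchPoint` and the two tangents `(0, ζ ^ a, 1, 1)` and `(0, 1, -1, 1)`.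
    -- Different powers of the primitive root `ζ` give `n` different planes.
    refine ⟨fun a => ![0, 2, 1 - ζ ^ (a : ℕ), -1 - ζ ^ (a : ℕ)], ?_, ?_⟩
    · intro a z hz
      refine ⟨![0, ζ ^ (a : ℕ), 1, 1], ⟨_, _, hζ a, by simp, rfl⟩, ![0, 1, -1, 1],
        ⟨_, _, by simp, by simp, rfl⟩, ?_⟩
      rw [Submodule.mem_span_triple]
      refine ⟨z 0, (z 2 + z 3) / 2, (z 3 - z 2) / 2, ?_⟩
      simp only [dotProduct, Fin.sum_univ_succ, Fin.sum_univ_zero] at hz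
      simp at hz
      funext i
      fin_cases i
      · simp [branchPoint]
      · simp [branchPoint]
        linear_combination (-1 / 2 : ℂ) * hz
      · simp [branchPoint]
        ring
      · simp [branchPoint]
        ring
    · intro a b hab
      refine ⟨![0, ζ ^ (a : ℕ), 1, 1], ?_, ?_⟩
      · simp [dotProduct, Fin.sum_univ_succ]
        ring
      · intro h
        simp [dotProduct, Fin.sum_univ_succ] at h
        refine hab (Fin.ext (hprim.pow_inj a.2 b.2 ?_))
        linear_combination (1 / 2 : ℂ) * h

end SecantVeronese

/-! ### A family of complete intersection curves: irreducibility -/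

namespace SecantVeronese

open MvPolynomial hiding zeroLocus

/-- The polynomial `T ^ (n + 1) + x₀ T ^ n - x₀ x₁ ^ n`. -/
noncomputable def branchPoly (n : ℕ) : Polynomial (MvPolynomial (Fin 2) ℂ) :=
  Polynomial.X ^ (n + 1) + (Polynomial.C (X 0) * Polynomial.X ^ n - Polynomial.C (X 0 * X 1 ^ n))

theorem branchPoly_tail_degree (n : ℕ) :
    (Polynomial.C (X 0) * Polynomial.X ^ n - Polynomial.C (X 0 * X 1 ^ n) :
      Polynomial (MvPolynomial (Fin 2) ℂ)).degree < (n + 1 : ℕ) := by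
  refine (Polynomial.degree_sub_le _ _).trans_lt (max_lt ?_ ?_)
  · exact (Polynomial.degree_C_mul_X_pow_le _ _).trans_lt (by norm_cast; omega)
  · exact Polynomial.degree_C_le.trans_lt (by norm_cast; omega)

theorem branchPoly_monic (n : ℕ) : (branchPoly n).Monic :=
  Polynomial.monic_X_pow_add (by exact_mod_cast branchPoly_tail_degree n)

theorem branchPoly_natDegree (n : ℕ) : (branchPoly n).natDegree = n + 1 := by
  refine Polynomial.natDegree_eq_of_degree_eq_some ?_
  rw [branchPoly, Polynomial.degree_add_eq_left_of_degree_lt, Polynomial.degree_X_pow]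
  rw [Polynomial.degree_X_pow]
  exact branchPoly_tail_degree n

/-- Eisenstein's criterion at `x₀`: the constant term `-x₀ x₁ ^ n` is divisible by `x₀` only once.
-/
theorem branchPoly_irreducible {n : ℕ} (hn : n ≠ 0) : Irreducible (branchPoly n) := by
  have hX0 : Prime (X 0 : MvPolynomial (Fin 2) ℂ) := X_prime
  have hprime : (Ideal.span {(X 0 : MvPolynomial (Fin 2) ℂ)}).IsPrime :=
    (Ideal.span_singleton_prime hX0.ne_zero).mpr hX0
  have hcoeff : ∀ i, i ≠ n + 1 → (branchPoly n).coeff i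
      = (if i = n then X 0 else 0) - (if i = 0 then X 0 * X 1 ^ n else 0) := by
    intro i hi
    rw [branchPoly, Polynomial.coeff_add, Polynomial.coeff_sub, Polynomial.coeff_C_mul_X_pow,
      Polynomial.coeff_X_pow, Polynomial.coeff_C, if_neg hi, zero_add]
  refine Polynomial.IsEisensteinAt.irreducible (𝓟 := Ideal.span {(X 0 : MvPolynomial (Fin 2) ℂ)})
    ⟨?_, ?_, ?_⟩ hprime (branchPoly_monic n).isPrimitive (by rw [branchPoly_natDegree]; omega)
  · rw [(branchPoly_monic n).leadingCoeff, ← Ideal.eq_top_iff_one]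
    exact hprime.ne_top
  · intro i hi
    rw [branchPoly_natDegree] at hi
    rw [hcoeff i (by omega)]
    refine Ideal.sub_mem _ ?_ ?_
    · split_ifs
      · exact Ideal.mem_span_singleton_self _
      · exact Ideal.zero_mem _
    · split_ifs
      · exact Ideal.mul_mem_right _ _ (Ideal.mem_span_singleton_self _)
      · exact Ideal.zero_mem _
  · rw [hcoeff 0 (by omega), if_neg (Ne.symm hn), if_pos rfl, zero_sub, neg_mem_iff,
      Ideal.span_singleton_pow, Ideal.mem_span_singleton, pow_two]
    intro h
    have h1 := (mul_dvd_mul_iff_left hX0.ne_zero).mp h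
    have h2 := hX0.dvd_of_dvd_pow h1
    rw [X_dvd_X] at h2
    simp at h2

/-- The ideal of `branchCurve`. -/
noncomputable def branchIdeal (n n' : ℕ) : Ideal (MvPolynomial (Fin 4) ℂ) :=
  Ideal.span {branchForm n 1, branchForm n' 2}

/-- The inclusion of the coordinate ring of the line in that of space. -/
noncomputable def lineInclusion : MvPolynomial (Fin 2) ℂ →+* MvPolynomial (Fin 4) ℂ :=
  (rename ![0, 3] : MvPolynomial (Fin 2) ℂ →ₐ[ℂ] MvPolynomial (Fin 4) ℂ).toRingHom

theorem lineInclusion_X_zero : lineInclusion (X 0) = X 0 := by simp [lineInclusion]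

theorem lineInclusion_X_one : lineInclusion (X 1) = X 3 := by simp [lineInclusion]

/-- The homogeneous coordinate ring of `branchCurve`. -/
def BranchRing (n n' : ℕ) : Type := MvPolynomial (Fin 4) ℂ ⧸ branchIdeal n n'

noncomputable instance (n n' : ℕ) : CommRing (BranchRing n n') :=
  inferInstanceAs (CommRing (MvPolynomial (Fin 4) ℂ ⧸ branchIdeal n n'))

/-- The restriction of polynomials to `branchCurve`. -/
noncomputable def branchMk (n n' : ℕ) : MvPolynomial (Fin 4) ℂ →+* BranchRing n n' :=
  Ideal.Quotient.mk (branchIdeal n n')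

theorem branchMk_surjective (n n' : ℕ) : Function.Surjective (branchMk n n') :=
  Ideal.Quotient.mk_surjective

theorem branchMk_eq_zero_iff {n n' : ℕ} {p : MvPolynomial (Fin 4) ℂ} :
    branchMk n n' p = 0 ↔ p ∈ branchIdeal n n' :=
  Ideal.Quotient.eq_zero_iff_mem

noncomputable instance (n n' : ℕ) : Algebra (MvPolynomial (Fin 2) ℂ) (BranchRing n n') :=
  ((branchMk n n').comp lineInclusion).toAlgebra

section

variable (n n' : ℕ)

local notation "A₂" => MvPolynomial (Fin 2) ℂ
local notation "Q" => BranchRing n n'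

theorem algebraMap_branch (p : A₂) :
    algebraMap A₂ Q p = branchMk n n' (lineInclusion p) := rfl

theorem aeval_branchPoly_mk (k : ℕ) (i : Fin 4) (hk : branchForm k i ∈ branchIdeal n n') :
    Polynomial.aeval (branchMk n n' (X i)) (branchPoly k) = 0 := by
  rw [← branchMk_eq_zero_iff (n := n) (n' := n')] at hk
  rw [← hk]
  simp only [branchPoly, branchForm, map_add, map_sub, map_mul, map_pow, Polynomial.aeval_X,
    Polynomial.aeval_C, algebraMap_branch, lineInclusion_X_zero, lineInclusion_X_one]
  ring

/-- The ring is generated over `ℂ[x₀, x₃]` by `x₁` and `x₂`, which are roots of monic polynomials of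
degrees `n + 1` and `n' + 1`. -/
theorem span_branch_eq_top :
    Submodule.span A₂ (Set.range fun p : Fin (n + 1) × Fin (n' + 1) =>
      (branchMk n n' (X 1) ^ (p.1 : ℕ) *
        branchMk n n' (X 2) ^ (p.2 : ℕ) : Q)) = ⊤ := by
  classical
  set α : Q := branchMk n n' (X 1)
  set β : Q := branchMk n n' (X 2)
  have hα : Polynomial.aeval α (branchPoly n) = 0 :=
    aeval_branchPoly_mk n n' n 1 (Ideal.subset_span (by simp))
  have hβ : Polynomial.aeval β (branchPoly n') = 0 :=
    aeval_branchPoly_mk n n' n' 2 (Ideal.subset_span (by simp))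
  have h1 := Submodule.span_range_natDegree_eq_adjoin (branchPoly_monic n) hα
  have h2 := Submodule.span_range_natDegree_eq_adjoin (branchPoly_monic n') hβ
  rw [branchPoly_natDegree] at h1 h2
  have h3 : Algebra.adjoin A₂ ({α} ∪ {β} : Set Q) = ⊤ := by
    rw [eq_top_iff]
    rintro z -
    obtain ⟨p, rfl⟩ := branchMk_surjective n n' z
    induction p using MvPolynomial.induction_on with
    | C c =>
      have : branchMk n n' (C c) = algebraMap A₂ Q (C c) := by
        rw [algebraMap_branch]
        simp [lineInclusion]
      rw [this]
      exact Subalgebra.algebraMap_mem _ _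
    | add p q hp hq => rw [map_add]; exact Subalgebra.add_mem _ hp hq
    | mul_X p i hp =>
      rw [map_mul]
      refine Subalgebra.mul_mem _ hp ?_
      fin_cases i
      · change branchMk n n' (X 0) ∈ _
        rw [← lineInclusion_X_zero]
        exact Subalgebra.algebraMap_mem _ (X 0)
      · exact Algebra.subset_adjoin (by simp [α])
      · exact Algebra.subset_adjoin (by simp [β])
      · change branchMk n n' (X 3) ∈ _
        rw [← lineInclusion_X_one]
        exact Subalgebra.algebraMap_mem _ (X 1)
  have h4 := Algebra.adjoin_union_coe_submodule A₂ ({α} : Set Q) {β}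
  rw [h3, ← h1, ← h2, Submodule.span_mul_span] at h4
  rw [eq_top_iff, ← Algebra.top_toSubmodule, h4]
  refine Submodule.span_mono ?_
  rintro _ ⟨_, ha, _, hb, rfl⟩
  simp only [Finset.coe_image, Set.mem_image, Finset.coe_range, Set.mem_Iio] at ha hb
  obtain ⟨i, hi, rfl⟩ := ha
  obtain ⟨j, hj, rfl⟩ := hb
  exact ⟨(⟨i, hi⟩, ⟨j, hj⟩), rfl⟩

instance : Module.Finite A₂ Q :=
  ⟨⟨(Set.finite_range _).toFinset, by
    rw [Set.Finite.coe_toFinset]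
    exact span_branch_eq_top n n'⟩⟩

end

/-- Roots `α`, `β` of the two irreducible polynomials generate extensions of coprime degrees of the
field of rational functions, hence linearly disjoint ones. So the `α ^ i β ^ j` are independent,
while the corresponding monomials span the quotient ring; that ring therefore embeds into a field.
-/
theorem branchIdeal_isPrime {n n' : ℕ} (hn : n ≠ 0) (hn' : n' ≠ 0)
    (hcop : Nat.Coprime (n + 1) (n' + 1)) : (branchIdeal n n').IsPrime := by
  let A₂ := MvPolynomial (Fin 2) ℂ
  let F := FractionRing A₂
  let Ω := AlgebraicClosure F
  have hirr : ∀ {k : ℕ}, k ≠ 0 → Irreducible ((branchPoly k).map (algebraMap A₂ F)) := fun hk =>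
    (branchPoly_monic _).irreducible_iff_irreducible_map_fraction_map.mp (branchPoly_irreducible hk)
  have hroot : ∀ {k : ℕ}, k ≠ 0 → ∃ α : Ω,
      Polynomial.aeval α ((branchPoly k).map (algebraMap A₂ F)) = 0 := fun hk =>
    IsAlgClosed.exists_aeval_eq_zero Ω _ (hirr hk).degree_pos.ne'
  have hfin : ∀ {k : ℕ} (hk : k ≠ 0) {α : Ω},
      Polynomial.aeval α ((branchPoly k).map (algebraMap A₂ F)) = 0 →
      (minpoly F α).natDegree = k + 1 ∧ IsIntegral F α := by
    intro k hk α hα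
    rw [← minpoly.eq_of_irreducible_of_monic (hirr hk) hα ((branchPoly_monic k).map _),
      (branchPoly_monic k).natDegree_map, branchPoly_natDegree]
    exact ⟨rfl, ⟨_, (branchPoly_monic k).map _, hα⟩⟩
  obtain ⟨α, hα⟩ := hroot hn
  obtain ⟨β, hβ⟩ := hroot hn'
  obtain ⟨hαd, hαi⟩ := hfin hn hα
  obtain ⟨hβd, hβi⟩ := hfin hn' hβ
  have hdisj : (IntermediateField.adjoin F {α}).LinearDisjoint (IntermediateField.adjoin F {β}) :=
    IntermediateField.LinearDisjoint.of_finrank_coprime (by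
      rw [IntermediateField.adjoin.finrank hαi, IntermediateField.adjoin.finrank hβi, hαd, hβd]
      exact hcop)
  have hind := hdisj.linearIndependent_mul
    (IntermediateField.adjoin.powerBasis hαi).basis.linearIndependent
    (IntermediateField.adjoin.powerBasis hβi).basis.linearIndependent
  let Θ : MvPolynomial (Fin 4) ℂ →+* Ω :=
    eval₂Hom ((algebraMap F Ω).comp ((algebraMap A₂ F).comp C))
      ![algebraMap F Ω (algebraMap A₂ F (X 0)), α, β, algebraMap F Ω (algebraMap A₂ F (X 1))]
  have hΘι : ∀ p, Θ (lineInclusion p) = algebraMap F Ω (algebraMap A₂ F p) := by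
    intro p
    have : Θ.comp lineInclusion = (algebraMap F Ω).comp (algebraMap A₂ F) := by
      refine MvPolynomial.ringHom_ext (fun c => ?_) fun i => ?_
      · simp [Θ, lineInclusion]
      · fin_cases i <;> simp [Θ, lineInclusion]
    exact congrArg (fun f => f p) this
  have hform : ∀ (k : ℕ) (i : Fin 4),
      Polynomial.aeval (Θ (X i)) ((branchPoly k).map (algebraMap A₂ F)) = 0 →
      Θ (branchForm k i) = 0 := by
    intro k i h
    rw [← h]
    simp only [branchPoly, branchForm, map_add, map_sub, map_mul, map_pow, Polynomial.aeval_X,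
      Polynomial.aeval_C, Polynomial.map_add, Polynomial.map_sub, Polynomial.map_mul,
      Polynomial.map_pow, Polynomial.map_X, Polynomial.map_C, ← hΘι, lineInclusion_X_zero,
      lineInclusion_X_one]
    ring
  have hle : branchIdeal n n' ≤ RingHom.ker Θ := by
    rw [branchIdeal, Ideal.span_le]
    rintro _ (rfl | rfl)
    · exact hform n 1 (by simpa [Θ] using hα)
    · exact hform n' 2 (by simpa [Θ] using hβ)
  have hge : RingHom.ker Θ ≤ branchIdeal n n' := by
    intro p hp
    have hmem : branchMk n n' p ∈ Submodule.span A₂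
        (Set.range fun p : Fin (n + 1) × Fin (n' + 1) =>
        (branchMk n n' (X 1) ^ (p.1 : ℕ) *
          branchMk n n' (X 2) ^ (p.2 : ℕ) :
          BranchRing n n')) := by
      rw [span_branch_eq_top]; trivial
    rw [Submodule.mem_span_range_iff_exists_fun] at hmem
    obtain ⟨c, hc⟩ := hmem
    rw [← branchMk_eq_zero_iff (n := n) (n' := n'), ← hc]
    let Λ : BranchRing n n' →+* Ω := Ideal.Quotient.lift (branchIdeal n n') Θ hle
    have hΛ : ∀ p, Λ (branchMk n n' p) = Θ p := fun p => rfl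
    have hsum := congrArg Λ hc
    rw [hΛ, RingHom.mem_ker.mp hp, map_sum] at hsum
    have hΘX : Θ (X 1) = α ∧ Θ (X 2) = β := by simp [Θ]
    have hc0 : ∀ ij, c ij = 0 := by
      have h0 : ∑ ij : Fin (n + 1) × Fin (n' + 1), algebraMap A₂ F (c ij) •
          (α ^ (ij.1 : ℕ) * β ^ (ij.2 : ℕ)) = 0 := by
        rw [← hsum]
        refine Finset.sum_congr rfl fun ij _ => ?_
        rw [Algebra.smul_def, Algebra.smul_def, algebraMap_branch, ← hΘι, map_mul, map_mul, map_pow,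
          map_pow, hΛ, hΛ, hΛ, hΘX.1,
          hΘX.2]
      have hdim : ∀ {γ : Ω} (hγ : IsIntegral F γ) {k : ℕ}, (minpoly F γ).natDegree = k + 1 →
          (IntermediateField.adjoin.powerBasis hγ).dim = k + 1 := fun hγ _ h => h
      let e : Fin (n + 1) × Fin (n' + 1) ≃ Fin (IntermediateField.adjoin.powerBasis hαi).dim ×
          Fin (IntermediateField.adjoin.powerBasis hβi).dim :=
        (finCongr (hdim hαi hαd).symm).prodCongr (finCongr (hdim hβi hβd).symm)
      have hind' := hind.comp e e.injective
      rw [Fintype.linearIndependent_iff] at hind'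
      have h5 := hind' (fun ij => algebraMap A₂ F (c ij)) (by
        rw [← h0]
        refine Finset.sum_congr rfl fun ij _ => ?_
        simp [e])
      intro ij
      exact (map_eq_zero_iff _ (IsFractionRing.injective A₂ F)).mp (h5 ij)
    simp [hc0]
  rw [le_antisymm hle hge]
  exact RingHom.ker_isPrime _

end SecantVeronese

/-! ### A family of complete intersection curves: ideals and finiteness -/

namespace SecantVeronese

open MvPolynomial hiding zeroLocus

theorem finite_zeros_of_isHomogeneous {G : MvPolynomial (Fin 2) ℂ} {m : ℕ} (hG : G.IsHomogeneous m)
    (h0 : G ≠ 0) : {t : ℂ | eval ![t, 1] G = 0}.Finite := by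
  have heval : ∀ t : ℂ, (aeval ![Polynomial.X, 1] G : Polynomial ℂ).eval t = eval ![t, 1] G := by
    intro t
    rw [← Polynomial.coe_evalRingHom, aeval_def, hom_eval₂]
    have h2 : (Polynomial.evalRingHom t).comp (algebraMap ℂ (Polynomial ℂ)) = RingHom.id ℂ := by
      ext
      simp
    rw [h2, eval₂_id]
    congr 2
    funext i
    fin_cases i <;> simp
  have hne : (aeval ![Polynomial.X, 1] G : Polynomial ℂ) ≠ 0 := by
    intro hz
    -- Dehomogenization loses the points with second coordinate zero; the factor `X 1` takes care of
    -- them.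
    refine h0 ((mul_eq_zero.mp (?_ : X 1 * G = 0)).resolve_left (X_ne_zero 1))
    refine MvPolynomial.funext fun z => ?_
    rw [map_mul, eval_X, map_zero]
    by_cases h1 : z 1 = 0
    · rw [h1, zero_mul]
    · have h2 : z = z 1 • ![z 0 / z 1, 1] := by
        funext i
        fin_cases i <;> simp [mul_div_cancel₀ _ h1]
      rw [h2, eval_smul_of_isHomogeneous hG, ← heval, hz]
      simp
  refine (Polynomial.finite_setOfPred_isRoot hne).subset fun t ht => ?_
  rw [Set.mem_ofPred_eq, Polynomial.IsRoot.def, heval]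
  exact ht

theorem finite_branch_roots (n : ℕ) (a b : ℂ) :
    {y : ℂ | a * (y ^ n - b ^ n) + y ^ (n + 1) = 0}.Finite := by
  have hne := ((branchPoly_monic n).map (eval ![a, b])).ne_zero
  refine (Polynomial.finite_setOfPred_isRoot hne).subset fun y hy => ?_
  have hy : a * (y ^ n - b ^ n) + y ^ (n + 1) = 0 := hy
  simp only [branchPoly, Set.mem_ofPred_eq, Polynomial.IsRoot.def, Polynomial.map_add,
    Polynomial.map_sub, Polynomial.map_mul, Polynomial.map_pow, Polynomial.map_X, Polynomial.map_C,
    Polynomial.eval_add, Polynomial.eval_sub, Polynomial.eval_mul, Polynomial.eval_pow,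
    Polynomial.eval_X, Polynomial.eval_C, map_mul, map_pow, eval_X]
  simp only [Matrix.cons_val]
  linear_combination hy

variable {n n' : ℕ}

theorem branchPoint_mem_coneOf (hn : n ≠ 0) (hn' : n' ≠ 0) :
    branchPoint ∈ coneOf (branchCurve n n') := by
  refine mem_coneOf_branchCurve.mpr ⟨fun h => ?_, ?_, ?_⟩
  · simpa [branchPoint] using congrFun h 0
  · simp [branchPoint, hn]
  · simp [branchPoint, hn']

theorem eval_eq_zero_of_mem_branchIdeal {F : MvPolynomial (Fin 4) ℂ} (hF : F ∈ branchIdeal n n')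
    {z : Fin 4 → ℂ} (h1 : eval z (branchForm n 1) = 0) (h2 : eval z (branchForm n' 2) = 0) :
    eval z F = 0 := by
  have hle : branchIdeal n n' ≤ RingHom.ker (eval z) := by
    rw [branchIdeal, Ideal.span_le]
    rintro _ (rfl | rfl)
    · exact h1
    · exact h2
  exact hle hF

/-- The Nullstellensatz concerns the affine cone including the origin, where a constant `F` need not
vanish. It is applied to `X 0 * F`, and `X 0` is cancelled by primality since it does not vanish at
`branchPoint`. -/
theorem mem_branchIdeal_of_vanishesAt (hn : n ≠ 0) (hn' : n' ≠ 0)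
    (hp : (branchIdeal n n').IsPrime) {F : MvPolynomial (Fin 4) ℂ} {m : ℕ} (hF : F.IsHomogeneous m)
    (h : ∀ x ∈ branchCurve n n', VanishesAt F x) : F ∈ branchIdeal n n' := by
  have hX0 : (X 0 : MvPolynomial (Fin 4) ℂ) ∉ branchIdeal n n' := by
    intro hmem
    obtain ⟨-, h1, h2⟩ := mem_coneOf_branchCurve.mp (branchPoint_mem_coneOf hn hn')
    have := eval_eq_zero_of_mem_branchIdeal hmem (z := branchPoint)
      (by rw [eval_branchForm]; exact h1) (by rw [eval_branchForm]; exact h2)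
    simp [branchPoint] at this
  refine (hp.mem_or_mem (?_ : X 0 * F ∈ _)).resolve_left hX0
  rw [← hp.radical, ← vanishingIdeal_zeroLocus_eq_radical (K := ℂ), mem_vanishingIdeal_iff]
  intro z hz
  rw [mem_zeroLocus_iff] at hz
  have h1 := hz (branchForm n 1) (Ideal.subset_span (by simp))
  have h2 := hz (branchForm n' 2) (Ideal.subset_span (by simp))
  simp only [aeval_eq_eval] at h1 h2 ⊢
  rw [map_mul, eval_X]
  by_cases hz0 : z = 0
  · simp [hz0]
  · rw [eval_branchForm] at h1 h2
    obtain ⟨_, hzX⟩ := mem_coneOf_branchCurve.mpr ⟨hz0, h1, h2⟩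
    rw [(vanishesAt_mk hF hz0).mp (h _ hzX), mul_zero]

theorem vanishesAt_of_mem_branchIdeal {F : MvPolynomial (Fin 4) ℂ}
    (h : F ∈ branchIdeal n n') {x : PSpace (Fin 4)} (hx : x ∈ branchCurve n n') :
    VanishesAt F x :=
  eval_eq_zero_of_mem_branchIdeal h (hx _ (by simp)) (hx _ (by simp))

theorem homogeneousIdeal_branchCurve (hn : n ≠ 0) (hn' : n' ≠ 0)
    (hp : (branchIdeal n n').IsPrime) :
    homogeneousIdeal (branchCurve n n') = branchIdeal n n' := by
  refine le_antisymm ?_ ?_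
  · rw [homogeneousIdeal, Ideal.span_le]
    rintro F ⟨m, hF, h⟩
    exact mem_branchIdeal_of_vanishesAt hn hn' hp hF h
  · rw [branchIdeal, Ideal.span_le]
    rintro _ (rfl | rfl)
    · exact Ideal.subset_span ⟨_, branchForm_isHomogeneous n 1, fun x hx => hx _ (by simp)⟩
    · exact Ideal.subset_span ⟨_, branchForm_isHomogeneous n' 2, fun x hx => hx _ (by simp)⟩

theorem isVariety_branchCurve (hn : n ≠ 0) (hn' : n' ≠ 0) (hp : (branchIdeal n n').IsPrime) :
    IsVariety (branchCurve n n') := by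
  refine ⟨isClosed_iff_isAlgebraicSet.mpr ⟨_, ?_, rfl⟩,
    isIrreducible_of_forall_mul ⟨_, (branchPoint_mem_coneOf hn hn').choose_spec⟩ ?_⟩
  · rintro _ (rfl | rfl)
    · exact ⟨_, branchForm_isHomogeneous n 1⟩
    · exact ⟨_, branchForm_isHomogeneous n' 2⟩
  · intro F G m k hF hG h
    have hFG := mem_branchIdeal_of_vanishesAt hn hn' hp (hF.mul hG) fun x hx => by
      rw [VanishesAt, map_mul, mul_eq_zero]
      exact h x hx
    exact (hp.mem_or_mem hFG).imp (fun h x hx => vanishesAt_of_mem_branchIdeal h hx)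
      fun h x hx => vanishesAt_of_mem_branchIdeal h hx

theorem finite_setOf_mk {σ : Type} {S : Set (σ → ℂ)} (hS : S.Finite) :
    {p : PSpace σ | ∃ v ∈ S, ∃ h : v ≠ 0, p = Projectivization.mk ℂ v h}.Finite := by
  have : {p : PSpace σ | ∃ v ∈ S, ∃ h : v ≠ 0, p = Projectivization.mk ℂ v h}
      = ⋃ v ∈ S, {p | ∃ h : v ≠ 0, p = Projectivization.mk ℂ v h} := by
    ext p
    simp
  rw [this]
  refine hS.biUnion fun v _ => Set.Subsingleton.finite ?_
  rintro _ ⟨h, rfl⟩ _ ⟨_, rfl⟩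
  rfl

/-- Elimination: a form not vanishing on `branchCurve` has a nonzero norm. -/
theorem exists_norm (hp : (branchIdeal n n').IsPrime) {F : MvPolynomial (Fin 4) ℂ} {m : ℕ}
    (hF : F.IsHomogeneous m) (hFI : F ∉ branchIdeal n n') :
    ∃ (G : MvPolynomial (Fin 2) ℂ) (k : ℕ), G.IsHomogeneous k ∧ G ≠ 0 ∧
      ∀ z ∈ coneOf (branchCurve n n'), eval z F = 0 → eval ![z 0, z 3] G = 0 := by
  have hdom : IsDomain (BranchRing n n') := Ideal.Quotient.isDomain (branchIdeal n n')
  have hint : Algebra.IsIntegral (MvPolynomial (Fin 2) ℂ) (BranchRing n n') :=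
    Algebra.IsIntegral.of_finite _ _
  have hne := Ideal.comap_ne_bot_of_integral_mem (R := MvPolynomial (Fin 2) ℂ)
    (mt branchMk_eq_zero_iff.mp hFI) (Ideal.mem_span_singleton_self (branchMk n n' F))
    (hint.isIntegral _)
  obtain ⟨G, hG, hG0⟩ := Submodule.exists_mem_ne_zero_of_ne_bot hne
  obtain ⟨c, hc⟩ := Ideal.mem_span_singleton.mp (Ideal.mem_comap.mp hG)
  obtain ⟨H, rfl⟩ := branchMk_surjective n n' c
  rw [algebraMap_branch, ← map_mul, ← sub_eq_zero, ← map_sub, branchMk_eq_zero_iff] at hc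
  have hlin : ∀ (p : MvPolynomial (Fin 2) ℂ) (z : Fin 4 → ℂ),
      eval z (lineInclusion p) = eval ![z 0, z 3] p := by
    intro p z
    have : (eval z).comp lineInclusion = eval ![z 0, z 3] := by
      refine MvPolynomial.ringHom_ext (fun c => ?_) fun i => ?_
      · simp [lineInclusion]
      · fin_cases i <;> simp [lineInclusion]
    exact congrArg (fun f => f p) this
  obtain ⟨k, hk⟩ : ∃ k, homogeneousComponent k G ≠ 0 := by
    by_contra! hcon
    apply hG0
    rw [← sum_homogeneousComponent G]
    exact Finset.sum_eq_zero fun i _ => hcon i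
  refine ⟨homogeneousComponent k G, k, homogeneousComponent_isHomogeneous k G, hk,
    fun z hz hzF => ?_⟩
  refine eval_homogeneousComponent_eq_zero (S := {w | ∃ z : Fin 4 → ℂ,
    eval z (branchForm n 1) = 0 ∧ eval z (branchForm n' 2) = 0 ∧ eval z F = 0 ∧ w = ![z 0, z 3]})
    ?_ ?_ k ?_
  · rintro _ ⟨z, h1, h2, h3, rfl⟩ t
    refine ⟨t • z, ?_, ?_, ?_, ?_⟩
    · rw [eval_smul_of_isHomogeneous (branchForm_isHomogeneous n 1), h1, mul_zero]
    · rw [eval_smul_of_isHomogeneous (branchForm_isHomogeneous n' 2), h2, mul_zero]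
    · rw [eval_smul_of_isHomogeneous hF, h3, mul_zero]
    · funext i
      fin_cases i <;> simp
  · rintro _ ⟨z, h1, h2, h3, rfl⟩
    have := eval_eq_zero_of_mem_branchIdeal hc h1 h2
    rwa [map_sub, map_mul, h3, zero_mul, sub_zero, hlin] at this
  · obtain ⟨-, h1, h2⟩ := mem_coneOf_branchCurve.mp hz
    exact ⟨z, by rw [eval_branchForm]; exact h1, by rw [eval_branchForm]; exact h2, hzF, rfl⟩

theorem isProjCurve_branchCurve (hn : n ≠ 0) (hn' : n' ≠ 0) (hcop : Nat.Coprime (n + 1) (n' + 1)) :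
    IsProjCurve (branchCurve n n') := by
  have hp := branchIdeal_isPrime hn hn' hcop
  refine ⟨isVariety_branchCurve hn hn' hp, fun F m hF hFX => ?_⟩
  have hFI : F ∉ branchIdeal n n' := by
    intro h
    obtain ⟨x, hx, hFx⟩ := hFX
    exact hFx (vanishesAt_of_mem_branchIdeal h hx)
  obtain ⟨G, k, hG, hG0, hGF⟩ := exists_norm hp hF hFI
  -- The possible values of `z 0` once `z 3` is scaled to `0` or `1`: a root of the norm if `z 3 =
  -- 1`, and `1` if `z 3 = 0`. The remaining two coordinates are then roots of monic polynomials.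
  set R := insert 1 {t : ℂ | eval ![t, 1] G = 0} with hR
  have hRfin : R.Finite := (finite_zeros_of_isHomogeneous hG hG0).insert 1
  have hroots : ∀ l : ℕ,
      (⋃ a ∈ R, ⋃ b ∈ ({0, 1} : Set ℂ), {y : ℂ | a * (y ^ l - b ^ l) + y ^ (l + 1) = 0}).Finite :=
    fun l => hRfin.biUnion fun a _ => (Set.toFinite _).biUnion fun b _ => finite_branch_roots l a b
  set D : Fin 4 → Set ℂ := ![R,
    ⋃ a ∈ R, ⋃ b ∈ ({0, 1} : Set ℂ), {y : ℂ | a * (y ^ n - b ^ n) + y ^ (n + 1) = 0},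
    ⋃ a ∈ R, ⋃ b ∈ ({0, 1} : Set ℂ), {y : ℂ | a * (y ^ n' - b ^ n') + y ^ (n' + 1) = 0}, {0, 1}]
    with hD
  have hDfin : (Set.pi Set.univ D).Finite := by
    refine Set.Finite.pi fun i => ?_
    fin_cases i
    · exact hRfin
    · exact hroots n
    · exact hroots n'
    · exact Set.toFinite ({0, 1} : Set ℂ)
  have hmem : ∀ z ∈ coneOf (branchCurve n n'), z 0 ∈ R → z 3 ∈ ({0, 1} : Set ℂ) →
      z ∈ Set.pi Set.univ D := by
    intro z hz h0 h3 i _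
    obtain ⟨-, h1, h2⟩ := mem_coneOf_branchCurve.mp hz
    fin_cases i
    · exact h0
    · exact Set.mem_biUnion h0 (Set.mem_biUnion h3 h1)
    · exact Set.mem_biUnion h0 (Set.mem_biUnion h3 h2)
    · exact h3
  refine (finite_setOf_mk hDfin).subset ?_
  rintro p ⟨hpX, hpF⟩
  have hz := rep_mem_coneOf hpX
  obtain ⟨c, hc, hcD⟩ : ∃ c : ℂ, c ≠ 0 ∧ c • p.rep ∈ Set.pi Set.univ D := by
    by_cases h3 : p.rep 3 = 0
    · have h0 : p.rep 0 ≠ 0 := by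
        intro h0
        obtain ⟨hne, h1, h2⟩ := mem_coneOf_branchCurve.mp hz
        refine hne (funext fun i => ?_)
        rw [h0, zero_mul, zero_add] at h1 h2
        fin_cases i
        · exact h0
        · exact pow_eq_zero_iff (by omega) |>.mp h1
        · exact pow_eq_zero_iff (by omega) |>.mp h2
        · exact h3
      exact ⟨(p.rep 0)⁻¹, inv_ne_zero h0, hmem _ (smul_mem_coneOf hz (inv_ne_zero h0))
        (by simp [hR, h0]) (by simp [h3])⟩
    · refine ⟨(p.rep 3)⁻¹, inv_ne_zero h3, hmem _ (smul_mem_coneOf hz (inv_ne_zero h3))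
        (Or.inr ?_) (by simp [h3])⟩
      have h4 := hGF _ (smul_mem_coneOf hz (inv_ne_zero h3)) (by
        rw [eval_smul_of_isHomogeneous hF, hpF, mul_zero])
      simpa [h3] using h4
  refine ⟨c • p.rep, hcD, smul_ne_zero hc p.rep_nonzero, ?_⟩
  conv_lhs => rw [← p.mk_rep]
  rw [eq_comm, Projectivization.mk_eq_mk_iff']
  exact ⟨c, rfl⟩

/-- The complete intersection curves of the family. -/
theorem exists_completeIntersection (q : ℕ) :
    ∃ (s s' t t' : ℕ) (g g' h h' : MvPolynomial (Fin 3) ℂ)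
      (f f' : MvPolynomial (Fin 4) ℂ) (X : Set (PSpace (Fin 4))),
      1 ≤ s ∧ 1 ≤ s' ∧ 2 ≤ t ∧ 2 ≤ t' ∧
      g.IsHomogeneous t ∧ g'.IsHomogeneous t' ∧
      h.IsHomogeneous (s + t) ∧ h'.IsHomogeneous (s' + t') ∧
      f = MvPolynomial.X 0 ^ s * MvPolynomial.rename Fin.succ g +
        MvPolynomial.rename Fin.succ h ∧
      f' = MvPolynomial.X 0 ^ s' * MvPolynomial.rename Fin.succ g' +
        MvPolynomial.rename Fin.succ h' ∧
      X = _root_.zeroLocus {f, f'} ∧ homogeneousIdeal X = Ideal.span {f, f'} ∧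
      IsSingularVariety X ∧ topologicalKrullDim X = 1 ∧ ¬ EKSHolds X ∧
      ∀ r d : ℕ, 2 ≤ r → 2 * r - 1 ≤ d →
        secantVariety r (veronese d '' X) ≠
          secantVariety r (Set.range (veronese (σ := Fin 4) d)) ∩
            linearSpan (veronese d '' X) ∧
        ¬ IsCutOutInDegreeLE q (secantVariety r (veronese d '' X)) := by
  -- A multiple of `3` larger than `q`: then `n + 1` is coprime to `2 + 1`, and the `n` planes
  -- exclude equations of degree at most `q`.
  set n := 3 * (q + 1) with hn
  have hcop : Nat.Coprime (n + 1) (2 + 1) := by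
    rw [hn, Nat.coprime_comm]
    exact (Nat.coprime_mul_left_add_right 3 1 (q + 1)).mpr (by norm_num)
  have hM := isMultibranchPoint_branchCurve (n := n) (by omega)
  have hC := isProjCurve_branchCurve (n := n) (n' := 2) (by omega) (by omega) hcop
  obtain ⟨hsing, hdim, hinf⟩ := hM.isSingularVariety (by simp) hC
  have hhom : ∀ (k : ℕ) (i j : Fin 3),
      (X i ^ k - X j ^ k : MvPolynomial (Fin 3) ℂ).IsHomogeneous k := fun k i j =>
    (isHomogeneous_X_pow i k).sub (isHomogeneous_X_pow j k)
  refine ⟨1, 1, n, 2, X 0 ^ n - X 2 ^ n, X 1 ^ 2 - X 2 ^ 2, X 0 ^ (n + 1), X 1 ^ 3,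
    branchForm n 1, branchForm 2 2, branchCurve n 2, le_rfl, le_rfl, by omega, le_rfl,
    hhom n 0 2, hhom 2 1 2, ?_, isHomogeneous_X_pow _ _, ?_, ?_, rfl,
    homogeneousIdeal_branchCurve (by omega) (by omega)
      (branchIdeal_isPrime (by omega) (by omega) hcop), hsing, hdim, hM.not_eksHolds (by simp) hinf,
    fun r d hr hd => ⟨hM.secantVariety_ne (by simp) hinf hr hd,
      hM.not_isCutOutInDegreeLE (by simp) hinf hr hd (by omega)⟩⟩
  · rw [add_comm]
    exact isHomogeneous_X_pow _ _
  · simp only [branchForm, map_sub, map_pow, rename_X, pow_one]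
    rfl
  · simp only [branchForm, map_sub, map_pow, rename_X, pow_one]
    rfl

end SecantVeronese

/-! ### Rational curves with an ordinary multiple point -/

namespace SecantVeronese

open MvPolynomial hiding zeroLocus
open Topology

/-- The determinant of two vectors in the plane. -/
def area {R : Type*} [CommRing R] (a b : Fin 2 → R) : R := a 0 * b 1 - a 1 * b 0

theorem map_area {R S : Type*} [CommRing R] [CommRing S] (f : R →+* S) (a b : Fin 2 → R) :
    f (area a b) = area (f ∘ a) (f ∘ b) := by
  simp [area]

theorem eq_of_area_eq_one {R : Type*} [CommRing R] {p q : Fin 2 → R} (h : area p q = 1)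
    (u : Fin 2 → R) : u = area u q • p + area p u • q := by
  simp only [area] at h
  funext m
  fin_cases m
  · simp only [area, Fin.zero_eta, Pi.add_apply, Pi.smul_apply, smul_eq_mul]
    linear_combination (-u 0) * h
  · simp only [area, Fin.mk_one, Pi.add_apply, Pi.smul_apply, smul_eq_mul]
    linear_combination (-u 1) * h

theorem exists_area_eq {R : Type*} [CommRing R] (f : ℂ →+* R) (m : Fin 2) :
    ∃ e : Fin 2 → ℂ, ∀ u : Fin 2 → R, area (f ∘ e) u = u m := by
  fin_cases m
  · exact ⟨![0, -1], fun u => by simp [area]⟩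
  · exact ⟨![1, 0], fun u => by simp [area]⟩

section Param

variable {R S : Type*} [CommRing R] [CommRing S]

/-- The values of a tuple of binary forms over a ring containing the complex numbers. -/
noncomputable def paramEval (f : ℂ →+* R) (Q : Fin 4 → MvPolynomial (Fin 2) ℂ) (u : Fin 2 → R) :
    Fin 4 → R :=
  fun n => eval₂ f u (Q n)

theorem map_paramEval (g : R →+* S) (f : ℂ →+* R) (Q : Fin 4 → MvPolynomial (Fin 2) ℂ)
    (u : Fin 2 → R) : g ∘ paramEval f Q u = paramEval (g.comp f) Q (g ∘ u) :=
  funext fun n => hom_eval₂ (Q n) f g u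

theorem paramEval_id (Q : Fin 4 → MvPolynomial (Fin 2) ℂ) (u : Fin 2 → ℂ) :
    paramEval (RingHom.id ℂ) Q u = fun n => eval u (Q n) := rfl

theorem paramEval_smul {Q : Fin 4 → MvPolynomial (Fin 2) ℂ} {D : ℕ}
    (hQ : ∀ n, (Q n).IsHomogeneous D) (f : ℂ →+* R) (c : R) (u : Fin 2 → R) :
    paramEval f Q (c • u) = c ^ D • paramEval f Q u := by
  funext n
  simp only [paramEval, eval₂_eq_eval_map, Pi.smul_apply, smul_eq_mul]
  exact eval_smul_of_isHomogeneous ((hQ n).map f) c u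

end Param

/-- The binary forms `Q` of degree `D` map the points `p i` of the projective line to the same
point `x`, and their span contains all forms that vanish at these points and have two further
prescribed zeros. The vectors `q i` complement the vectors `p i`. -/
structure IsMultipointParam {k : ℕ} (D : ℕ) (Q : Fin 4 → MvPolynomial (Fin 2) ℂ)
    (p q : Fin k → Fin 2 → ℂ) (x : Fin 4 → ℂ) : Prop where
  homogeneous : ∀ n, (Q n).IsHomogeneous D
  ne_zero : x ≠ 0
  eval_eq : ∀ i n, eval (p i) (Q n) = x n
  area_eq_one : ∀ i, area (p i) (q i) = 1
  area_ne_zero : ∀ i j, i ≠ j → area (p i) (p j) ≠ 0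
  exists_form : ∀ e e' : Fin 2 → ℂ, ∃ γ : Fin 4 → ℂ, ∑ n, C (γ n) * Q n =
    (∏ i, area (C ∘ p i) (X : Fin 2 → MvPolynomial (Fin 2) ℂ)) * area (C ∘ e) X * area (C ∘ e') X

/-- The parametrization of the branch through `x` that belongs to the parameter `p`. -/
noncomputable def branchArc (Q : Fin 4 → MvPolynomial (Fin 2) ℂ) (p q : Fin 2 → ℂ) :
    Fin 4 → Polynomial ℂ :=
  paramEval Polynomial.C Q (Polynomial.C ∘ p + (Polynomial.X : Polynomial ℂ) • Polynomial.C ∘ q)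

/-- The tangent vector of the branch. -/
noncomputable def branchTangent (Q : Fin 4 → MvPolynomial (Fin 2) ℂ) (p q : Fin 2 → ℂ) :
    Fin 4 → ℂ :=
  fun n => (branchArc Q p q n).coeff 1

theorem eval₂_branchArc {R : Type*} [CommRing R] (f : ℂ →+* R)
    (Q : Fin 4 → MvPolynomial (Fin 2) ℂ) (p q : Fin 2 → ℂ) (ε : R) (n : Fin 4) :
    (branchArc Q p q n).eval₂ f ε = paramEval f Q (f ∘ p + ε • f ∘ q) n := by
  have h := congrFun (map_paramEval (Polynomial.eval₂RingHom f ε) Polynomial.C Q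
    (Polynomial.C ∘ p + (Polynomial.X : Polynomial ℂ) • Polynomial.C ∘ q)) n
  have h1 : (Polynomial.eval₂RingHom f ε).comp Polynomial.C = f := by
    ext c
    simp
  have h2 : Polynomial.eval₂RingHom f ε ∘
      (Polynomial.C ∘ p + (Polynomial.X : Polynomial ℂ) • Polynomial.C ∘ q)
      = f ∘ p + ε • f ∘ q := by
    funext m
    simp only [Function.comp_apply, Pi.add_apply, Pi.smul_apply, smul_eq_mul,
      Polynomial.coe_eval₂RingHom, Polynomial.eval₂_add, Polynomial.eval₂_mul, Polynomial.eval₂_C,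
      Polynomial.eval₂_X]
  rw [h1, h2] at h
  exact h

/-- The image of the projective line under a tuple of binary forms. -/
def paramCurve (Q : Fin 4 → MvPolynomial (Fin 2) ℂ) : Set (PSpace (Fin 4)) :=
  {y | ∃ u : Fin 2 → ℂ, u ≠ 0 ∧ ∃ h : (fun n => eval u (Q n)) ≠ 0, y = Projectivization.mk ℂ _ h}

namespace IsMultipointParam

variable {k D : ℕ} {Q : Fin 4 → MvPolynomial (Fin 2) ℂ} {p q : Fin k → Fin 2 → ℂ} {x : Fin 4 → ℂ}

/-- The polynomial identity of `exists_form` is evaluated in an arbitrary ring, with one `γ` serving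
complex points, arcs and valuation rings alike. -/
theorem exists_dotProduct_paramEval (h : IsMultipointParam D Q p q x) (e e' : Fin 2 → ℂ) :
    ∃ γ : Fin 4 → ℂ, ∀ {R : Type} [CommRing R] (f : ℂ →+* R) (u : Fin 2 → R),
      (f ∘ γ) ⬝ᵥ paramEval f Q u =
        (∏ i, area (f ∘ p i) u) * area (f ∘ e) u * area (f ∘ e') u := by
  obtain ⟨γ, hγ⟩ := h.exists_form e e'
  refine ⟨γ, fun f u => ?_⟩
  have h1 := congrArg (eval₂Hom f u) hγ
  have h2 : eval₂Hom f u ∘ X = u := by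
    funext m
    simp
  have h3 : ∀ a : Fin 2 → ℂ, eval₂Hom f u ∘ C ∘ a = f ∘ a := by
    intro a
    funext m
    simp
  simp only [map_sum, map_mul, map_prod, map_area, h2, h3, eval₂Hom_C] at h1
  exact h1

theorem paramEval_point (h : IsMultipointParam D Q p q x) (i : Fin k) :
    (fun n => eval (p i) (Q n)) = x :=
  funext (h.eval_eq i)

theorem paramEval_add_smul (h : IsMultipointParam D Q p q x) (i : Fin k) {R : Type} [CommRing R]
    (f : ℂ →+* R) (ε : R) (n : Fin 4) :
    paramEval f Q (f ∘ p i + ε • f ∘ q i) n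
      = f (x n) + ε * (branchArc Q (p i) (q i) n).divX.eval₂ f ε := by
  have h0 : (branchArc Q (p i) (q i) n).coeff 0 = x n := by
    rw [Polynomial.coeff_zero_eq_eval_zero, Polynomial.eval, eval₂_branchArc, zero_smul, add_zero,
      ← h.paramEval_point i]
    rfl
  rw [← eval₂_branchArc]
  conv_lhs => rw [← Polynomial.divX_mul_X_add (branchArc Q (p i) (q i) n)]
  rw [Polynomial.eval₂_add, Polynomial.eval₂_mul, Polynomial.eval₂_X, Polynomial.eval₂_C, h0]
  ring

/-- A linear form vanishing at `x` and at exactly two prescribed tangent vectors. -/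
theorem exists_form_tangent (h : IsMultipointParam D Q p q x) (i j : Fin k) :
    ∃ γ : Fin 4 → ℂ, γ ⬝ᵥ x = 0 ∧
      ∀ m, γ ⬝ᵥ branchTangent Q (p m) (q m) = 0 ↔ m = i ∨ m = j := by
  classical
  obtain ⟨γ, hγ⟩ := h.exists_dotProduct_paramEval (p i) (p j)
  have hself : ∀ a : Fin 2 → ℂ, area a a = 0 := fun a => by simp only [area]; ring
  have hzero : ∀ a b, area (p a) (p b) = 0 ↔ b = a := by
    intro a b
    constructor
    · intro h0
      by_contra hne
      exact h.area_ne_zero a b (Ne.symm hne) h0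
    · rintro rfl
      exact hself _
  refine ⟨γ, ?_, fun m => ?_⟩
  · have h1 := hγ (RingHom.id ℂ) (p i)
    rw [paramEval_id, h.paramEval_point] at h1
    simp only [RingHom.coe_id, Function.id_comp, hself, mul_zero, zero_mul] at h1
    exact h1
  -- Along the branch of `p m` the factor belonging to `m` equals the parameter, so the linear
  -- coefficient is the product of the remaining factors at `p m`. It vanishes exactly if one of the
  -- two extra zeros is `p m`.
  · have h1 := hγ Polynomial.C
      (Polynomial.C ∘ p m + (Polynomial.X : Polynomial ℂ) • Polynomial.C ∘ q m)
    have harea : ∀ a : Fin 2 → ℂ,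
        area (Polynomial.C ∘ a)
            (Polynomial.C ∘ p m + (Polynomial.X : Polynomial ℂ) • Polynomial.C ∘ q m)
          = Polynomial.C (area a (p m)) + Polynomial.X * Polynomial.C (area a (q m)) := by
      intro a
      simp only [area, Function.comp_apply, Pi.add_apply, Pi.smul_apply, smul_eq_mul, map_sub,
        map_mul]
      ring
    rw [← Finset.mul_prod_erase _ _ (Finset.mem_univ m)] at h1
    simp only [harea, hself, h.area_eq_one, map_zero, map_one, zero_add, mul_one] at h1
    have h2 := congrArg (fun P : Polynomial ℂ => P.coeff 1) h1
    have h3 : ((Polynomial.C ∘ γ) ⬝ᵥ paramEval Polynomial.C Q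
        (Polynomial.C ∘ p m + (Polynomial.X : Polynomial ℂ) • Polynomial.C ∘ q m)).coeff 1
        = γ ⬝ᵥ branchTangent Q (p m) (q m) := by
      simp only [dotProduct, Polynomial.finsetSum_coeff, Function.comp_apply,
        Polynomial.coeff_C_mul]
      rfl
    simp only [h3, mul_assoc, Polynomial.coeff_X_mul, Polynomial.mul_coeff_zero,
      Polynomial.coeff_zero_prod] at h2
    rw [h2]
    simp only [Polynomial.coeff_add, Polynomial.coeff_C_zero, Polynomial.mul_coeff_zero,
      Polynomial.coeff_X_zero, zero_mul, add_zero, mul_eq_zero, hzero, Finset.prod_eq_zero_iff]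
    constructor
    · rintro (⟨l, hl, hml⟩ | h | h)
      · exact absurd hml.symm (Finset.ne_of_mem_erase hl)
      · exact Or.inl h
      · exact Or.inr h
    · exact Or.inr

theorem branchTangent_injective (h : IsMultipointParam D Q p q x) {i j : Fin k}
    (hij : branchTangent Q (p i) (q i) = branchTangent Q (p j) (q j)) : i = j := by
  obtain ⟨γ, -, hγ⟩ := h.exists_form_tangent i i
  have := (hγ i).mpr (Or.inl rfl)
  rw [hij, hγ] at this
  exact (or_self_iff.mp this).symm

/-- The vector `x` and three tangent vectors form a basis. -/
theorem exists_eq_smul_add (h : IsMultipointParam D Q p q x) {i j l : Fin k} (hij : i ≠ j)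
    (hil : i ≠ l) (hjl : j ≠ l) (z : Fin 4 → ℂ) : ∃ a b c d : ℂ,
      z = a • x + b • branchTangent Q (p i) (q i) + c • branchTangent Q (p j) (q j)
        + d • branchTangent Q (p l) (q l) := by
  have hind : LinearIndependent ℂ ![x, branchTangent Q (p i) (q i), branchTangent Q (p j) (q j),
      branchTangent Q (p l) (q l)] := by
    rw [Fintype.linearIndependent_iff]
    intro g hg
    simp only [Fin.sum_univ_four, Matrix.cons_val] at hg
    have key : ∀ a b c : Fin k, ∃ γ : Fin 4 → ℂ, γ ⬝ᵥ x = 0 ∧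
        γ ⬝ᵥ branchTangent Q (p a) (q a) = 0 ∧ γ ⬝ᵥ branchTangent Q (p b) (q b) = 0 ∧
        (c ≠ a → c ≠ b → γ ⬝ᵥ branchTangent Q (p c) (q c) ≠ 0) := by
      intro a b c
      obtain ⟨γ, hγ0, hγ⟩ := h.exists_form_tangent a b
      exact ⟨γ, hγ0, (hγ a).mpr (Or.inl rfl), (hγ b).mpr (Or.inr rfl), fun h1 h2 h3 =>
        ((hγ c).mp h3).elim h1 h2⟩
    have h3 : g 3 = 0 := by
      obtain ⟨γ, e0, e1, e2, e3⟩ := key i j l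
      have := congrArg (γ ⬝ᵥ ·) hg
      simp only [dotProduct_add, dotProduct_smul, e0, e1, e2, smul_eq_mul, mul_zero, zero_add,
        add_zero, dotProduct_zero, mul_eq_zero] at this
      exact this.resolve_right (e3 hil.symm hjl.symm)
    have h2 : g 2 = 0 := by
      obtain ⟨γ, e0, e1, e2, e3⟩ := key i l j
      have := congrArg (γ ⬝ᵥ ·) hg
      simp only [dotProduct_add, dotProduct_smul, e0, e1, e2, smul_eq_mul, mul_zero, zero_add,
        add_zero, dotProduct_zero, mul_eq_zero] at this
      exact this.resolve_right (e3 hij.symm hjl)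
    have h1 : g 1 = 0 := by
      obtain ⟨γ, e0, e1, e2, e3⟩ := key j l i
      have := congrArg (γ ⬝ᵥ ·) hg
      simp only [dotProduct_add, dotProduct_smul, e0, e1, e2, smul_eq_mul, mul_zero, zero_add,
        add_zero, dotProduct_zero, mul_eq_zero] at this
      exact this.resolve_right (e3 hij hil)
    rw [h1, h2, h3, zero_smul, zero_smul, zero_smul, add_zero, add_zero, add_zero] at hg
    have h0 : g 0 = 0 := (smul_eq_zero.mp hg).resolve_right h.ne_zero
    intro m
    fin_cases m
    exacts [h0, h1, h2, h3]
  have hspan := hind.span_eq_top_of_card_eq_finrank (by simp)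
  have hz : z ∈ Submodule.span ℂ (Set.range ![x, branchTangent Q (p i) (q i),
      branchTangent Q (p j) (q j), branchTangent Q (p l) (q l)]) := hspan ▸ Submodule.mem_top
  obtain ⟨g, hg⟩ := (Submodule.mem_span_range_iff_exists_fun ℂ).mp hz
  refine ⟨g 0, g 1, g 2, g 3, ?_⟩
  rw [← hg]
  simp only [Fin.sum_univ_four, Matrix.cons_val]

/-- A common zero `u` of the forms would be a zero of all products in `exists_form`; varying the
extra factors forces `u` to be proportional to some `p i`, where the value is a nonzero multiple of
`x`. -/
theorem eval_ne_zero (h : IsMultipointParam D Q p q x) {u : Fin 2 → ℂ} (hu : u ≠ 0) :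
    (fun n => eval u (Q n)) ≠ 0 := by
  intro h0
  obtain ⟨m, hm⟩ := Function.ne_iff.mp hu
  obtain ⟨e, he⟩ := exists_area_eq (RingHom.id ℂ) m
  obtain ⟨γ, hγ⟩ := h.exists_dotProduct_paramEval e e
  have h1 := hγ (RingHom.id ℂ) u
  rw [paramEval_id, h0, he, eq_comm] at h1
  have h2 : ∏ i, area (p i) u = 0 := by
    have h3 : (∏ i, area (p i) u) * u m * u m = 0 := h1.trans (dotProduct_zero _)
    exact ((mul_eq_zero.mp ((mul_eq_zero.mp h3).resolve_right hm)).resolve_right hm)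
  obtain ⟨i, -, hi⟩ := Finset.prod_eq_zero_iff.mp h2
  have h3 := eq_of_area_eq_one (h.area_eq_one i) u
  rw [hi, zero_smul, add_zero] at h3
  have h4 : area u (q i) ≠ 0 := by
    intro h4
    rw [h4, zero_smul] at h3
    exact hu h3
  rw [← paramEval_id, h3, paramEval_smul h.homogeneous, paramEval_id, h.paramEval_point] at h0
  exact smul_ne_zero (pow_ne_zero _ h4) h.ne_zero h0

theorem mem_coneOf (h : IsMultipointParam D Q p q x) {z : Fin 4 → ℂ} :
    z ∈ coneOf (paramCurve Q) ↔
      ∃ u : Fin 2 → ℂ, u ≠ 0 ∧ ∃ c : ℂ, c ≠ 0 ∧ z = c • fun n => eval u (Q n) := by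
  constructor
  · rintro ⟨hz, u, hu, h0, heq⟩
    obtain ⟨c, hc⟩ := (Projectivization.mk_eq_mk_iff' ℂ _ _ _ _).mp heq
    refine ⟨u, hu, c, ?_, hc.symm⟩
    rintro rfl
    rw [zero_smul] at hc
    exact hz hc.symm
  · rintro ⟨u, hu, c, hc, rfl⟩
    have h0 : (fun n => eval u (Q n)) ∈ coneOf (paramCurve Q) :=
      ⟨h.eval_ne_zero hu, u, hu, h.eval_ne_zero hu, rfl⟩
    exact smul_mem_coneOf h0 hc

theorem isArcTangent (h : IsMultipointParam D Q p q x) (i : Fin k) :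
    IsArcTangent (paramCurve Q) x (branchTangent Q (p i) (q i)) := by
  have hval : ∀ ε : ℂ, (fun n => (branchArc Q (p i) (q i) n).eval ε)
      = fun n => eval (p i + ε • q i) (Q n) := fun ε =>
    funext fun n => eval₂_branchArc (RingHom.id ℂ) Q (p i) (q i) ε n
  refine ⟨fun ε n => (branchArc Q (p i) (q i) n).eval ε, ?_, ?_, ?_⟩
  · exact (hval 0).trans (by rw [zero_smul, add_zero, h.paramEval_point])
  · refine Filter.Eventually.of_forall fun ε => ?_
    change (fun n => (branchArc Q (p i) (q i) n).eval ε) ∈ _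
    rw [hval, h.mem_coneOf]
    refine ⟨p i + ε • q i, fun h0 => ?_, 1, one_ne_zero, (one_smul _ _).symm⟩
    have h1 : area (p i + ε • q i) (q i) = area (p i) (q i) := by
      simp only [area, Pi.add_apply, Pi.smul_apply, smul_eq_mul]
      ring
    rw [h0, h.area_eq_one] at h1
    simp [area] at h1
  · refine hasDerivAt_pi.mpr fun n => ?_
    refine ((branchArc Q (p i) (q i) n).hasDerivAt 0).congr_deriv ?_
    rw [← Polynomial.coeff_zero_eq_eval_zero, Polynomial.coeff_derivative]
    simp [branchTangent]

end IsMultipointParam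

end SecantVeronese

/-! ### Branches and closedness of rational curves with a multiple point -/

namespace SecantVeronese

open MvPolynomial hiding zeroLocus

namespace IsMultipointParam

variable {k D : ℕ} {Q : Fin 4 → MvPolynomial (Fin 2) ℂ} {p q : Fin k → Fin 2 → ℂ} {x : Fin 4 → ℂ}

/-- The generic value of a family of points of the curve has a parameter over the valuation ring. -/
theorem exists_normal_parameter (h : IsMultipointParam D Q p q x) {W : Type} (P : Place W)
    {A : W → Fin 4 → ℂ} (hA : ∀ w, A w ∈ coneOf (paramCurve Q)) :
    ∃ u : Fin 2 → P.O, (∃ m, u m = 1) ∧ ∃ c : P.K, c ≠ 0 ∧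
      ∀ n, (P.ψ fun w => A w n) = c * (paramEval P.j Q u n : P.O) := by
  choose U hU μ hμ hAU using fun w => h.mem_coneOf.mp (hA w)
  obtain ⟨u, hu1, c, hc, hu⟩ := P.exists_isNormalForm hU
  have hμ' : P.ψ μ ≠ 0 := by
    have h1 : μ * (fun w => (μ w)⁻¹) = 1 := funext fun w => mul_inv_cancel₀ (hμ w)
    have h2 := congrArg P.ψ h1
    rw [map_mul, map_one] at h2
    exact left_ne_zero_of_mul_eq_one h2
  refine ⟨u, hu1, P.ψ μ * (c ^ D)⁻¹, mul_ne_zero hμ' (inv_ne_zero (pow_ne_zero _ hc)), fun n => ?_⟩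
  have h1 : ((paramEval P.j Q u n : P.O) : P.K) = c ^ D * P.ψ fun w => eval (U w) (Q n) := by
    have h2 : P.O.subtype ∘ u = c • fun m => P.ψ fun w => U w m := funext hu
    have h3 := congrFun (map_paramEval P.O.subtype P.j Q u) n
    rw [h2, paramEval_smul h.homogeneous] at h3
    rw [P.ψ_eval]
    exact h3
  have h2 : (fun w => A w n) = μ * fun w => eval (U w) (Q n) := by
    funext w
    rw [hAU]
    rfl
  rw [h1, h2, map_mul, mul_assoc, inv_mul_cancel_left₀ (pow_ne_zero _ hc)]

/-- A parameter over a valuation ring with special value `p i`. -/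
theorem exists_eq_smul_of_area (h : IsMultipointParam D Q p q x) {W : Type} (P : Place W)
    {u : Fin 2 → P.O} (hu : ∃ m, u m = 1) {i : Fin k} (hi : P.π (area (P.j ∘ p i) u) = 0) :
    ∃ (l : P.O) (ε : P.O), P.π ε = 0 ∧ P.π l ≠ 0 ∧ u = l • (P.j ∘ p i + ε • P.j ∘ q i) := by
  have harea : area (P.j ∘ p i) (P.j ∘ q i) = 1 := by
    rw [← map_area, h.area_eq_one, map_one]
  have h1 := eq_of_area_eq_one harea u
  set l := area u (P.j ∘ q i)
  set ε := area (P.j ∘ p i) u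
  have hl : P.π l ≠ 0 := by
    intro hl
    obtain ⟨m, hm⟩ := hu
    have h2 := congrArg P.π (congrFun h1 m)
    simp only [hm, Pi.add_apply, Pi.smul_apply, smul_eq_mul, map_add, map_mul, hl, hi, zero_mul,
      add_zero, map_one] at h2
    exact one_ne_zero h2
  have hunit : IsUnit l := by
    by_contra hcon
    exact hl ((IsLocalRing.residue_eq_zero_iff l).mpr hcon)
  obtain ⟨l', hl'⟩ := hunit.exists_right_inv
  refine ⟨l, l' * ε, by rw [map_mul, hi, mul_zero], hl, ?_⟩
  conv_lhs => rw [h1]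
  rw [smul_add, smul_smul, ← mul_assoc, hl', one_mul]

/-- The factor `c` in `z = c Q(u)` is integral if the value of `u` is none of the `p i`. -/
theorem exists_integral_factor (h : IsMultipointParam D Q p q x) {W : Type} (P : Place W)
    (hk : 0 < k) {u : Fin 2 → P.O} (hu : ∃ m, u m = 1) (hi : ∀ i, P.π (area (P.j ∘ p i) u) ≠ 0)
    {z : Fin 4 → P.O} {c : P.K} (hz : ∀ n, (z n : P.K) = c * (paramEval P.j Q u n : P.O)) :
    ∃ c₀ N : P.O, P.π N ≠ 0 ∧ (∀ n, z n = c₀ * paramEval P.j Q u n) ∧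
      ∃ γ : Fin 2 → Fin 4 → ℂ, ∀ m, γ m ⬝ᵥ x = 0 ∧ (P.j ∘ γ m) ⬝ᵥ z = c₀ * N * u m := by
  obtain ⟨m₀, hm₀⟩ := hu
  choose e he using exists_area_eq P.j
  choose γ hγ using fun m => h.exists_dotProduct_paramEval (e m₀) (e m)
  set N := ∏ i, area (P.j ∘ p i) u with hN
  have hN0 : P.π N ≠ 0 := by
    rw [hN, map_prod]
    exact Finset.prod_ne_zero_iff.mpr fun i _ => hi i
  have hunit : IsUnit N := by
    by_contra hcon
    exact hN0 ((IsLocalRing.residue_eq_zero_iff N).mpr hcon)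
  obtain ⟨N', hN'⟩ := hunit.exists_right_inv
  have hdot : ∀ m, (((P.j ∘ γ m) ⬝ᵥ z : P.O) : P.K) = c * (N * u m : P.O) := by
    intro m
    have h1 := hγ m P.j u
    rw [he, he, hm₀, mul_one, ← hN] at h1
    rw [← h1]
    simp only [dotProduct, AddSubmonoidClass.coe_finsetSum, MulMemClass.coe_mul, hz,
      Finset.mul_sum]
    exact Finset.sum_congr rfl fun n _ => by ring
  -- The form `γ m₀` takes the value `c * N` on `z`, because its extra factors are both `u m₀ = 1`,
  -- and `N` is a unit.
  have hc : c = ((P.j ∘ γ m₀) ⬝ᵥ z * N' : P.O) := by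
    rw [MulMemClass.coe_mul, hdot, hm₀, mul_one, mul_assoc, ← MulMemClass.coe_mul, hN']
    simp
  refine ⟨(P.j ∘ γ m₀) ⬝ᵥ z * N', N, hN0, fun n => ?_, γ, fun m => ⟨?_, ?_⟩⟩
  · apply Subtype.val_injective
    rw [hz, MulMemClass.coe_mul, ← hc]
  · have h1 := hγ m (RingHom.id ℂ) (p ⟨0, hk⟩)
    rw [paramEval_id, h.paramEval_point, Finset.prod_eq_zero (Finset.mem_univ ⟨0, hk⟩), zero_mul,
      zero_mul] at h1
    · exact h1
    · simp only [area, Function.comp_apply, RingHom.id_apply]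
      ring
  · apply Subtype.val_injective
    rw [hdot, mul_assoc (_ * _)]
    exact congrArg (· * ((N * u m : P.O) : P.K)) hc

/-- Near `x`, a family of points on the curve follows one of the branches. -/
theorem exists_branch (h : IsMultipointParam D Q p q x) (hk : 0 < k) {W : Type} (P : Place W)
    {A : W → Fin 4 → ℂ} {a : Fin 4 → P.O} (hA : ∀ w, A w ∈ coneOf (paramCurve Q))
    (ha : P.IsNormalForm A a) (hax : ¬ Indep (P.π ∘ a) (P.ρ ∘ x)) :
    ∃ (i : Fin k) (c : P.K) (ε : P.O), P.π ε = 0 ∧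
      ∀ n, (a n : P.K) =
        c * (P.j (x n) + ε * (branchArc Q (p i) (q i) n).divX.eval₂ P.j ε : P.O) := by
  obtain ⟨⟨n₀, hn₀⟩, c', hc', ha⟩ := ha
  obtain ⟨u, hu, c, hc, hAu⟩ := h.exists_normal_parameter P hA
  have hau : ∀ n, (a n : P.K) = (c' * c) * (paramEval P.j Q u n : P.O) := by
    intro n
    rw [ha, hAu, mul_assoc]
  by_cases hcase : ∃ i, P.π (area (P.j ∘ p i) u) = 0
  · obtain ⟨i, hi⟩ := hcase
    obtain ⟨l, ε, hε, -, hul⟩ := h.exists_eq_smul_of_area P hu hi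
    refine ⟨i, c' * c * (l ^ D : P.O), ε, hε, fun n => ?_⟩
    rw [hau, hul, paramEval_smul h.homogeneous, Pi.smul_apply, smul_eq_mul,
      h.paramEval_add_smul, MulMemClass.coe_mul, mul_assoc (c' * c)]
  -- If the parameter tends to no `p i`, the forms `γ m` recover it from `a` up to the factor `c₀ *
  -- N`. They vanish at `x`, to which `a` is proportional after reduction, so `c₀` reduces to zero,
  -- against the normalization of `a`.
  · exfalso
    push Not at hcase
    obtain ⟨c₀, N, hN, hz, γ, hγ⟩ := h.exists_integral_factor P hk hu hcase hau
    have hx0 : P.ρ ∘ x ≠ 0 := by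
      intro h0
      refine h.ne_zero (funext fun n => ?_)
      exact (map_eq_zero P.ρ).mp (congrFun h0 n)
    obtain ⟨t, ht⟩ := (not_indep_iff hx0).mp hax
    have hdot : ∀ m, P.π ((P.j ∘ γ m) ⬝ᵥ a) = 0 := by
      intro m
      have h1 : P.π ((P.j ∘ γ m) ⬝ᵥ a) = (P.ρ ∘ γ m) ⬝ᵥ (P.π ∘ a) := by
        simp [dotProduct, map_sum, Place.ρ_apply]
      have h2 : (P.ρ ∘ γ m) ⬝ᵥ (P.ρ ∘ x) = P.ρ (γ m ⬝ᵥ x) := by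
        simp [dotProduct, map_sum]
      rw [h1, ht, dotProduct_smul, h2, (hγ m).1, map_zero, smul_zero]
    obtain ⟨m, hm⟩ := hu
    have h1 := hdot m
    rw [(hγ m).2, hm, mul_one, map_mul] at h1
    have h2 := congrArg P.π (hz n₀)
    rw [hn₀, map_one, map_mul, (mul_eq_zero.mp h1).resolve_right hN, zero_mul] at h2
    exact one_ne_zero h2

theorem smoothBranches (h : IsMultipointParam D Q p q x) (hk : 0 < k) :
    SmoothBranches (paramCurve Q) x (Set.range fun i => branchTangent Q (p i) (q i)) := by
  intro W P A A' a a' hA hA' ha ha' hax hax'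
  obtain ⟨i, c, ε, hε, hac⟩ := h.exists_branch hk P hA ha hax
  obtain ⟨i', c', ε', hε', hac'⟩ := h.exists_branch hk P hA' ha' hax'
  have hres : ∀ (i : Fin k) (ε : P.O), P.π ε = 0 →
      (P.π ∘ fun n => (branchArc Q (p i) (q i) n).divX.eval₂ P.j ε)
        = P.ρ ∘ branchTangent Q (p i) (q i) := by
    intro i ε hε
    funext n
    rw [Function.comp_apply, Polynomial.hom_eval₂, hε, Polynomial.eval₂_at_zero,
      Polynomial.coeff_divX]
    rfl
  refine ⟨_, ⟨i, rfl⟩, _, ⟨i', rfl⟩, c, c', ε, ε', _, _, hac, hac', hε, hε', hres i ε hε,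
    hres i' ε' hε', fun heq => ?_⟩
  obtain rfl := h.branchTangent_injective heq
  have hdvd : ∀ n, ∃ s, (branchArc Q (p i) (q i) n).divX.eval₂ P.j ε
      - (branchArc Q (p i) (q i) n).divX.eval₂ P.j ε' = (ε - ε') * s := by
    intro n
    rw [Polynomial.eval₂_eq_eval_map, Polynomial.eval₂_eq_eval_map]
    exact Polynomial.sub_dvd_eval_sub _ _ _
  choose s hs using hdvd
  refine ⟨fun n => (branchArc Q (p i) (q i) n).divX.eval₂ P.j ε + ε' * s n, ?_, fun n => ?_⟩
  · rw [← hres i ε hε]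
    funext n
    simp [hε']
  · linear_combination ε' * hs n

/-- Valuative properness: a point of the closure is the limit of points with a parameter over the
valuation ring. If the parameter tends to some `p i` the limit is `x`; otherwise the reduced
parameter turns out to be complex up to a scalar. -/
theorem isClosed_paramCurve (h : IsMultipointParam D Q p q x) (hk : 0 < k) :
    IsClosed (paramCurve Q) := by
  rw [← closure_subset_iff_isClosed]
  intro y hy
  rw [mem_closure_iff_vanishesAt] at hy
  suffices hmem : y.rep ∈ coneOf (paramCurve Q) by
    obtain ⟨_, hmem⟩ := hmem
    rwa [y.mk_rep] at hmem
  have hx : x ∈ coneOf (paramCurve Q) := by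
    refine h.mem_coneOf.mpr ⟨p ⟨0, hk⟩, fun h0 => ?_, 1, one_ne_zero, ?_⟩
    · have h1 := h.area_eq_one ⟨0, hk⟩
      rw [h0] at h1
      simp [area] at h1
    · rw [one_smul, h.paramEval_point]
  have hmul : ∀ {t : ℂ} {v : Fin 4 → ℂ}, v ∈ coneOf (paramCurve Q) → y.rep = t • v →
      y.rep ∈ coneOf (paramCurve Q) := by
    intro t v hv hyv
    rw [hyv]
    refine smul_mem_coneOf hv ?_
    rintro rfl
    exact y.rep_nonzero (hyv.trans (zero_smul _ _))
  let W := ℂ × coneOf (paramCurve Q)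
  obtain ⟨P, z, hz, hzy⟩ := exists_place (fun w : W => w.1 • (w.2 : Fin 4 → ℂ)) y.rep (by
    intro F hF
    rw [← sum_homogeneousComponent F, map_sum]
    refine Finset.sum_eq_zero fun m _ => ?_
    refine hy _ m (homogeneousComponent_isHomogeneous m F) fun v hv => ?_
    refine eval_homogeneousComponent_eq_zero
      (S := {v | ∃ w : W, v = w.1 • (w.2 : Fin 4 → ℂ)}) ?_ ?_ m
      ⟨(1, ⟨v.rep, rep_mem_coneOf hv⟩), (one_smul _ _).symm⟩
    · rintro _ ⟨w, rfl⟩ t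
      exact ⟨(t * w.1, w.2), smul_smul _ _ _⟩
    · rintro _ ⟨w, rfl⟩
      exact hF w)
  obtain ⟨u, hu, c, hc, hAu⟩ := h.exists_normal_parameter P (A := fun w : W => (w.2 : Fin 4 → ℂ))
    fun w => w.2.2
  have hzu : ∀ n, (z n : P.K) = (P.ψ (fun w => w.1) * c) * (paramEval P.j Q u n : P.O) := by
    intro n
    rw [hz, mul_assoc, ← hAu, ← map_mul]
    rfl
  have hπz : P.π ∘ z = P.ρ ∘ y.rep := funext hzy
  -- it suffices to compare over the residue field
  have hfin : ∀ {v : Fin 4 → ℂ} {t : P.κ}, v ∈ coneOf (paramCurve Q) → P.π ∘ z = t • P.ρ ∘ v →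
      y.rep ∈ coneOf (paramCurve Q) := by
    intro v t hv hzv
    have hind : ¬ Indep y.rep v := by
      intro hind
      refine (not_indep_iff ?_).mpr ⟨t, ?_⟩ (hind.map P.ρ)
      · exact (hind.map P.ρ).ne_zero
      · rw [← hπz, hzv]
    obtain ⟨t, ht⟩ := (not_indep_iff hv.choose).mp hind
    exact hmul hv ht
  by_cases hcase : ∃ i, P.π (area (P.j ∘ p i) u) = 0
  · obtain ⟨i, hi⟩ := hcase
    obtain ⟨l, ε, hε, -, hul⟩ := h.exists_eq_smul_of_area P hu hi
    set c' := P.ψ (fun w => w.1) * c * (l ^ D : P.O) with hc'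
    have hz' : ∀ n, (z n : P.K) =
        c' * (P.j (x n) + ε * (branchArc Q (p i) (q i) n).divX.eval₂ P.j ε : P.O) := by
      intro n
      rw [hzu, hul, paramEval_smul h.homogeneous, Pi.smul_apply, smul_eq_mul,
        h.paramEval_add_smul, MulMemClass.coe_mul, hc', mul_assoc (_ * c)]
    set b : Fin 4 → P.O := fun n =>
      P.j (x n) + ε * (branchArc Q (p i) (q i) n).divX.eval₂ P.j ε with hb
    have hπb : P.π ∘ b = P.ρ ∘ x := by
      funext n
      simp only [hb, Function.comp_apply, map_add, map_mul, hε, zero_mul, add_zero]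
      rfl
    obtain ⟨n, hn⟩ := Function.ne_iff.mp h.ne_zero
    have hunit : IsUnit (b n) := by
      by_contra hcon
      have h1 := congrFun hπb n
      rw [Function.comp_apply, (IsLocalRing.residue_eq_zero_iff (b n)).mpr hcon] at h1
      exact hn ((map_eq_zero P.ρ).mp h1.symm)
    obtain ⟨b', hb'⟩ := hunit.exists_right_inv
    have hc0 : c' = (z n * b' : P.O) := by
      have h1 : (z n : P.K) = c' * (b n : P.O) := hz' n
      rw [MulMemClass.coe_mul, h1, mul_assoc, ← MulMemClass.coe_mul, hb']
      simp
    refine hfin (t := P.π (z n * b')) hx ?_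
    rw [← hπb]
    funext m
    have h1 : z m = (z n * b') * b m := by
      apply Subtype.val_injective
      rw [hz', MulMemClass.coe_mul, ← hc0]
    rw [Function.comp_apply, h1, map_mul]
    rfl
  · push Not at hcase
    obtain ⟨c₀, N, hN, hzc, γ, hγ⟩ := h.exists_integral_factor P hk hu hcase hzu
    have hc0 : P.π c₀ ≠ 0 := by
      intro h0
      refine y.rep_nonzero (funext fun n => ?_)
      have h1 := hzy n
      rw [hzc, map_mul, h0, zero_mul] at h1
      exact (map_eq_zero P.ρ).mp h1.symm
    -- The reduced parameter a priori lives in the residue field; the complex forms `γ m` applied to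
    -- the complex vector `y.rep` show that it is proportional to a complex vector.
    set w : Fin 2 → ℂ := fun m => γ m ⬝ᵥ y.rep with hw
    have hρw : P.ρ ∘ w = P.π (c₀ * N) • P.π ∘ u := by
      funext m
      have h1 : P.π ((P.j ∘ γ m) ⬝ᵥ z) = (P.ρ ∘ γ m) ⬝ᵥ (P.π ∘ z) := by
        simp [dotProduct, map_sum, Place.ρ_apply]
      have h2 : (P.ρ ∘ γ m) ⬝ᵥ (P.ρ ∘ y.rep) = P.ρ (γ m ⬝ᵥ y.rep) := by
        simp [dotProduct, map_sum]
      rw [hπz, h2, (hγ m).2, map_mul] at h1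
      exact h1.symm
    have hcN : P.π (c₀ * N) ≠ 0 := by
      rw [map_mul]
      exact mul_ne_zero hc0 hN
    have hw0 : w ≠ 0 := by
      intro h0
      obtain ⟨m, hm⟩ := hu
      have h1 := congrFun hρw m
      rw [Function.comp_apply, h0, Pi.smul_apply, Function.comp_apply, hm, map_one, smul_eq_mul,
        mul_one, Pi.zero_apply, map_zero] at h1
      exact hcN h1.symm
    refine hfin (v := fun n => eval w (Q n)) (t := P.π c₀ * (P.π (c₀ * N) ^ D)⁻¹)
      (h.mem_coneOf.mpr ⟨w, hw0, 1, one_ne_zero, (one_smul _ _).symm⟩) ?_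
    have h1 : P.ρ ∘ (fun n => eval w (Q n)) = paramEval P.ρ Q (P.ρ ∘ w) :=
      map_paramEval P.ρ (RingHom.id ℂ) Q w
    have h2 : P.π ∘ paramEval P.j Q u = paramEval P.ρ Q (P.π ∘ u) := map_paramEval P.π P.j Q u
    rw [h1, hρw, paramEval_smul h.homogeneous, ← h2, smul_smul, mul_assoc,
      inv_mul_cancel₀ (pow_ne_zero _ hcN), mul_one]
    funext n
    rw [Function.comp_apply, hzc, map_mul]
    rfl

end IsMultipointParam

end SecantVeronese

/-! ### Rational curves with a multiple point as multibranch curves -/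

namespace SecantVeronese

open MvPolynomial hiding zeroLocus

theorem eval_aeval_eq {σ τ : Type*} (Q : τ → MvPolynomial σ ℂ) (F : MvPolynomial τ ℂ) (u : σ → ℂ) :
    eval u (aeval Q F) = eval (fun n => eval u (Q n)) F := by
  rw [aeval_def, hom_eval₂]
  have h2 : (eval u).comp (algebraMap ℂ (MvPolynomial σ ℂ)) = RingHom.id ℂ := by
    ext
    simp
  rw [h2]
  rfl

theorem exists_ne_of_three_le {k : ℕ} (hk : 3 ≤ k) (i j : Fin k) : ∃ l, l ≠ i ∧ l ≠ j := by
  by_contra! hcon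
  have h1 : (Finset.univ : Finset (Fin k)) ⊆ {i, j} := by
    intro l _
    rw [Finset.mem_insert, Finset.mem_singleton]
    by_cases h : l = i
    · exact Or.inl h
    · exact Or.inr (hcon l h)
  have h2 := (Finset.card_le_card h1).trans Finset.card_le_two
  rw [Finset.card_univ, Fintype.card_fin] at h2
  omega

namespace IsMultipointParam

variable {k D : ℕ} {Q : Fin 4 → MvPolynomial (Fin 2) ℂ} {p q : Fin k → Fin 2 → ℂ} {x : Fin 4 → ℂ}

/-- Vanishing on the curve is a condition on the pullback to the projective line, which makes
irreducibility a consequence of `ℂ[u₀, u₁]` being a domain. The factor `X 0` in the proof covers `u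
= 0`. -/
theorem forall_vanishesAt_iff (h : IsMultipointParam D Q p q x) {F : MvPolynomial (Fin 4) ℂ} {m : ℕ}
    (hF : F.IsHomogeneous m) : (∀ y ∈ paramCurve Q, VanishesAt F y) ↔ aeval Q F = 0 := by
  constructor
  · intro hv
    refine (mul_eq_zero.mp (?_ : X 0 * aeval Q F = 0)).resolve_left (X_ne_zero 0)
    refine MvPolynomial.funext fun u => ?_
    rw [map_mul, eval_X, map_zero, eval_aeval_eq]
    by_cases hu : u = 0
    · simp [hu]
    · have h1 := hv _ ⟨u, hu, h.eval_ne_zero hu, rfl⟩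
      rw [vanishesAt_mk hF] at h1
      rw [h1, mul_zero]
  · rintro h0 _ ⟨u, hu, hne, rfl⟩
    rw [vanishesAt_mk hF, ← eval_aeval_eq, h0, map_zero]

theorem isProjCurve (h : IsMultipointParam D Q p q x) (hk : 0 < k) :
    IsProjCurve (paramCurve Q) := by
  have hone : (![1, 0] : Fin 2 → ℂ) ≠ 0 := fun h0 => by simpa using congrFun h0 0
  refine ⟨⟨h.isClosed_paramCurve hk, isIrreducible_of_forall_mul
    ⟨_, ![1, 0], hone, h.eval_ne_zero hone, rfl⟩ fun F G m l hF hG hFG => ?_⟩,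
    fun F m hF hFX => ?_⟩
  · rw [h.forall_vanishesAt_iff hF, h.forall_vanishesAt_iff hG, ← mul_eq_zero, ← map_mul,
      ← h.forall_vanishesAt_iff (hF.mul hG)]
    intro y hy
    rw [VanishesAt, map_mul, mul_eq_zero]
    exact hFG y hy
  · have hF0 : aeval Q F ≠ 0 := by
      rw [Ne, ← h.forall_vanishesAt_iff hF]
      push Not
      exact hFX
    have hfin := finite_zeros_of_isHomogeneous (hF.aeval Q h.homogeneous) hF0
    refine (finite_setOf_mk (((hfin.image fun t => ![t, 1]).insert ![1, 0]).image
      fun u n => eval u (Q n))).subset ?_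
    rintro _ ⟨⟨u, hu, hne, rfl⟩, hv⟩
    have key : ∀ (c : ℂ) (w : Fin 2 → ℂ), u = c • w →
        w ∈ insert ![1, 0] ((fun t : ℂ => ![t, 1]) '' {t | eval ![t, 1] (aeval Q F) = 0}) →
        Projectivization.mk ℂ _ hne ∈ {p : PSpace (Fin 4) | ∃ v ∈ (fun u n => eval u (Q n)) ''
          insert ![1, 0] ((fun t : ℂ => ![t, 1]) '' {t | eval ![t, 1] (aeval Q F) = 0}),
          ∃ h : v ≠ 0, p = Projectivization.mk ℂ v h} := by
      intro c w huw hw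
      have hw0 : w ≠ 0 := by
        rintro rfl
        exact hu (huw.trans (smul_zero c))
      refine ⟨_, ⟨w, hw, rfl⟩, h.eval_ne_zero hw0, ?_⟩
      rw [Projectivization.mk_eq_mk_iff']
      refine ⟨c ^ D, ?_⟩
      rw [huw]
      exact (paramEval_smul h.homogeneous (RingHom.id ℂ) c w).symm
    by_cases h1 : u 1 = 0
    · refine key (u 0) ![1, 0] ?_ (Set.mem_insert _ _)
      funext i
      fin_cases i <;> simp [h1]
    · have h2 : u = u 1 • ![u 0 / u 1, 1] := by
        funext i
        fin_cases i <;> simp [mul_div_cancel₀ _ h1]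
      refine key _ _ h2 (Set.mem_insert_of_mem _ ⟨_, ?_, rfl⟩)
      rw [vanishesAt_mk hF, ← eval_aeval_eq, h2,
        eval_smul_of_isHomogeneous (hF.aeval Q h.homogeneous)] at hv
      exact (mul_eq_zero.mp hv).resolve_left (pow_ne_zero _ h1)

/-- For a pair of branches take the form vanishing at `x` and at exactly their two tangents. A third
branch completes these vectors to a basis, so the zeros of the form are exactly their span;
different pairs are told apart by a tangent of one pair missing from the other. -/
theorem exists_planes (h : IsMultipointParam D Q p q x) (hk : 3 ≤ k) :
    ∃ l : Fin (k.choose 2) → Fin 4 → ℂ,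
      (∀ a z, l a ⬝ᵥ z = 0 → ∃ τ ∈ Set.range fun i => branchTangent Q (p i) (q i),
        ∃ τ' ∈ Set.range fun i => branchTangent Q (p i) (q i), z ∈ Submodule.span ℂ {x, τ, τ'}) ∧
      ∀ a b, a ≠ b → ∃ z, l a ⬝ᵥ z = 0 ∧ l b ⬝ᵥ z ≠ 0 := by
  classical
  let e : {s : Finset (Fin k) // s.card = 2} ≃ Fin (k.choose 2) :=
    Fintype.equivFinOfCardEq (by rw [Fintype.card_finset_len, Fintype.card_fin])
  choose i j hij hs using fun a => Finset.card_eq_two.mp (e.symm a).2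
  choose γ hγx hγ using fun a => h.exists_form_tangent (i a) (j a)
  refine ⟨γ, fun a z hz => ⟨_, ⟨i a, rfl⟩, _, ⟨j a, rfl⟩, ?_⟩, fun a b hab => ?_⟩
  · obtain ⟨l, hli, hlj⟩ := exists_ne_of_three_le hk (i a) (j a)
    obtain ⟨c₀, c₁, c₂, c₃, hz'⟩ := h.exists_eq_smul_add (hij a) hli.symm hlj.symm z
    have h1 := (hγ a (i a)).mpr (Or.inl rfl)
    have h2 := (hγ a (j a)).mpr (Or.inr rfl)
    have h3 : γ a ⬝ᵥ branchTangent Q (p l) (q l) ≠ 0 := fun h3 =>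
      ((hγ a l).mp h3).elim hli hlj
    rw [hz'] at hz
    simp only [dotProduct_add, dotProduct_smul, hγx, h1, h2, smul_eq_mul, mul_zero, zero_add,
      mul_eq_zero] at hz
    rw [hz', hz.resolve_right h3, zero_smul, add_zero]
    exact Submodule.mem_span_triple.mpr ⟨c₀, c₁, c₂, rfl⟩
  · have h1 : ∃ m ∈ (e.symm a).1, m ∉ (e.symm b).1 := by
      by_contra! hcon
      refine hab (e.symm.injective (Subtype.ext (Finset.eq_of_subset_of_card_le hcon ?_)))
      rw [(e.symm a).2, (e.symm b).2]
    obtain ⟨m, hma, hmb⟩ := h1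
    rw [hs] at hma hmb
    refine ⟨branchTangent Q (p m) (q m), (hγ a m).mpr (by simpa using hma), fun h0 => ?_⟩
    exact hmb (by simpa using (hγ b m).mp h0)

theorem isMultibranchPoint (h : IsMultipointParam D Q p q x) (hk : 3 ≤ k) :
    IsMultibranchPoint (k.choose 2) (paramCurve Q) x
      (Set.range fun i => branchTangent Q (p i) (q i)) where
  finite := Set.finite_range _
  nonempty := ⟨_, ⟨0, by omega⟩, rfl⟩
  branches := h.smoothBranches (by omega)
  tangent := by
    rintro _ ⟨i, rfl⟩
    exact h.isArcTangent i
  indep := by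
    rintro _ ⟨i, rfl⟩
    obtain ⟨j, hj, -⟩ := exists_ne_of_three_le hk i i
    obtain ⟨γ, hγx, hγ⟩ := h.exists_form_tangent j j
    exact ⟨γ, hγx, fun h0 => hj (or_self_iff.mp ((hγ i).mp h0)).symm⟩
  indep_pair := by
    rintro _ ⟨i, rfl⟩ _ ⟨j, rfl⟩ hne
    obtain ⟨γ, hγx, hγ⟩ := h.exists_form_tangent j j
    refine ⟨γ, hγx, fun h0 => hne ?_, (hγ j).mpr (Or.inl rfl)⟩
    rw [or_self_iff.mp ((hγ i).mp h0)]
  span_eq_top := by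
    rw [eq_top_iff]
    rintro z -
    obtain ⟨c₀, c₁, c₂, c₃, rfl⟩ := h.exists_eq_smul_add
      (i := ⟨0, by omega⟩) (j := ⟨1, by omega⟩) (l := ⟨2, by omega⟩) (by simp) (by simp) (by simp) z
    have hx := Submodule.subset_span (R := ℂ)
      (Set.mem_insert x (Set.range fun i => branchTangent Q (p i) (q i)))
    have hτ : ∀ i, branchTangent Q (p i) (q i) ∈ Submodule.span ℂ
        (insert x (Set.range fun i => branchTangent Q (p i) (q i))) := fun i =>
      Submodule.subset_span (Set.mem_insert_of_mem _ ⟨i, rfl⟩)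
    exact add_mem (add_mem (add_mem (Submodule.smul_mem _ _ hx) (Submodule.smul_mem _ _ (hτ _)))
      (Submodule.smul_mem _ _ (hτ _))) (Submodule.smul_mem _ _ (hτ _))
  planes := h.exists_planes hk

end IsMultipointParam

/-! ### Projections of rational normal curves -/

section Projection

variable {d : ℕ} (L : (Sym (Fin 2) d → ℂ) →ₗ[ℂ] (Fin 4 → ℂ))

/-- The binary forms that define the projection of a rational normal curve. -/
noncomputable def projectionForms (n : Fin 4) : MvPolynomial (Fin 2) ℂ :=
  ∑ s : Sym (Fin 2) d, C (L (Pi.single s 1) n) * ((s : Multiset (Fin 2)).map X).prod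

theorem projectionForms_isHomogeneous (n : Fin 4) : (projectionForms L n).IsHomogeneous d := by
  refine IsHomogeneous.sum _ _ _ fun s _ => ?_
  have h : ∀ m : Multiset (Fin 2),
      ((m.map X).prod : MvPolynomial (Fin 2) ℂ).IsHomogeneous m.card := by
    intro m
    induction m using Multiset.induction with
    | empty => simpa using isHomogeneous_one (Fin 2) ℂ
    | cons a m ih =>
      rw [Multiset.map_cons, Multiset.prod_cons, Multiset.card_cons, add_comm]
      exact (isHomogeneous_X ℂ a).mul ih
  have hs : (((s : Multiset (Fin 2)).map X).prod : MvPolynomial (Fin 2) ℂ).IsHomogeneous d := by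
    simpa using h s
  simpa using (isHomogeneous_C (Fin 2) (L (Pi.single s 1) n)).mul hs

theorem eval_projectionForms (u : Fin 2 → ℂ) (n : Fin 4) :
    eval u (projectionForms L n) = L (ver d u) n := by
  conv_rhs => rw [pi_eq_sum_univ' (ver d u)]
  simp only [projectionForms, map_sum, map_mul, eval_C, map_smul, Finset.sum_apply, Pi.smul_apply,
    smul_eq_mul, map_multiset_prod, Multiset.map_map]
  refine Finset.sum_congr rfl fun s _ => ?_
  rw [mul_comm]
  congr 2
  simp

theorem projectedImage_eq_paramCurve :
    projectedImage L (rationalNormalCurve d) = paramCurve (projectionForms L) := by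
  have hφ : ∀ u : Fin 2 → ℂ, (fun n => eval u (projectionForms L n)) = L (ver d u) := by
    intro u
    funext n
    rw [eval_projectionForms]
  have hrep : ∀ u : Fin 2 → ℂ, ∀ hu : u ≠ 0, ∃ a : ℂ, a ≠ 0 ∧
      (veronese d (Projectivization.mk ℂ u hu)).rep = a • ver d u := by
    intro u hu
    rw [veronese_mk]
    obtain ⟨a, ha⟩ := Projectivization.exists_smul_eq_mk_rep ℂ _ (veroneseVec_ne_zero d hu)
    exact ⟨a, a.ne_zero, ha.symm⟩
  ext y
  constructor
  · rintro ⟨_, ⟨z, rfl⟩, h, rfl⟩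
    obtain ⟨a, ha, hz⟩ := hrep z.rep z.rep_nonzero
    rw [z.mk_rep] at hz
    have h1 : L (veronese d z).rep = a • fun n => eval z.rep (projectionForms L n) := by
      rw [hφ, hz, map_smul]
    have h2 : (fun n => eval z.rep (projectionForms L n)) ≠ 0 := by
      intro h0
      exact h (h1.trans (by rw [h0, smul_zero]))
    refine ⟨z.rep, z.rep_nonzero, h2, ?_⟩
    rw [Projectivization.mk_eq_mk_iff']
    exact ⟨a, h1.symm⟩
  · rintro ⟨u, hu, h, rfl⟩
    obtain ⟨a, ha, hz⟩ := hrep u hu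
    have h1 : L (veronese d (Projectivization.mk ℂ u hu)).rep
        = a • fun n => eval u (projectionForms L n) := by
      rw [hφ, hz, map_smul]
    refine ⟨_, ⟨Projectivization.mk ℂ u hu, rfl⟩, ?_, ?_⟩
    · rw [h1]
      exact smul_ne_zero ha h
    · rw [eq_comm, Projectivization.mk_eq_mk_iff']
      exact ⟨a, h1.symm⟩

end Projection

end SecantVeronese

/-! ### Projections of rational normal curves from hyperplanes of spans of points -/

namespace SecantVeronese

open MvPolynomial hiding zeroLocus

/-- The map `L` contracts the span of `k` vectors to a line if its kernel is contained in this span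
and has dimension `k - 1`. -/
theorem exists_forall_eq_smul {V V' : Type*} [AddCommGroup V] [Module ℂ V] [FiniteDimensional ℂ V]
    [AddCommGroup V'] [Module ℂ V'] {L : V →ₗ[ℂ] V'} (hL : Function.Surjective L) {k : ℕ}
    (v : Fin k → V) (hker : LinearMap.ker L ≤ Submodule.span ℂ (Set.range v))
    (hdim : Module.finrank ℂ V + 1 = k + Module.finrank ℂ V') :
    ∃ x : V', ∀ i, ∃ t : ℂ, t • x = L (v i) := by
  set S := Submodule.span ℂ (Set.range v) with hS
  have h1 := LinearMap.finrank_range_add_finrank_ker L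
  rw [LinearMap.range_eq_top.mpr hL, finrank_top] at h1
  have h2 := LinearMap.finrank_range_add_finrank_ker (L ∘ₗ S.subtype)
  have h3 : LinearMap.ker (L ∘ₗ S.subtype) = (LinearMap.ker L).comap S.subtype :=
    LinearMap.ker_comp _ _
  rw [h3, (Submodule.comapSubtypeEquivOfLe hker).finrank_eq] at h2
  have h4 : Module.finrank ℂ S ≤ k := (finrank_range_le_card v).trans_eq (Fintype.card_fin k)
  obtain ⟨x, hx⟩ := finrank_le_one_iff.mp
    (by omega : Module.finrank ℂ (LinearMap.range (L ∘ₗ S.subtype)) ≤ 1)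
  refine ⟨x, fun i => ?_⟩
  obtain ⟨t, ht⟩ := hx ⟨L (v i), ⟨⟨v i, Submodule.subset_span ⟨i, rfl⟩⟩, rfl⟩⟩
  exact ⟨t, congrArg Subtype.val ht⟩

theorem exists_area_eq_one {p : Fin 2 → ℂ} (hp : p ≠ 0) : ∃ q, area p q = 1 := by
  by_cases h0 : p 0 = 0
  · have h1 : p 1 ≠ 0 := by
      intro h1
      refine hp (funext fun m => ?_)
      fin_cases m
      exacts [h0, h1]
    exact ⟨![-(p 1)⁻¹, 0], by simp [area, h1]⟩
  · exact ⟨![0, (p 0)⁻¹], by simp [area, h0]⟩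

theorem area_ne_zero_of_indep {p q : Fin 2 → ℂ} (h : Indep p q) : area p q ≠ 0 := by
  rintro h0
  obtain ⟨m, n, hmn⟩ := h
  apply hmn
  simp only [area] at h0
  fin_cases m <;> fin_cases n <;> simp only [Fin.zero_eta, Fin.mk_one]
  · ring
  · exact h0
  · linear_combination -h0
  · ring

/-- A product of linear forms vanishing on the kernel of `L` is a linear form in the forms defining
the projection. -/
theorem exists_sum_projectionForms {d : ℕ} {L : (Sym (Fin 2) d → ℂ) →ₗ[ℂ] (Fin 4 → ℂ)}
    (hL : Function.Surjective L) (w : Fin d → Fin 2 → ℂ)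
    (hw : ∀ z ∈ LinearMap.ker L, pair w z = 0) :
    ∃ γ : Fin 4 → ℂ, ∀ u, ∑ n, γ n * eval u (projectionForms L n) = ∏ m, w m ⬝ᵥ u := by
  obtain ⟨g, hg⟩ := L.exists_rightInverse_of_surjective (LinearMap.range_eq_top.mpr hL)
  refine ⟨fun n => pair w (g (Pi.single n 1)), fun u => ?_⟩
  have h1 : ver d u = (ver d u - g (L (ver d u))) + ∑ n, L (ver d u) n • g (Pi.single n 1) := by
    have h2 : ∑ n, L (ver d u) n • g (Pi.single n 1) = g (L (ver d u)) := by
      conv_rhs => rw [pi_eq_sum_univ' (L (ver d u))]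
      simp only [map_sum, map_smul]
    rw [h2, sub_add_cancel]
  have h3 : ver d u - g (L (ver d u)) ∈ LinearMap.ker L := by
    rw [LinearMap.mem_ker, map_sub, sub_eq_zero]
    exact (LinearMap.congr_fun hg (L (ver d u))).symm
  rw [← pair_ver]
  conv_rhs => rw [h1]
  rw [pair_add, hw _ h3, zero_add, pair_sum]
  refine Finset.sum_congr rfl fun n _ => ?_
  rw [pair_smul, eval_projectionForms, mul_comm]

/-- The kernel has dimension `k - 1` inside the span of the `k` points, so `L` maps all of them to
one line, spanned by `x`. A form of degree `k + 2` vanishing at the `k` parameters is a linear form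
on `S^(k+2)` that kills this span and hence the kernel, so it factors through `L`; two zeros remain
free. -/
theorem exists_isMultipointParam {k : ℕ} (hk : 0 < k) {c : Fin k → PSpace (Sym (Fin 2) (k + 2))}
    (hc : Function.Injective c) (hcC : ∀ i, c i ∈ rationalNormalCurve (k + 2))
    {L : (Sym (Fin 2) (k + 2) → ℂ) →ₗ[ℂ] (Fin 4 → ℂ)} (hL : Function.Surjective L)
    (hker : LinearMap.ker L ≤ Submodule.span ℂ (Set.range fun i => (c i).rep))
    (hcL : ∀ i, (c i).rep ∉ LinearMap.ker L) :
    ∃ (p q : Fin k → Fin 2 → ℂ) (x : Fin 4 → ℂ),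
      IsMultipointParam (k + 2) (projectionForms L) p q x := by
  choose y hy using hcC
  have hrep : ∀ i, ∃ a : ℂ, a ≠ 0 ∧ (c i).rep = a • ver (k + 2) (y i).rep := by
    intro i
    rw [← hy, ← (y i).mk_rep, veronese_mk, (y i).mk_rep]
    obtain ⟨a, ha⟩ := Projectivization.exists_smul_eq_mk_rep ℂ _
      (veroneseVec_ne_zero (k + 2) (y i).rep_nonzero)
    exact ⟨a, a.ne_zero, ha.symm⟩
  choose a ha hca using hrep
  have hdim : Module.finrank ℂ (Sym (Fin 2) (k + 2) → ℂ) + 1 =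
      k + Module.finrank ℂ (Fin 4 → ℂ) := by
    rw [Module.finrank_fintype_fun_eq_card, Module.finrank_fintype_fun_eq_card,
      Sym.card_sym_eq_multichoose, Fintype.card_fin, Fintype.card_fin, Nat.multichoose_two]
  obtain ⟨x, hx⟩ := exists_forall_eq_smul hL _ hker hdim
  choose t ht using hx
  have ht0 : ∀ i, t i ≠ 0 := by
    intro i h0
    have h1 := ht i
    rw [h0, zero_smul] at h1
    exact hcL i h1.symm
  have hx0 : x ≠ 0 := by
    rintro rfl
    have h1 := ht ⟨0, hk⟩
    rw [smul_zero] at h1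
    exact hcL _ h1.symm
  -- Rescaling the parameters by `(k + 2)`-th roots makes their images equal to `x` itself, not only
  -- proportional to it.
  choose s hs using fun i => IsAlgClosed.exists_pow_nat_eq (a i * (t i)⁻¹) (n := k + 2) (by omega)
  have hs0 : ∀ i, s i ≠ 0 := by
    intro i h0
    have h1 := hs i
    rw [h0, zero_pow (by omega)] at h1
    exact mul_ne_zero (ha i) (inv_ne_zero (ht0 i)) h1.symm
  have hver : ∀ i, ver (k + 2) (s i • (y i).rep) = (t i)⁻¹ • (c i).rep := by
    intro i
    rw [ver_smul, hs, hca, smul_smul, mul_comm]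
  have hp0 : ∀ i, s i • (y i).rep ≠ 0 := fun i => smul_ne_zero (hs0 i) (y i).rep_nonzero
  choose q hq using fun i => exists_area_eq_one (hp0 i)
  refine ⟨fun i => s i • (y i).rep, q, x, projectionForms_isHomogeneous L, hx0, fun i n => ?_, hq,
    fun i j hij => area_ne_zero_of_indep (indep_of_mk_ne (hp0 i) (hp0 j) ?_), fun e e' => ?_⟩
  · rw [eval_projectionForms, hver, map_smul, ← ht, smul_smul, inv_mul_cancel₀ (ht0 i), one_smul]
  · intro heq
    have hmk : ∀ i, Projectivization.mk ℂ (s i • (y i).rep) (hp0 i) = y i := by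
      intro i
      conv_rhs => rw [← (y i).mk_rep]
      rw [Projectivization.mk_eq_mk_iff']
      exact ⟨s i, rfl⟩
    rw [hmk, hmk] at heq
    exact hij (hc (by rw [← hy, ← hy, heq]))
  · let perp : (Fin 2 → ℂ) → Fin 2 → ℂ := fun e => ![-e 1, e 0]
    have hperp : ∀ e u : Fin 2 → ℂ, perp e ⬝ᵥ u = area e u := by
      intro e u
      simp only [perp, dotProduct, Fin.sum_univ_two, area, Matrix.cons_val]
      ring
    let w : Fin (k + 2) → Fin 2 → ℂ :=
      Fin.append (fun i => perp (s i • (y i).rep)) ![perp e, perp e']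
    have hprod : ∀ u, ∏ m, w m ⬝ᵥ u
        = (∏ i, area (s i • (y i).rep) u) * area e u * area e' u := by
      intro u
      rw [Fin.prod_univ_add, Fin.prod_univ_two]
      simp only [w, Fin.append_left, Fin.append_right, hperp, Matrix.cons_val, mul_assoc]
    obtain ⟨γ, hγ⟩ := exists_sum_projectionForms hL w (by
      intro z hz
      refine Submodule.span_induction (p := fun z _ => pair w z = 0) ?_ ?_ ?_ ?_ (hker hz)
      · rintro _ ⟨i, rfl⟩
        have h1 : (c i).rep = t i • ver (k + 2) (s i • (y i).rep) := by
          rw [hver, smul_smul, mul_inv_cancel₀ (ht0 i), one_smul]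
        have h2 : area (s i • (y i).rep) (s i • (y i).rep) = 0 := by
          simp only [area]
          ring
        simp only [h1, pair_smul, pair_ver, hprod]
        rw [Finset.prod_eq_zero (Finset.mem_univ i) h2, zero_mul, zero_mul, mul_zero]
      · simp [pair]
      · intro z z' _ _ h1 h2
        rw [pair_add, h1, h2, add_zero]
      · intro b z _ h1
        rw [pair_smul, h1, mul_zero])
    refine ⟨γ, MvPolynomial.funext fun u => ?_⟩
    have harea : ∀ b : Fin 2 → ℂ, eval u (area (C ∘ b) (X : Fin 2 → MvPolynomial (Fin 2) ℂ))
        = area b u := by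
      intro b
      simp [area]
    simp only [map_sum, map_mul, map_prod, eval_C, harea]
    rw [hγ, hprod]

/-- The projections of rational normal curves. -/
theorem projectedImage_properties {k : ℕ} (hk : 4 ≤ k) {c : Fin k → PSpace (Sym (Fin 2) (k + 2))}
    (hc : Function.Injective c) (hcC : ∀ i, c i ∈ rationalNormalCurve (k + 2))
    {L : (Sym (Fin 2) (k + 2) → ℂ) →ₗ[ℂ] (Fin 4 → ℂ)} (hL : Function.Surjective L)
    (hker : LinearMap.ker L ≤ Submodule.span ℂ (Set.range fun i => (c i).rep))
    (hcL : ∀ i, (c i).rep ∉ LinearMap.ker L) {X : Set (PSpace (Fin 4))}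
    (hX : X = projectedImage L (rationalNormalCurve (k + 2))) :
    IsSingularVariety X ∧ topologicalKrullDim X = 1 ∧ ¬ EKSHolds X ∧
      ∀ r d : ℕ, 2 ≤ r → 2 * r - 1 ≤ d →
        secantVariety r (veronese d '' X) ≠
          secantVariety r (Set.range (veronese (σ := Fin 4) d)) ∩
            linearSpan (veronese d '' X) ∧
        ∀ q : ℕ, q < k.choose 2 →
          ¬ IsCutOutInDegreeLE q (secantVariety r (veronese d '' X)) := by
  obtain ⟨p, q, x, h⟩ := exists_isMultipointParam (by omega) hc hcC hL hker hcL
  rw [hX, projectedImage_eq_paramCurve]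
  have hM := h.isMultibranchPoint (by omega)
  obtain ⟨hsing, hdim, hinf⟩ := hM.isSingularVariety (by simp) (h.isProjCurve (by omega))
  exact ⟨hsing, hdim, hM.not_eksHolds (by simp) hinf, fun r d hr hd =>
    ⟨hM.secantVariety_ne (by simp) hinf hr hd, fun q hq =>
      hM.not_isCutOutInDegreeLE (by simp) hinf hr hd hq⟩⟩

end SecantVeronese

theorem theorem1p3 :
    -- existence of irreducible singular varieties, for every bound `q` and every `r ≥ 2`
    (∀ q r : ℕ, 2 ≤ r → ∃ (n : ℕ) (X : Set (PSpace (Fin (n + 1)))), IsSingularVariety X ∧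
      ∀ d : ℕ, 2 * r - 1 ≤ d →
        secantVariety r (veronese d '' X) ≠
          secantVariety r (Set.range (veronese (σ := Fin (n + 1)) d)) ∩
            linearSpan (veronese d '' X) ∧
        ¬ IsCutOutInDegreeLE q (secantVariety r (veronese d '' X))) ∧
    -- explicit curves: projections of rational normal curves from a hyperplane `P(ker L)` of the
    -- span of `k` points, the hyperplane containing none of these points
    (∀ (k : ℕ), 4 ≤ k → ∀ (c : Fin k → PSpace (Sym (Fin 2) (k + 2))), Function.Injective c →
      (∀ i, c i ∈ rationalNormalCurve (k + 2)) →
      ∀ (L : (Sym (Fin 2) (k + 2) → ℂ) →ₗ[ℂ] (Fin 4 → ℂ)), Function.Surjective L →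
      LinearMap.ker L ≤ Submodule.span ℂ (Set.range fun i => (c i).rep) →
      (∀ i, (c i).rep ∉ LinearMap.ker L) →
      ∀ X : Set (PSpace (Fin 4)), X = projectedImage L (rationalNormalCurve (k + 2)) →
        IsSingularVariety X ∧ topologicalKrullDim X = 1 ∧ ¬ EKSHolds X ∧
        ∀ r d : ℕ, 2 ≤ r → 2 * r - 1 ≤ d →
          secantVariety r (veronese d '' X) ≠
            secantVariety r (Set.range (veronese (σ := Fin 4) d)) ∩
              linearSpan (veronese d '' X) ∧
          ∀ q : ℕ, q < k.choose 2 →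
            ¬ IsCutOutInDegreeLE q (secantVariety r (veronese d '' X))) ∧
    -- complete intersection curves `x₀ ^ s * g + h = x₀ ^ s' * g' + h' = 0` in `P^3`
    (∀ q : ℕ, ∃ (s s' t t' : ℕ) (g g' h h' : MvPolynomial (Fin 3) ℂ)
      (f f' : MvPolynomial (Fin 4) ℂ) (X : Set (PSpace (Fin 4))),
      1 ≤ s ∧ 1 ≤ s' ∧ 2 ≤ t ∧ 2 ≤ t' ∧
      g.IsHomogeneous t ∧ g'.IsHomogeneous t' ∧
      h.IsHomogeneous (s + t) ∧ h'.IsHomogeneous (s' + t') ∧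
      f = MvPolynomial.X 0 ^ s * MvPolynomial.rename Fin.succ g +
        MvPolynomial.rename Fin.succ h ∧
      f' = MvPolynomial.X 0 ^ s' * MvPolynomial.rename Fin.succ g' +
        MvPolynomial.rename Fin.succ h' ∧
      X = zeroLocus {f, f'} ∧ homogeneousIdeal X = Ideal.span {f, f'} ∧
      IsSingularVariety X ∧ topologicalKrullDim X = 1 ∧ ¬ EKSHolds X ∧
      ∀ r d : ℕ, 2 ≤ r → 2 * r - 1 ≤ d →
        secantVariety r (veronese d '' X) ≠
          secantVariety r (Set.range (veronese (σ := Fin 4) d)) ∩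
            linearSpan (veronese d '' X) ∧
        ¬ IsCutOutInDegreeLE q (secantVariety r (veronese d '' X))) := by
  refine ⟨fun q r hr => ?_, fun k hk c hc hcC L hL hker hcL X hX =>
    SecantVeronese.projectedImage_properties hk hc hcC hL hker hcL hX,
    SecantVeronese.exists_completeIntersection⟩
  -- The complete intersection curve for `q` serves all `r` at once.
  obtain ⟨_, _, _, _, _, _, _, _, _, _, X, -, -, -, -, -, -, -, -, -, -, -, -, hX, -, -, h⟩ :=
    SecantVeronese.exists_completeIntersection q
  exact ⟨3, X, hX, fun d hd => h r d hr hd⟩
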